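/- Let $X$ be a compact complex manifold of dimension $n\ge 1$ with a smooth Hermitian metric, with associated positive $(1,1)$-form $\omega$. A function $u$ on $X$ is $\omega$-plurisubharmonic ($\omega$-psh) if it is quasi-plurisubharmonic (locally the sum of a plurisubharmonic and a smooth function) and $\omega+dd^c u\ge 0$ in the sense of currents. Put $$\mathcal S=\{v\ \omega\text{-psh on } X:\ -1\le v\le 0,\ \sup_X v=0\}.$$ For a positive Borel measure $\mu$ on $X$ let $\hat\mu(v)=\int_X v\,d\mu$. We say that $\hat\mu$ is Hölder continuous on $\mathcal S$ if $\hat\mu$ is finite on $\mathcal S$ and there are $C>0$, $\alpha>0$ with $$|\hat\mu(u)-\hat\mu(v)|\le C\Big(\int_X|u-v|\,\omega^n\Big)^{\alpha}\qquad\text{for all }u,v\in\mathcal S .$$ For an open set $\Omega\subset\mathbb C^n$ let $\mathcal S_0(\Omega)$ be the set of plurisubharmonic functions $v$ on $\Omega$ with $-1\le v\le 0$. For a positive Borel measure $\nu$ on $\Omega$, the functional $\hat\nu(\varphi)=\int_\Omega\varphi\,d\nu$ is locally Hölder continuous on $\mathcal S_0(\Omega)$ if for every open $\Omega'\subset\subset\Omega$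 there are $C>0$, $\alpha>0$ with $$\int_{\Omega'}|\varphi-\psi|\,d\nu\le C\Big(\int_\Omega|\varphi-\psi|\,dV_{2n}\Big)^{\alpha}\qquad\text{for all }\varphi,\psi\in\mathcal S_0(\Omega).$$ We say that $\hat\mu$ is locally Hölder continuous in a holomorphic coordinate chart $e:U\to\Omega\subset\mathbb C^n$ of $X$ if this holds for $\Omega=e(U)$ and $\nu=e_*(\mu|_U)$. Lemma. Let $\mu$ be a positive Borel measure on $X$. Then $\hat\mu$ is Hölder continuous on $\mathcal S$ if and only if it is locally Hölder continuous in every holomorphic coordinate chart of $X$ whose image is a strictly pseudoconvex domain (a bounded domain $\{\rho<0\}$ with a strictly plurisubharmonic $C^2$ defining function $\rho$, defined on a neighbourhood of its closure, with $d\rho\neq 0$ on the boundary). It is likewise equivalent that $\hat\mu$ be locally Hölder continuous in every holomorphic coordinate chart of $X$, without restriction on its image. -/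

import Mathlib

open MeasureTheory Set
open scoped ContDiff Manifold ComplexConjugate

noncomputable section

/-! ### Plurisubharmonic functions on open subsets of `ℂⁿ` -/

/-- The Levi form of `f` at `z` in the direction `v`, that is `4 ∑ ∂²f/∂z_j∂z̄_k v_j v̄_k`, which is
the Laplacian at `ζ = 0` of `ζ ↦ f (z + ζ v)` and the value of `dd^c f` on `(v, i v)`, for
`dd^c = 2 i ∂∂̄`. -/
def leviForm {n : ℕ} (f : (Fin n → ℂ) → ℝ) (z v : Fin n → ℂ) : ℝ :=
  iteratedFDeriv ℝ 2 f z ![v, v] +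
    iteratedFDeriv ℝ 2 f z ![Complex.I • v, Complex.I • v]

/-- A real valued function `u` is plurisubharmonic on `Ω`: it is upper semicontinuous and satisfies
the sub-mean value inequality on each closed complex disc `{a + ζ b : |ζ| ≤ 1}` inside `Ω`.
(A mean value equal to `-∞` is impossible here, since `u a` is finite: hence the integrability.) -/
def IsPSHOn {n : ℕ} (u : (Fin n → ℂ) → ℝ) (Ω : Set (Fin n → ℂ)) : Prop :=
  UpperSemicontinuousOn u Ω ∧
    ∀ a b : Fin n → ℂ, (∀ ζ : ℂ, ‖ζ‖ ≤ 1 → a + ζ • b ∈ Ω) →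
      CircleIntegrable (fun ζ : ℂ => u (a + ζ • b)) 0 1 ∧
        u a ≤ Real.circleAverage (fun ζ : ℂ => u (a + ζ • b)) 0 1

/-- Strictly pseudoconvex domains: bounded domains with a strictly plurisubharmonic defining
function of class `C²` on a neighbourhood of the closure. -/
structure IsStrictlyPseudoconvexDomain {n : ℕ} (Ω : Set (Fin n → ℂ)) : Prop where
  isOpen : IsOpen Ω
  isConnected : IsConnected Ω
  isBounded : Bornology.IsBounded Ω
  exists_defining : ∃ (W : Set (Fin n → ℂ)) (ρ : (Fin n → ℂ) → ℝ),
    IsOpen W ∧ closure Ω ⊆ W ∧ ContDiffOn ℝ 2 ρ W ∧ Ω = {z ∈ W | ρ z < 0} ∧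
      (∀ z ∈ frontier Ω, fderiv ℝ ρ z ≠ 0) ∧
      ∀ z ∈ W, ∀ v : Fin n → ℂ, v ≠ 0 → 0 < leviForm ρ z v

/-- The class `S₀(Ω)` of plurisubharmonic functions with values in `[-1, 0]`. -/
def classS₀ {n : ℕ} (Ω : Set (Fin n → ℂ)) : Set ((Fin n → ℂ) → ℝ) :=
  {v | IsPSHOn v Ω ∧ ∀ z ∈ Ω, -1 ≤ v z ∧ v z ≤ 0}

/-- The functional `φ ↦ ∫ φ dν` is locally Hölder continuous on `S₀(Ω)`. -/
def IsLocallyHolderOnS₀ {n : ℕ} (Ω : Set (Fin n → ℂ)) (ν : Measure (Fin n → ℂ)) : Prop :=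
  ∀ Ω' : Set (Fin n → ℂ), IsOpen Ω' → IsCompact (closure Ω') → closure Ω' ⊆ Ω →
    ∃ C α : ℝ, 0 < C ∧ 0 < α ∧ ∀ φ ∈ classS₀ Ω, ∀ ψ ∈ classS₀ Ω,
      ∫⁻ z in Ω', ENNReal.ofReal |φ z - ψ z| ∂ν ≤
        ENNReal.ofReal C * (∫⁻ z in Ω, ENNReal.ofReal |φ z - ψ z|) ^ α

/-! ### Hermitian metrics on complex manifolds -/

section Manifold

variable {n : ℕ} {X : Type*} [TopologicalSpace X] [ChartedSpace (Fin n → ℂ) X]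

/-- The expression at `z`, in the coordinates of the chart `e`, of a sesquilinear form on the
holomorphic tangent bundle. -/
def formInChart
    (h : ∀ x : X, TangentSpace 𝓘(ℂ, Fin n → ℂ) x →ₗ⋆[ℂ] TangentSpace 𝓘(ℂ, Fin n → ℂ) x →ₗ[ℂ] ℂ)
    (e : OpenPartialHomeomorph X (Fin n → ℂ)) (z v w : Fin n → ℂ) : ℂ :=
  h (e.symm z) (mfderiv 𝓘(ℂ, Fin n → ℂ) 𝓘(ℂ, Fin n → ℂ) e.symm z v)
    (mfderiv 𝓘(ℂ, Fin n → ℂ) 𝓘(ℂ, Fin n → ℂ) e.symm z w)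

variable (n X) in
/-- A (smooth) Hermitian metric on the complex manifold `X`. If its matrix in a chart is `(h_jk)`,
the associated positive `(1,1)`-form is `ω = (i/2) ∑ h_jk dz_j ∧ dz̄_k`, so that the value of `ω` on
`(v, i v)` is `h(v, v)`. -/
structure HermitianMetric where
  form : ∀ x : X, TangentSpace 𝓘(ℂ, Fin n → ℂ) x →ₗ⋆[ℂ] TangentSpace 𝓘(ℂ, Fin n → ℂ) x →ₗ[ℂ] ℂ
  conj_symm : ∀ x v w, conj (form x w v) = form x v w
  pos : ∀ x v, v ≠ 0 → 0 < (form x v v).re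
  smooth : ∀ e ∈ IsManifold.maximalAtlas 𝓘(ℂ, Fin n → ℂ) ω X, ∀ v w : Fin n → ℂ,
    ContDiffOn ℝ ∞ (fun z => formInChart form e z v w) e.target

/-- The measure `ω^n = n! det(h_jk) dV` on the domain of the chart `e`, extended by zero. -/
def HermitianMetric.chartVolume [MeasurableSpace X] (g : HermitianMetric n X)
    (e : OpenPartialHomeomorph X (Fin n → ℂ)) : Measure X :=
  ((volume.restrict e.target).withDensity fun z => ENNReal.ofReal (n.factorial *
    (Matrix.det (Matrix.of fun j k : Fin n =>
      formInChart g.form e z (Pi.single j 1) (Pi.single k 1))).re)).map e.symm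

/-- The volume measure `ω^n` on `X`: the least measure that dominates, hence the measure that
restricts to, the measure `n! det(h_jk) dV` on the domain of every holomorphic chart (these agree
on overlaps). -/
def HermitianMetric.volume [MeasurableSpace X] (g : HermitianMetric n X) : Measure X :=
  ⨆ e ∈ IsManifold.maximalAtlas 𝓘(ℂ, Fin n → ℂ) ω X, g.chartVolume e

variable (n) in
/-- Quasi-plurisubharmonic (real valued) functions: in every holomorphic chart, `u` is locally the
sum of a plurisubharmonic and a smooth function. -/
def IsQuasiPSH (u : X → ℝ) : Prop :=
  ∀ e ∈ IsManifold.maximalAtlas 𝓘(ℂ, Fin n → ℂ) ω X, ∀ z ∈ e.target,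
    ∃ (V : Set (Fin n → ℂ)) (p f : (Fin n → ℂ) → ℝ), IsOpen V ∧ z ∈ V ∧ V ⊆ e.target ∧
      IsPSHOn p V ∧ ContDiffOn ℝ ∞ f V ∧ ∀ w ∈ V, u (e.symm w) = p w + f w

/-- Real valued `ω`-plurisubharmonic functions: quasi-plurisubharmonic functions with
`ω + dd^c u ≥ 0` in the sense of currents. Positivity of a `(1,1)`-current on an open subset of
`ℂⁿ` is positivity of the distribution it gives in each constant direction `v`. -/
def IsOmegaPSH (g : HermitianMetric n X) (u : X → ℝ) : Prop :=
  IsQuasiPSH n u ∧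
    ∀ e ∈ IsManifold.maximalAtlas 𝓘(ℂ, Fin n → ℂ) ω X, ∀ (v : Fin n → ℂ) (χ : (Fin n → ℂ) → ℝ),
      ContDiff ℝ ∞ χ → HasCompactSupport χ → tsupport χ ⊆ e.target → (∀ z, 0 ≤ χ z) →
        0 ≤ ∫ z in e.target, (χ z * (formInChart g.form e z v v).re +
          u (e.symm z) * leviForm χ z v)

/-- The class `S` of `ω`-plurisubharmonic functions with values in `[-1, 0]` and supremum `0`. -/
def classS (g : HermitianMetric n X) : Set (X → ℝ) :=
  {v | IsOmegaPSH g v ∧ (∀ x, -1 ≤ v x ∧ v x ≤ 0) ∧ IsLUB (range v) 0}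

/-- The functional `v ↦ ∫ v dμ` is (well defined, i.e. finite, and) Hölder continuous on `S` with
respect to the `L¹(ω^n)`-distance. -/
def IsHolderOnS [MeasurableSpace X] (g : HermitianMetric n X) (μ : Measure X) : Prop :=
  (∀ v ∈ classS g, Integrable v μ) ∧
    ∃ C α : ℝ, 0 < C ∧ 0 < α ∧ ∀ u ∈ classS g, ∀ v ∈ classS g,
      |∫ x, u x ∂μ - ∫ x, v x ∂μ| ≤ C * (∫ x, |u x - v x| ∂g.volume) ^ α

/-- The functional of `μ` is locally Hölder continuous in the chart `e`: the image `ν` under `e` of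
the restriction of `μ` to the domain of `e` gives a functional that is locally Hölder continuous on
`S₀(Ω)`, where `Ω` is the image of `e`. -/
def IsLocallyHolderInChart [MeasurableSpace X] (μ : Measure X)
    (e : OpenPartialHomeomorph X (Fin n → ℂ)) : Prop :=
  IsLocallyHolderOnS₀ e.target ((μ.restrict e.source).map e)

end Manifold

end

noncomputable section

open Filter Topology Metric


/-! ### Circle means in logarithmic polar coordinates -/

section CircleMeans

/-! From global to local, let `φ` be in `S₀` of a chart image and let `q` be a cutoff on a small
ball, equal to `1` near its centre. For small `ε` the function `max (ε (φ - 1)) (-3 ε q)`, extended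
by zero, is `ω`-psh: the first branch is psh, and the second has a small negative part that `ω`
absorbs. Since `-2ε ≤ ε (φ - 1) ≤ -ε`, the first branch wins where `q = 1` and the second where `q =
0`. So this function `glue` lies in `S`, is affine in `φ` near the centre, is monotone in `φ`, and
contracts `L¹` distances up to a constant. The global hypothesis controls only differences of
integrals, whereas the local conclusion concerns the integral of `|φ - ψ|`. The bridge is `|φ - ψ| =
(χ - φ) + (χ - ψ)` with `χ = max φ ψ`, whose summands are differences of ordered pairs. Finitely
many balls cover `closure Ω'`. See `IsCutoff.glue_mem_classS` and
`IsCutoff.exists_setLIntegral_abs_sub_le`.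

From local to global, a member `u` of `S` becomes a member of `S₀` of a Euclidean ball of a chart
after adding `ρ = C (|z - a|² - r²)`, whose Levi form dominates the metric, and dividing by a
constant (`exists_comp_symm_add_mem_classS₀`). The term `ρ` cancels in differences, so the local
estimate bounds the integral of `|u - v|` over the half ball; the constants `-1` and `0` show that
`μ` is finite there. A finite subcover and the finiteness of `ω^n`, which permits lowering all
exponents to the smallest, conclude. Only ball charts are needed, and balls are strictly
pseudoconvex, so the same argument serves both equivalences.

The analytic work is to pass between two descriptions of positivity: sub-mean inequalities on affine
discs, used for psh functions, and distributional inequalities, used for `ω`-psh functions. From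
means to distributions (`integral_add_mul_leviForm_nonneg`), the mean over small circles is moved
onto the test function and expanded to second order. From distributions to means
(`le_circleAverage_comp_of_distribution`), the function is convolved with a rotation invariant
kernel, the inequality is proved for smooth functions along arbitrary holomorphic discs, and the
kernel is shrunk; the convolutions converge at every point by upper semicontinuity and the
asymptotic sub-mean property. Arbitrary discs are needed because chart changes do not preserve
affine ones. -/

theorem circleMap_zero_exp (t θ : ℝ) :
    circleMap 0 (Real.exp t) θ = Complex.exp (t + θ * Complex.I) := by
  simp [circleMap, Complex.exp_add]

theorem norm_exp_add_mul_I (t θ : ℝ) : ‖Complex.exp (t + θ * Complex.I)‖ = Real.exp t := by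
  simp [Complex.norm_exp]

theorem exp_add_mul_I_mem_closedBall {t : ℝ} (ht : t ≤ 0) (θ : ℝ) :
    Complex.exp (t + θ * Complex.I) ∈ closedBall (0 : ℂ) 1 := by
  rw [mem_closedBall_zero_iff, norm_exp_add_mul_I]
  exact Real.exp_le_one_iff.2 ht

theorem continuousOn_integral_circleMap {h : ℂ → ℝ} (hh : ContinuousOn h (closedBall 0 1)) :
    ContinuousOn (fun r : ℝ => ∫ θ in (0)..2 * Real.pi, h (circleMap 0 r θ)) (Icc 0 1) := by
  have hc : Continuous (Function.uncurry fun (r θ : ℝ) =>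
      h (circleMap 0 (max 0 (min r 1)) θ)) := by
    refine hh.comp_continuous (f := fun p : ℝ × ℝ => circleMap 0 (max 0 (min p.1 1)) p.2) ?_ ?_
    · unfold circleMap; fun_prop
    · intro p
      simp only [mem_closedBall_zero_iff, norm_circleMap_zero]
      rw [abs_of_nonneg (le_max_left _ _)]
      exact max_le zero_le_one (min_le_right _ _)
  refine (intervalIntegral.continuous_parametric_intervalIntegral_of_continuous'
    (μ := volume) hc 0 (2 * Real.pi)).continuousOn.congr ?_
  intro r hr
  simp only [min_eq_left hr.2, max_eq_right hr.1]

theorem continuousOn_integral_exp {h : ℂ → ℝ} (hh : ContinuousOn h (closedBall 0 1)) :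
    ContinuousOn (fun t : ℝ => ∫ θ in (0)..2 * Real.pi, h (Complex.exp (t + θ * Complex.I)))
      (Iic 0) := by
  simp only [← circleMap_zero_exp]
  exact (continuousOn_integral_circleMap hh).comp Real.continuous_exp.continuousOn
    fun t ht => ⟨(Real.exp_pos t).le, Real.exp_le_one_iff.2 ht⟩

theorem tendsto_integral_exp_atBot {h : ℂ → ℝ} (hh : ContinuousOn h (closedBall 0 1)) :
    Tendsto (fun t : ℝ => ∫ θ in (0)..2 * Real.pi, h (Complex.exp (t + θ * Complex.I))) atBot
      (𝓝 (2 * Real.pi * h 0)) := by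
  simp only [← circleMap_zero_exp]
  have h0 : Tendsto (fun r : ℝ => ∫ θ in (0)..2 * Real.pi, h (circleMap 0 r θ)) (𝓝[Icc 0 1] 0)
      (𝓝 (2 * Real.pi * h 0)) := by
    simpa [ContinuousWithinAt] using continuousOn_integral_circleMap hh 0 (by simp)
  refine h0.comp (tendsto_nhdsWithin_iff.2 ⟨Real.tendsto_exp_atBot, ?_⟩)
  filter_upwards [eventually_le_atBot 0] with t ht
  exact ⟨(Real.exp_pos t).le, Real.exp_le_one_iff.2 ht⟩

theorem continuous_comp_exp {h : ℂ → ℝ} (hh : ContinuousOn h (closedBall 0 1)) {t : ℝ}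
    (ht : t ≤ 0) : Continuous fun θ : ℝ => h (Complex.exp (t + θ * Complex.I)) :=
  hh.comp_continuous (by fun_prop) fun θ => exp_add_mul_I_mem_closedBall ht θ

theorem hasDerivAt_integral_exp {h h' : ℂ → ℝ} (hh : ContinuousOn h (closedBall 0 1))
    (hh' : ContinuousOn h' (closedBall 0 1))
    (hd : ∀ t < (0 : ℝ), ∀ θ : ℝ, HasDerivAt (fun t : ℝ => h (Complex.exp (t + θ * Complex.I)))
      (h' (Complex.exp (t + θ * Complex.I))) t) {t : ℝ} (ht : t < 0) :
    HasDerivAt (fun t : ℝ => ∫ θ in (0)..2 * Real.pi, h (Complex.exp (t + θ * Complex.I)))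
      (∫ θ in (0)..2 * Real.pi, h' (Complex.exp (t + θ * Complex.I))) t := by
  obtain ⟨M, hM⟩ := (isCompact_closedBall (0 : ℂ) 1).exists_bound_of_continuousOn hh'
  refine (intervalIntegral.hasDerivAt_integral_of_dominated_loc_of_deriv_le (s := Iio 0)
    (F := fun (t θ : ℝ) => h (Complex.exp (t + θ * Complex.I)))
    (F' := fun (t θ : ℝ) => h' (Complex.exp (t + θ * Complex.I))) (bound := fun _ => M)
    (Iio_mem_nhds ht) ?_ ?_ ?_ ?_ ?_ ?_).2
  · filter_upwards [Iio_mem_nhds ht] with s hs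
    exact (continuous_comp_exp hh (le_of_lt hs)).aestronglyMeasurable
  · exact (continuous_comp_exp hh ht.le).intervalIntegrable _ _
  · exact (continuous_comp_exp hh' ht.le).aestronglyMeasurable
  · exact Eventually.of_forall fun θ _ s hs =>
      hM _ (exp_add_mul_I_mem_closedBall (le_of_lt hs) θ)
  · exact intervalIntegrable_const
  · exact Eventually.of_forall fun θ _ s hs => hd s hs θ

theorem nonneg_of_deriv_nonneg_of_tendsto_atBot {F F' : ℝ → ℝ} {l : ℝ}
    (hd : ∀ t < 0, HasDerivAt F (F' t) t) (hF' : ∀ t < 0, 0 ≤ F' t)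
    (hl : Tendsto F atBot (𝓝 l)) {t : ℝ} (ht : t < 0) : l ≤ F t := by
  have hm : MonotoneOn F (Iio 0) := by
    refine monotoneOn_of_deriv_nonneg (convex_Iio 0)
      (fun s hs => (hd s hs).continuousAt.continuousWithinAt) ?_ ?_
    · rw [interior_Iio]
      exact fun s hs => (hd s hs).differentiableAt.differentiableWithinAt
    · rw [interior_Iio]
      intro s hs
      rw [(hd s hs).deriv]
      exact hF' s hs
  refine le_of_tendsto hl ?_
  filter_upwards [eventually_le_atBot t] with s hs
  exact hm (lt_of_le_of_lt hs ht) ht hs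

/-- In the coordinates `ζ = exp (t + iθ)`, `h1` and `h2` are the first two `t`-derivatives of `h0`,
and `k2` is a `θ`-derivative, so it integrates to zero over a period. Hence the integral `F(t)` of
`h0` over the circle satisfies `F'' ≥ 2π m e^{2t}`. Integrating twice from `t = -∞`, where `F' → 2π
h1(0) = 0` and `F → 2π h0(0)`, gives `F(0) ≥ 2π h0(0) + π m / 2`. -/
theorem add_div_le_circleAverage_of_hasDerivAt {h0 h1 h2 k1 k2 : ℂ → ℝ}
    (h0c : ContinuousOn h0 (closedBall 0 1)) (h1c : ContinuousOn h1 (closedBall 0 1))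
    (h2c : ContinuousOn h2 (closedBall 0 1)) (k2c : ContinuousOn k2 (closedBall 0 1))
    (h10 : h1 0 = 0)
    (hd0 : ∀ t < (0 : ℝ), ∀ θ : ℝ, HasDerivAt (fun t : ℝ => h0 (Complex.exp (t + θ * Complex.I)))
      (h1 (Complex.exp (t + θ * Complex.I))) t)
    (hd1 : ∀ t < (0 : ℝ), ∀ θ : ℝ, HasDerivAt (fun t : ℝ => h1 (Complex.exp (t + θ * Complex.I)))
      (h2 (Complex.exp (t + θ * Complex.I))) t)
    (hdk : ∀ t < (0 : ℝ), ∀ θ : ℝ, HasDerivAt (fun θ : ℝ => k1 (Complex.exp (t + θ * Complex.I)))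
      (k2 (Complex.exp (t + θ * Complex.I))) θ) {m : ℝ}
    (hm : ∀ ζ ∈ closedBall (0 : ℂ) 1, m * ‖ζ‖ ^ 2 ≤ h2 ζ + k2 ζ) :
    h0 0 + m / 4 ≤ Real.circleAverage h0 0 1 := by
  have hk0 : ∀ t < (0 : ℝ),
      ∫ θ in (0)..2 * Real.pi, k2 (Complex.exp (t + θ * Complex.I)) = 0 := fun t ht => by
    rw [intervalIntegral.integral_eq_sub_of_hasDerivAt (fun θ _ => hdk t ht θ)
      ((continuous_comp_exp k2c ht.le).intervalIntegrable _ _)]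
    have : Complex.exp (t + ((2 * Real.pi : ℝ) : ℂ) * Complex.I) =
        Complex.exp (t + ((0 : ℝ) : ℂ) * Complex.I) := by
      push_cast
      rw [Complex.exp_add, Complex.exp_two_pi_mul_I]
      simp
    rw [this, sub_self]
  have hh2 : ∀ t < (0 : ℝ), 2 * Real.pi * (m * Real.exp (2 * t)) ≤
      ∫ θ in (0)..2 * Real.pi, h2 (Complex.exp (t + θ * Complex.I)) := fun t ht => by
    have hsum : ∫ θ in (0)..2 * Real.pi, h2 (Complex.exp (t + θ * Complex.I)) =
        ∫ θ in (0)..2 * Real.pi, (h2 (Complex.exp (t + θ * Complex.I)) +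
          k2 (Complex.exp (t + θ * Complex.I))) := by
      rw [intervalIntegral.integral_add ((continuous_comp_exp h2c ht.le).intervalIntegrable _ _)
        ((continuous_comp_exp k2c ht.le).intervalIntegrable _ _), hk0 t ht, add_zero]
    have hconst : 2 * Real.pi * (m * Real.exp (2 * t)) =
        ∫ θ in (0)..2 * Real.pi, m * Real.exp (2 * t) := by simp; ring
    rw [hsum, hconst]
    refine intervalIntegral.integral_mono_on (by positivity) intervalIntegrable_const
      (((continuous_comp_exp h2c ht.le).add (continuous_comp_exp k2c ht.le)).intervalIntegrable
        _ _) fun θ _ => ?_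
    have hl := hm _ (exp_add_mul_I_mem_closedBall ht.le θ)
    rw [norm_exp_add_mul_I, ← Real.exp_nat_mul] at hl
    exact_mod_cast hl
  have hexp2 : ∀ t : ℝ, HasDerivAt (fun t : ℝ => Real.exp (2 * t)) (2 * Real.exp (2 * t)) t :=
    fun t => by simpa [mul_comm] using ((hasDerivAt_id t).const_mul 2).exp
  have hexplim : Tendsto (fun t : ℝ => Real.exp (2 * t)) atBot (𝓝 0) :=
    Real.tendsto_exp_atBot.comp (tendsto_id.const_mul_atBot two_pos)
  have hG1 : ∀ t < (0 : ℝ), 0 ≤ (∫ θ in (0)..2 * Real.pi, h1 (Complex.exp (t + θ * Complex.I))) -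
      Real.pi * m * Real.exp (2 * t) := fun t ht => by
    refine nonneg_of_deriv_nonneg_of_tendsto_atBot (fun t ht =>
      (hasDerivAt_integral_exp h1c h2c hd1 ht).sub ((hexp2 t).const_mul (Real.pi * m)))
      (fun t ht => ?_) ?_ ht
    · have := hh2 t ht
      linarith
    · simpa [h10, Pi.sub_def] using (tendsto_integral_exp_atBot h1c).sub (hexplim.const_mul (Real.pi * m))
  have hG0 : ∀ t < (0 : ℝ), 2 * Real.pi * h0 0 ≤
      (∫ θ in (0)..2 * Real.pi, h0 (Complex.exp (t + θ * Complex.I))) -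
      Real.pi * m / 2 * Real.exp (2 * t) := fun t ht => by
    refine nonneg_of_deriv_nonneg_of_tendsto_atBot (fun t ht =>
      (hasDerivAt_integral_exp h0c h1c hd0 ht).sub ((hexp2 t).const_mul (Real.pi * m / 2)))
      (fun t ht => ?_) ?_ ht
    · have := hG1 t ht
      linarith
    · simpa [Pi.sub_def] using (tendsto_integral_exp_atBot h0c).sub (hexplim.const_mul (Real.pi * m / 2))
  have hlim : Tendsto (fun t : ℝ =>
      (∫ θ in (0)..2 * Real.pi, h0 (Complex.exp (t + θ * Complex.I))) -
      Real.pi * m / 2 * Real.exp (2 * t)) (𝓝[<] 0)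
      (𝓝 ((∫ θ in (0)..2 * Real.pi, h0 (Complex.exp ((0 : ℝ) + θ * Complex.I))) -
      Real.pi * m / 2 * Real.exp (2 * 0))) :=
    (((continuousOn_integral_exp h0c) 0 self_mem_Iic).mono_left
      (nhdsWithin_mono _ Iio_subset_Iic_self)).sub (by
        refine Tendsto.mono_left ?_ nhdsWithin_le_nhds
        exact (by fun_prop : Continuous fun t : ℝ =>
          Real.pi * m / 2 * Real.exp (2 * t)).tendsto 0)
  have hfin := ge_of_tendsto hlim (eventually_nhdsWithin_of_forall fun t ht => hG0 t ht)
  simp only [← circleMap_zero_exp, Real.exp_zero, mul_zero, mul_one] at hfin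
  rw [Real.circleAverage_def, smul_eq_mul, inv_mul_eq_div, le_div_iff₀ (by positivity)]
  linarith

end CircleMeans

/-! ### The Levi form and means over holomorphic discs -/

section Levi

variable {n : ℕ}

theorem leviForm_eq (f : (Fin n → ℂ) → ℝ) (z v : Fin n → ℂ) :
    leviForm f z v = fderiv ℝ (fderiv ℝ f) z v v +
      fderiv ℝ (fderiv ℝ f) z (Complex.I • v) (Complex.I • v) := by
  simp [leviForm, iteratedFDeriv_two_apply]

/-- With `c = a + ib`, the vectors `c v` and `i c v` expand in `v` and `i v`; the cross terms of the
two second derivatives have opposite signs and cancel. -/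
theorem leviForm_smul (f : (Fin n → ℂ) → ℝ) (z v : Fin n → ℂ) (c : ℂ) :
    leviForm f z (c • v) = ‖c‖ ^ 2 * leviForm f z v := by
  have hc : c • v = c.re • v + c.im • (Complex.I • v) := by
    ext j
    simp only [Pi.smul_apply, Pi.add_apply, smul_eq_mul, Complex.real_smul]
    linear_combination (-(v j)) * Complex.re_add_im c
  have hc' : Complex.I • (c • v) = c.re • (Complex.I • v) - c.im • v := by
    ext j
    simp only [Pi.smul_apply, Pi.sub_apply, smul_eq_mul, Complex.real_smul]
    linear_combination (-(Complex.I * v j)) * Complex.re_add_im c +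
      (c.im * v j) * Complex.I_mul_I
  rw [leviForm_eq, leviForm_eq, hc', hc, Complex.sq_norm, Complex.normSq_apply]
  simp only [map_add, map_sub, map_smul, add_apply,
    sub_apply, smul_apply, smul_eq_mul]
  ring

section Curves

variable {f : (Fin n → ℂ) → ℝ} {W : Set (Fin n → ℂ)} {γ : ℂ → Fin n → ℂ} {U : Set ℂ}

theorem hasDerivAt_comp_curve (hW : IsOpen W) (hf : DifferentiableOn ℝ f W) (hU : IsOpen U)
    (hγ : DifferentiableOn ℂ γ U) {c : ℝ → ℂ} {c' : ℂ} {t : ℝ} (hc : HasDerivAt c c' t)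
    (hU' : c t ∈ U) (hW' : γ (c t) ∈ W) :
    HasDerivAt (fun t => f (γ (c t))) (fderiv ℝ f (γ (c t)) (c' • deriv γ (c t))) t := by
  have h1 : HasDerivAt (fun t => γ (c t)) (c' • deriv γ (c t)) t :=
    ((hγ.differentiableAt (hU.mem_nhds hU')).hasDerivAt).scomp t hc
  have h2 : HasFDerivAt f (fderiv ℝ f (γ (c t))) (γ (c t)) :=
    (hf.differentiableAt (hW.mem_nhds hW')).hasFDerivAt
  exact h2.comp_hasDerivAt t h1

theorem hasDerivAt_fderiv_comp_curve (hW : IsOpen W) (hDf : DifferentiableOn ℝ (fderiv ℝ f) W)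
    (hU : IsOpen U) (hγ : DifferentiableOn ℂ γ U) (a : ℂ) {c : ℝ → ℂ} {c' : ℂ} {t : ℝ}
    (hc : HasDerivAt c c' t) (hU' : c t ∈ U) (hW' : γ (c t) ∈ W) :
    HasDerivAt (fun t => fderiv ℝ f (γ (c t)) (a • c t • deriv γ (c t)))
      (fderiv ℝ (fderiv ℝ f) (γ (c t)) (c' • deriv γ (c t)) (a • c t • deriv γ (c t)) +
        fderiv ℝ f (γ (c t)) (a • (c t • c' • deriv (deriv γ) (c t) + c' • deriv γ (c t)))) t := by
  have h1 : HasDerivAt (fun t => γ (c t)) (c' • deriv γ (c t)) t :=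
    ((hγ.differentiableAt (hU.mem_nhds hU')).hasDerivAt).scomp t hc
  have h2 : HasFDerivAt (fderiv ℝ f) (fderiv ℝ (fderiv ℝ f) (γ (c t))) (γ (c t)) :=
    (hDf.differentiableAt (hW.mem_nhds hW')).hasFDerivAt
  have h3 : HasDerivAt (fun t => deriv γ (c t)) (c' • deriv (deriv γ) (c t)) t :=
    (((hγ.deriv hU).differentiableAt (hU.mem_nhds hU')).hasDerivAt).scomp t hc
  have h4 : HasDerivAt (fun t => a • c t • deriv γ (c t))
      (a • (c t • c' • deriv (deriv γ) (c t) + c' • deriv γ (c t))) t :=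
    (hc.smul h3).const_smul a
  have h5 : HasDerivAt (fun t => fderiv ℝ f (γ (c t)))
      (fderiv ℝ (fderiv ℝ f) (γ (c t)) (c' • deriv γ (c t))) t := h2.comp_hasDerivAt t h1
  exact h5.clm_apply h4

end Curves

theorem hasDerivAt_exp_add_mul_I (t θ : ℝ) :
    HasDerivAt (fun t : ℝ => Complex.exp (t + θ * Complex.I))
      (Complex.exp (t + θ * Complex.I)) t := by
  have := ((hasDerivAt_id (t : ℂ)).add_const (θ * Complex.I)).cexp.comp_ofReal
  simpa using this

theorem hasDerivAt_exp_add_mul_I' (t θ : ℝ) :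
    HasDerivAt (fun θ : ℝ => Complex.exp (t + θ * Complex.I))
      (Complex.I * Complex.exp (t + θ * Complex.I)) θ := by
  have := (((hasDerivAt_id (θ : ℂ)).mul_const Complex.I).const_add (t : ℂ)).cexp.comp_ofReal
  simpa [mul_comm] using this

/-- The second `t`- and `θ`-derivatives of `f ∘ γ ∘ exp` both contain the first-order term `Df (c γ'
+ c² γ'')`, with opposite signs because `i² = -1`. Their sum is therefore the Levi form in the
direction `c γ'`, that is `|c|²` times the one in the direction `γ'`. -/
theorem add_div_le_circleAverage_comp {f : (Fin n → ℂ) → ℝ} {W : Set (Fin n → ℂ)}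
    (hW : IsOpen W) (hf : ContDiffOn ℝ 2 f W) {γ : ℂ → Fin n → ℂ} {U : Set ℂ} (hU : IsOpen U)
    (hU1 : closedBall 0 1 ⊆ U) (hγ : DifferentiableOn ℂ γ U) (hγW : MapsTo γ (closedBall 0 1) W)
    {m : ℝ} (hm : ∀ ζ ∈ closedBall (0 : ℂ) 1, m ≤ leviForm f (γ ζ) (deriv γ ζ)) :
    f (γ 0) + m / 4 ≤ Real.circleAverage (fun ζ => f (γ ζ)) 0 1 := by
  have hγ1 : DifferentiableOn ℂ (deriv γ) U := hγ.deriv hU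
  have hγ2 : DifferentiableOn ℂ (deriv (deriv γ)) U := hγ1.deriv hU
  have hγc := hγ.continuousOn.mono hU1
  have hγ1c := hγ1.continuousOn.mono hU1
  have hγ2c := hγ2.continuousOn.mono hU1
  have hDf : ContDiffOn ℝ 1 (fderiv ℝ f) W := hf.fderiv_of_isOpen hW (by norm_num)
  have hDDf : ContDiffOn ℝ 0 (fderiv ℝ (fderiv ℝ f)) W := contDiffOn_zero.2 (hDf.continuousOn_fderiv_of_isOpen hW (by norm_num))
  have hfc : ContinuousOn (fun c => f (γ c)) (closedBall 0 1) := hf.continuousOn.comp hγc hγW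
  have hDfc : ContinuousOn (fun c => fderiv ℝ f (γ c)) (closedBall 0 1) :=
    hDf.continuousOn.comp hγc hγW
  have hDDfc : ContinuousOn (fun c => fderiv ℝ (fderiv ℝ f) (γ c)) (closedBall 0 1) :=
    hDDf.continuousOn.comp hγc hγW
  have hid : ContinuousOn (fun c : ℂ => c) (closedBall 0 1) := continuousOn_id
  let h1 : ℂ → ℝ := fun c => fderiv ℝ f (γ c) (c • deriv γ c)
  let h2 : ℂ → ℝ := fun c => fderiv ℝ (fderiv ℝ f) (γ c) (c • deriv γ c) (c • deriv γ c) +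
    fderiv ℝ f (γ c) (c • deriv γ c + c • c • deriv (deriv γ) c)
  let k1 : ℂ → ℝ := fun c => fderiv ℝ f (γ c) (Complex.I • c • deriv γ c)
  let k2 : ℂ → ℝ := fun c => fderiv ℝ (fderiv ℝ f) (γ c) (Complex.I • c • deriv γ c)
    (Complex.I • c • deriv γ c) -
    fderiv ℝ f (γ c) (c • deriv γ c + c • c • deriv (deriv γ) c)
  have hv : ContinuousOn (fun c : ℂ => c • deriv γ c) (closedBall 0 1) := hid.smul hγ1c
  have hIv : ContinuousOn (fun c : ℂ => Complex.I • c • deriv γ c) (closedBall 0 1) :=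
    hv.const_smul Complex.I
  have hw : ContinuousOn (fun c : ℂ => c • deriv γ c + c • c • deriv (deriv γ) c)
      (closedBall 0 1) := hv.add (hid.smul (hid.smul hγ2c))
  have h1c : ContinuousOn h1 (closedBall 0 1) := hDfc.clm_apply hv
  have h2c : ContinuousOn h2 (closedBall 0 1) :=
    ((hDDfc.clm_apply hv).clm_apply hv).add (hDfc.clm_apply hw)
  have k2c : ContinuousOn k2 (closedBall 0 1) :=
    ((hDDfc.clm_apply hIv).clm_apply hIv).sub (hDfc.clm_apply hw)
  have hd0 : ∀ t < (0 : ℝ), ∀ θ : ℝ,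
      HasDerivAt (fun t : ℝ => f (γ (Complex.exp (t + θ * Complex.I))))
        (h1 (Complex.exp (t + θ * Complex.I))) t := fun t ht θ =>
    hasDerivAt_comp_curve hW (hf.differentiableOn (by norm_num)) hU hγ
      (hasDerivAt_exp_add_mul_I t θ) (hU1 (exp_add_mul_I_mem_closedBall ht.le θ))
      (hγW (exp_add_mul_I_mem_closedBall ht.le θ))
  have hd1 : ∀ t < (0 : ℝ), ∀ θ : ℝ,
      HasDerivAt (fun t : ℝ => h1 (Complex.exp (t + θ * Complex.I)))
        (h2 (Complex.exp (t + θ * Complex.I))) t := fun t ht θ => by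
    have := hasDerivAt_fderiv_comp_curve hW (hDf.differentiableOn (by norm_num)) hU hγ 1
      (hasDerivAt_exp_add_mul_I t θ) (hU1 (exp_add_mul_I_mem_closedBall ht.le θ))
      (hγW (exp_add_mul_I_mem_closedBall ht.le θ))
    simp only [one_smul] at this
    refine this.congr_deriv ?_
    simp only [h2]
    rw [add_comm (Complex.exp _ • deriv γ _)]
  have hdk : ∀ t < (0 : ℝ), ∀ θ : ℝ,
      HasDerivAt (fun θ : ℝ => k1 (Complex.exp (t + θ * Complex.I)))
        (k2 (Complex.exp (t + θ * Complex.I))) θ := fun t ht θ => by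
    have := hasDerivAt_fderiv_comp_curve hW (hDf.differentiableOn (by norm_num)) hU hγ
      Complex.I (hasDerivAt_exp_add_mul_I' t θ) (hU1 (exp_add_mul_I_mem_closedBall ht.le θ))
      (hγW (exp_add_mul_I_mem_closedBall ht.le θ))
    refine this.congr_deriv ?_
    simp only [k2]
    rw [sub_eq_add_neg, ← map_neg]
    congr 2
    · rw [mul_smul]
    · ext j
      simp only [Pi.neg_apply, Pi.add_apply, Pi.smul_apply, smul_eq_mul]
      generalize Complex.exp (t + θ * Complex.I) = c
      linear_combination (c * deriv γ c j + c * (c * deriv (deriv γ) c j)) * Complex.I_mul_I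
  refine add_div_le_circleAverage_of_hasDerivAt hfc h1c h2c k2c (by simp [h1]) hd0 hd1 hdk
    fun ζ hζ => ?_
  have he : h2 ζ + k2 ζ = leviForm f (γ ζ) (ζ • deriv γ ζ) := by
    rw [leviForm_eq]
    simp only [h2, k2]
    ring
  rw [he, leviForm_smul, mul_comm]
  exact mul_le_mul_of_nonneg_left (hm ζ hζ) (by positivity)

end Levi


/-! ### Means over affine discs and the distributional inequality -/

section DiscMean

variable {n : ℕ}

/-- The mean of `u` over the boundary of the disc `{z + ζ b : |ζ| ≤ 1}`. -/
def discMean (u : (Fin n → ℂ) → ℝ) (z b : Fin n → ℂ) : ℝ :=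
  Real.circleAverage (fun ζ : ℂ => u (z + ζ • b)) 0 1

theorem discMean_eq (u : (Fin n → ℂ) → ℝ) (z b : Fin n → ℂ) :
    discMean u z b =
      (2 * Real.pi)⁻¹ * ∫ θ in (0)..2 * Real.pi, u (z + circleMap 0 1 θ • b) := by
  simp [discMean, Real.circleAverage_def]

theorem discMean_eq_sub (u : (Fin n → ℂ) → ℝ) (z b : Fin n → ℂ) :
    discMean u z b =
      (2 * Real.pi)⁻¹ * ∫ θ in (0)..2 * Real.pi, u (z - circleMap 0 1 θ • b) := by
  rw [discMean, Real.circleAverage_eq_integral_add Real.pi, smul_eq_mul]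
  have (θ : ℝ) : circleMap 0 1 (θ + Real.pi) = -circleMap 0 1 θ := by
    simp [circleMap, add_mul, Complex.exp_add]
  simp only [this, neg_smul, sub_eq_add_neg]

theorem discMean_neg (u : (Fin n → ℂ) → ℝ) (z b : Fin n → ℂ) :
    discMean (fun w => -u w) z b = -discMean u z b := by
  simp [discMean_eq, intervalIntegral.integral_neg]

theorem continuous_circleMap_smul (b : Fin n → ℂ) :
    Continuous fun p : (Fin n → ℂ) × ℝ => p.1 + circleMap 0 1 p.2 • b := by
  unfold circleMap; fun_prop

theorem continuous_circleMap_smul' (b : Fin n → ℂ) :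
    Continuous fun p : (Fin n → ℂ) × ℝ => p.1 - circleMap 0 1 p.2 • b := by
  unfold circleMap; fun_prop

theorem norm_circleMap_smul (θ : ℝ) (b : Fin n → ℂ) : ‖circleMap 0 1 θ • b‖ = ‖b‖ := by
  rw [norm_smul, norm_circleMap_zero, abs_one, one_mul]

theorem continuous_discMean {u : (Fin n → ℂ) → ℝ} (hu : Continuous u) (b : Fin n → ℂ) :
    Continuous fun z => discMean u z b := by
  simp only [discMean_eq]
  exact continuous_const.mul
    (intervalIntegral.continuous_parametric_intervalIntegral_of_continuous' (μ := volume)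
      (f := fun z θ => u (z + circleMap 0 1 θ • b)) (hu.comp (continuous_circleMap_smul b)) _ _)

theorem discMean_congr {u w : (Fin n → ℂ) → ℝ} {z b : Fin n → ℂ}
    (h : ∀ ζ : ℂ, ‖ζ‖ = 1 → u (z + ζ • b) = w (z + ζ • b)) : discMean u z b = discMean w z b := by
  rw [discMean_eq, discMean_eq]
  congr 2
  ext θ
  exact h _ (by simp)

theorem discMean_mono {u w : (Fin n → ℂ) → ℝ} {z b : Fin n → ℂ}
    (hu : CircleIntegrable (fun ζ : ℂ => u (z + ζ • b)) 0 1)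
    (hw : CircleIntegrable (fun ζ : ℂ => w (z + ζ • b)) 0 1)
    (h : ∀ ζ : ℂ, ‖ζ‖ = 1 → u (z + ζ • b) ≤ w (z + ζ • b)) : discMean u z b ≤ discMean w z b := by
  rw [discMean_eq, discMean_eq]
  refine mul_le_mul_of_nonneg_left ?_ (by positivity)
  exact intervalIntegral.integral_mono_on (by positivity) hu hw fun θ _ => h _ (by simp)

theorem leviForm_neg (f : (Fin n → ℂ) → ℝ) (z v : Fin n → ℂ) :
    leviForm (fun w => -f w) z v = -leviForm f z v := by
  have h : fderiv ℝ (fun w => -f w) = fun w => -fderiv ℝ f w := by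
    ext1 w
    exact fderiv_fun_neg
  rw [leviForm_eq, leviForm_eq, h]
  rw [fderiv_fun_neg]
  simp only [neg_apply]
  ring

theorem add_div_le_discMean {f : (Fin n → ℂ) → ℝ} {W : Set (Fin n → ℂ)}
    (hW : IsOpen W) (hf : ContDiffOn ℝ 2 f W) {z b : Fin n → ℂ}
    (hb : ∀ ζ : ℂ, ‖ζ‖ ≤ 1 → z + ζ • b ∈ W) {m : ℝ}
    (hm : ∀ ζ : ℂ, ‖ζ‖ ≤ 1 → m ≤ leviForm f (z + ζ • b) b) :
    f z + m / 4 ≤ discMean f z b := by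
  have hd (ζ : ℂ) : HasDerivAt (fun ζ : ℂ => z + ζ • b) b ζ := by
    simpa using ((hasDerivAt_id ζ).smul_const b).const_add z
  have := add_div_le_circleAverage_comp (γ := fun ζ : ℂ => z + ζ • b) (U := univ) (m := m) hW hf
    isOpen_univ (subset_univ _) (fun ζ _ => (hd ζ).differentiableAt.differentiableWithinAt)
    (fun ζ hζ => hb ζ (by simpa using hζ)) (fun ζ hζ => by
      rw [(hd ζ).deriv]
      exact hm ζ (by simpa using hζ))
  simpa [discMean] using this

theorem continuousOn_leviForm {f : (Fin n → ℂ) → ℝ} {W : Set (Fin n → ℂ)}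
    (hW : IsOpen W) (hf : ContDiffOn ℝ 2 f W) :
    ContinuousOn (fun p : (Fin n → ℂ) × (Fin n → ℂ) => leviForm f p.1 p.2) (W ×ˢ univ) := by
  have h1 : ContDiffOn ℝ 1 (fderiv ℝ f) W := hf.fderiv_of_isOpen hW (by norm_num)
  have h2 : ContinuousOn (fderiv ℝ (fderiv ℝ f)) W :=
    h1.continuousOn_fderiv_of_isOpen hW (by norm_num)
  have h3 : ContinuousOn (fun p : (Fin n → ℂ) × (Fin n → ℂ) => fderiv ℝ (fderiv ℝ f) p.1)
      (W ×ˢ univ) := h2.comp continuousOn_fst fun p hp => hp.1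
  have h4 : ContinuousOn (fun p : (Fin n → ℂ) × (Fin n → ℂ) => p.2) (W ×ˢ univ) :=
    continuousOn_snd
  have h5 : ContinuousOn (fun p : (Fin n → ℂ) × (Fin n → ℂ) => Complex.I • p.2) (W ×ˢ univ) :=
    h4.const_smul Complex.I
  simp only [leviForm_eq]
  exact ((h3.clm_apply h4).clm_apply h4).add ((h3.clm_apply h5).clm_apply h5)

theorem continuous_leviForm {f : (Fin n → ℂ) → ℝ} (hf : ContDiff ℝ 2 f) (v : Fin n → ℂ) :
    Continuous fun z => leviForm f z v := by
  have := continuousOn_leviForm isOpen_univ hf.contDiffOn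
  rw [univ_prod_univ, continuousOn_univ] at this
  exact this.comp (by fun_prop : Continuous fun z : Fin n → ℂ => (z, v))

theorem leviForm_eq_zero_of_notMem_tsupport {f : (Fin n → ℂ) → ℝ} {z : Fin n → ℂ}
    (hz : z ∉ tsupport f) (v : Fin n → ℂ) : leviForm f z v = 0 := by
  have h1 : fderiv ℝ (fderiv ℝ f) z = 0 := by
    by_contra h
    have h' : z ∈ Function.support (fderiv ℝ (fderiv ℝ f)) := h
    exact hz (tsupport_fderiv_subset ℝ (support_fderiv_subset ℝ h'))
  simp [leviForm_eq, h1]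

theorem hasCompactSupport_leviForm {f : (Fin n → ℂ) → ℝ} (hf : HasCompactSupport f)
    (v : Fin n → ℂ) : HasCompactSupport fun z => leviForm f z v :=
  HasCompactSupport.intro hf fun _ hz => leviForm_eq_zero_of_notMem_tsupport hz v

/-- The Levi form of `χ` is uniformly continuous, so on a disc of small radius it varies by less
than `δ`, uniformly in the centre. The two bounds come from `add_div_le_discMean` applied to `χ` and
to `-χ`. -/
theorem exists_abs_discMean_sub_le {χ : (Fin n → ℂ) → ℝ} (hχ : ContDiff ℝ 2 χ)
    (hc : HasCompactSupport χ) (v : Fin n → ℂ) {δ : ℝ} (hδ : 0 < δ) :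
    ∃ r₀ > 0, ∀ r : ℝ, 0 < r → r < r₀ → ∀ z,
      |discMean χ z (r • v) - χ z - r ^ 2 / 4 * leviForm χ z v| ≤ r ^ 2 / 4 * δ := by
  have huc : UniformContinuous fun z => leviForm χ z v :=
    (continuous_leviForm hχ v).uniformContinuous_of_tendsto_cocompact
      (hasCompactSupport_leviForm hc v).is_zero_at_infty
  obtain ⟨η, hη, huc⟩ := Metric.uniformContinuous_iff.1 huc δ hδ
  refine ⟨η / (‖v‖ + 1), by positivity, fun r hr hr' z => ?_⟩
  have hnear (ζ : ℂ) (hζ : ‖ζ‖ ≤ 1) :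
      |leviForm χ (z + ζ • r • v) v - leviForm χ z v| < δ := by
    rw [← Real.dist_eq]
    apply huc
    rw [dist_eq_norm, add_sub_cancel_left, norm_smul, norm_smul, Real.norm_of_nonneg hr.le]
    rw [lt_div_iff₀ (by positivity)] at hr'
    have : r * ‖v‖ < η := by nlinarith [norm_nonneg v]
    have h0 : 0 ≤ r * ‖v‖ := by positivity
    nlinarith
  have hsm (f : (Fin n → ℂ) → ℝ) (w : Fin n → ℂ) :
      leviForm f w (r • v) = r ^ 2 * leviForm f w v := by
    have := leviForm_smul f w v (r : ℂ)
    rw [Complex.norm_real, Real.norm_of_nonneg hr.le] at this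
    rw [← this]
    congr 1
  have h1 := add_div_le_discMean (z := z) (b := r • v) (m := r ^ 2 * (leviForm χ z v - δ))
    isOpen_univ hχ.contDiffOn (fun _ _ => mem_univ _) (fun ζ hζ => by
      rw [hsm]
      have := (abs_lt.1 (hnear ζ hζ)).1
      exact mul_le_mul_of_nonneg_left (by linarith) (by positivity))
  have h2 := add_div_le_discMean (z := z) (b := r • v) (m := r ^ 2 * (-leviForm χ z v - δ))
    isOpen_univ hχ.neg.contDiffOn (fun _ _ => mem_univ _) (fun ζ hζ => by
      have h := (abs_lt.1 (hnear ζ hζ)).2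
      rw [leviForm_neg, hsm, ← mul_neg]
      exact mul_le_mul_of_nonneg_left (by linarith) (by positivity))
  rw [discMean_neg] at h2
  rw [abs_le]
  constructor <;> linarith

theorem integrable_prod_discMean {u χ : (Fin n → ℂ) → ℝ} (hu : Measurable u) {M : ℝ}
    (hM : ∀ z, |u z| ≤ M) (hχ : Integrable χ) (b : Fin n → ℂ) :
    Integrable (fun p : (Fin n → ℂ) × ℝ => u (p.1 + circleMap 0 1 p.2 • b) * χ p.1)
      (volume.prod (volume.restrict (Ioc 0 (2 * Real.pi)))) := by
  have h := hχ.comp_fst (volume.restrict (Ioc (0 : ℝ) (2 * Real.pi)))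
  exact h.bdd_mul (hu.comp (continuous_circleMap_smul b).measurable).aestronglyMeasurable
    (Eventually.of_forall fun p => hM _)

theorem integrable_discMean_mul {u χ : (Fin n → ℂ) → ℝ} (hu : Measurable u) {M : ℝ}
    (hM : ∀ z, |u z| ≤ M) (hχ : Integrable χ) (b : Fin n → ℂ) :
    Integrable fun z => discMean u z b * χ z := by
  have := (integrable_prod_discMean hu hM hχ b).integral_prod_left.const_mul (2 * Real.pi)⁻¹
  refine this.congr (Eventually.of_forall fun z => ?_)
  simp only [discMean_eq, integral_mul_const,
    intervalIntegral.integral_of_le (by positivity : (0 : ℝ) ≤ 2 * Real.pi)]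
  ring

/-- Taking means over a fixed circle is self-adjoint: by Fubini and translation invariance its
adjoint is the mean over the opposite circle, which is the same circle. -/
theorem integral_mul_discMean {u χ : (Fin n → ℂ) → ℝ} (hu : Measurable u) {M : ℝ}
    (hM : ∀ z, |u z| ≤ M) (hχ : Integrable χ) (b : Fin n → ℂ) :
    ∫ z, u z * discMean χ z b = ∫ z, discMean u z b * χ z := by
  have h2π : (0 : ℝ) ≤ 2 * Real.pi := by positivity
  have hi := integrable_prod_discMean hu hM hχ b
  have hi' : Integrable (fun p : (Fin n → ℂ) × ℝ => u p.1 * χ (p.1 - circleMap 0 1 p.2 • b))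
      (volume.prod (volume.restrict (Ioc 0 (2 * Real.pi)))) := by
    let T : (Fin n → ℂ) × ℝ → (Fin n → ℂ) × ℝ := fun p => (p.1 - circleMap 0 1 p.2 • b, p.2)
    have hT : MeasurePreserving T (volume.prod (volume.restrict (Ioc 0 (2 * Real.pi))))
        (volume.prod (volume.restrict (Ioc 0 (2 * Real.pi)))) := by
      have hsw := (MeasurePreserving.id
        ((volume : Measure ℝ).restrict (Ioc 0 (2 * Real.pi)))).skew_product
        (μc := (volume : Measure (Fin n → ℂ))) (μd := (volume : Measure (Fin n → ℂ)))
        (g := fun θ z => z - circleMap 0 1 θ • b)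
        ((continuous_circleMap_smul' b).comp continuous_swap).measurable
        (Eventually.of_forall fun θ => (measurePreserving_sub_right volume _).map_eq)
      exact (Measure.measurePreserving_swap.comp hsw).comp Measure.measurePreserving_swap
    have := hT.integrable_comp_of_integrable hi
    refine this.congr (Eventually.of_forall fun p => ?_)
    simp [T]
  calc ∫ z, u z * discMean χ z b
      = ∫ z, (2 * Real.pi)⁻¹ * ∫ θ in Ioc 0 (2 * Real.pi),
          u z * χ (z - circleMap 0 1 θ • b) := by
        congr 1
        ext z
        rw [discMean_eq_sub, intervalIntegral.integral_of_le h2π, integral_const_mul]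
        ring
    _ = (2 * Real.pi)⁻¹ * ∫ θ in Ioc 0 (2 * Real.pi), ∫ z,
          u z * χ (z - circleMap 0 1 θ • b) := by
        rw [integral_const_mul]
        congr 1
        exact integral_integral_swap hi'
    _ = (2 * Real.pi)⁻¹ * ∫ θ in Ioc 0 (2 * Real.pi), ∫ z,
          u (z + circleMap 0 1 θ • b) * χ z := by
        congr 2
        ext θ
        rw [← integral_add_right_eq_self _ (circleMap 0 1 θ • b)]
        simp
    _ = ∫ z, (2 * Real.pi)⁻¹ * ∫ θ in Ioc 0 (2 * Real.pi),
          u (z + circleMap 0 1 θ • b) * χ z := by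
        rw [integral_const_mul]
        congr 1
        exact (integral_integral_swap hi).symm
    _ = ∫ z, discMean u z b * χ z := by
        congr 1
        ext z
        rw [discMean_eq, intervalIntegral.integral_of_le h2π, integral_mul_const]
        ring

theorem integrable_bdd_mul {u f : (Fin n → ℂ) → ℝ} (hu : Measurable u) {M : ℝ}
    (hM : ∀ z, |u z| ≤ M) (hf : Integrable f) : Integrable fun z => u z * f z :=
  hf.bdd_mul hu.aestronglyMeasurable (Eventually.of_forall hM)

/-- An infinitesimal sub-mean inequality with defect `h` implies `h + L u ≥ 0` as a distribution,
where `L` is the Levi form in the direction `v`. Integrating the inequality against `χ`, moving the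
mean onto `χ` and expanding it there leaves, after division by `r² / 4`, an error proportional to
`δ`. -/
theorem integral_add_mul_leviForm_nonneg {u h χ : (Fin n → ℂ) → ℝ} (hu : Measurable u) {M : ℝ}
    (hM : ∀ z, |u z| ≤ M) (hχ : ContDiff ℝ 2 χ) (hc : HasCompactSupport χ) (hχ0 : ∀ z, 0 ≤ χ z)
    (hh : Integrable fun z => χ z * h z) (v : Fin n → ℂ)
    (H : ∀ δ > 0, ∃ r₀ > 0, ∀ r : ℝ, 0 < r → r < r₀ → ∀ z ∈ tsupport χ,
      u z - r ^ 2 / 4 * (h z + δ) ≤ discMean u z (r • v)) :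
    0 ≤ ∫ z, (χ z * h z + u z * leviForm χ z v) := by
  have hM0 : 0 ≤ M := (abs_nonneg _).trans (hM 0)
  have hχi : Integrable χ := hχ.continuous.integrable_of_hasCompactSupport hc
  have hLi : Integrable fun z => leviForm χ z v :=
    (continuous_leviForm hχ v).integrable_of_hasCompactSupport (hasCompactSupport_leviForm hc v)
  set K' : Set (Fin n → ℂ) := cthickening ‖v‖ (tsupport χ) with hK'
  have hK'c : IsCompact K' := IsCompact.cthickening hc
  set V : ℝ := volume.real K'
  suffices hs : ∀ δ > 0, -(δ * ((∫ z, χ z) + M * V)) ≤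
      ∫ z, (χ z * h z + u z * leviForm χ z v) by
    have hl : Tendsto (fun δ : ℝ => -(δ * ((∫ z, χ z) + M * V))) (𝓝[>] 0) (𝓝 0) := by
      refine Tendsto.mono_left ?_ nhdsWithin_le_nhds
      simpa using (by fun_prop : Continuous fun δ : ℝ =>
        -(δ * ((∫ z, χ z) + M * V))).tendsto 0
    exact le_of_tendsto hl (eventually_nhdsWithin_of_forall fun δ hδ => hs δ hδ)
  intro δ hδ
  obtain ⟨r₁, hr₁, h1⟩ := exists_abs_discMean_sub_le hχ hc v hδ
  obtain ⟨r₂, hr₂, h2⟩ := H δ hδ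
  -- The bound `r < 1` keeps the circle mean of `χ` supported in `K'`, whose volume does not depend
  -- on `r`.
  obtain ⟨r, hr, hrlt⟩ := exists_between (lt_min (lt_min hr₁ hr₂) one_pos)
  have hrr1 : r < r₁ := hrlt.trans_le ((min_le_left _ _).trans (min_le_left _ _))
  have hrr2 : r < r₂ := hrlt.trans_le ((min_le_left _ _).trans (min_le_right _ _))
  have hrr3 : r < 1 := hrlt.trans_le (min_le_right _ _)
  have hr2 : 0 < r ^ 2 / 4 := by positivity
  set R : (Fin n → ℂ) → ℝ := fun z =>
    discMean χ z (r • v) - χ z - r ^ 2 / 4 * leviForm χ z v with hR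
  have hRc : Continuous R := ((continuous_discMean hχ.continuous _).sub hχ.continuous).sub
    (continuous_const.mul (continuous_leviForm hχ v))
  have hR0 : ∀ z ∉ K', R z = 0 := by
    intro z hz
    have hz' : z ∉ tsupport χ := fun h => hz (self_subset_cthickening _ h)
    have hd : discMean χ z (r • v) = 0 := by
      rw [discMean_eq]
      have : ∀ θ : ℝ, χ (z + circleMap 0 1 θ • r • v) = 0 := fun θ => by
        apply image_eq_zero_of_notMem_tsupport
        intro hmem
        refine hz (mem_cthickening_of_dist_le z _ _ _ hmem ?_)
        rw [dist_eq_norm, sub_add_cancel_left, norm_neg, norm_circleMap_smul, norm_smul,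
          Real.norm_of_nonneg hr.le]
        nlinarith [norm_nonneg v]
      simp [this]
    simp [hR, hd, image_eq_zero_of_notMem_tsupport hz', leviForm_eq_zero_of_notMem_tsupport hz']
  have hRi : Integrable R := hRc.integrable_of_hasCompactSupport (HasCompactSupport.intro hK'c hR0)
  have hDi : Integrable fun z => discMean χ z (r • v) := by
    have := (hRi.add hχi).add (hLi.const_mul (r ^ 2 / 4))
    refine this.congr (Eventually.of_forall fun z => ?_)
    simp only [hR, Pi.add_apply]
    ring
  have hRle : ∫ z, u z * R z ≤ r ^ 2 / 4 * (δ * (M * V)) := by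
    have hset : ∫ z, u z * R z = ∫ z in K', u z * R z := by
      rw [setIntegral_eq_integral_of_forall_compl_eq_zero]
      intro z hz
      simp [hR0 z hz]
    have hb := norm_setIntegral_le_of_norm_le_const (μ := volume) (s := K')
      (f := fun z => u z * R z) (C := M * (r ^ 2 / 4 * δ)) hK'c.measure_lt_top fun z _ => by
        rw [norm_mul]
        exact mul_le_mul (hM z) (h1 r hr hrr1 z) (norm_nonneg _) hM0
    rw [hset]
    refine (le_abs_self _).trans (hb.trans_eq ?_)
    ring
  have hmain : -(r ^ 2 / 4) * ∫ z, χ z * (h z + δ) ≤ ∫ z, (discMean u z (r • v) - u z) * χ z := by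
    rw [← integral_const_mul]
    have hi1 : Integrable fun z => χ z * (h z + δ) := by
      simp only [mul_add]
      exact hh.add (hχi.mul_const δ)
    have hi2 : Integrable fun z => (discMean u z (r • v) - u z) * χ z := by
      simp only [sub_mul]
      exact (integrable_discMean_mul hu hM hχi _).sub (integrable_bdd_mul hu hM hχi)
    refine integral_mono (hi1.const_mul _) hi2 fun z => ?_
    by_cases hz : z ∈ tsupport χ
    · have := mul_le_mul_of_nonneg_right (h2 r hr hrr2 z hz) (hχ0 z)
      simp only
      nlinarith
    · simp [image_eq_zero_of_notMem_tsupport hz]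
  have hfub : ∫ z, (discMean u z (r • v) - u z) * χ z =
      (∫ z, u z * R z) + r ^ 2 / 4 * ∫ z, u z * leviForm χ z v := by
    rw [← integral_const_mul, ← integral_add (integrable_bdd_mul hu hM hRi)
      ((integrable_bdd_mul hu hM hLi).const_mul _)]
    have e1 : ∫ z, (discMean u z (r • v) - u z) * χ z =
        (∫ z, discMean u z (r • v) * χ z) - ∫ z, u z * χ z := by
      rw [← integral_sub (integrable_discMean_mul hu hM hχi _) (integrable_bdd_mul hu hM hχi)]
      simp only [sub_mul]
    rw [e1, ← integral_mul_discMean hu hM hχi, ← integral_sub (integrable_bdd_mul hu hM hDi)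
      (integrable_bdd_mul hu hM hχi)]
    congr 1
    ext z
    simp only [hR]
    ring
  have hsplit : ∫ z, (χ z * h z + u z * leviForm χ z v) =
      (∫ z, χ z * h z) + ∫ z, u z * leviForm χ z v :=
    integral_add hh (integrable_bdd_mul hu hM hLi)
  have hsplit2 : ∫ z, χ z * (h z + δ) = (∫ z, χ z * h z) + δ * ∫ z, χ z := by
    rw [← integral_const_mul, ← integral_add hh (hχi.const_mul δ)]
    congr 1
    ext z
    ring
  rw [hfub, hsplit2] at hmain
  rw [hsplit]
  have hfin : r ^ 2 / 4 * (-(δ * ((∫ z, χ z) + M * V))) ≤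
      r ^ 2 / 4 * ((∫ z, χ z * h z) + ∫ z, u z * leviForm χ z v) := by
    nlinarith
  exact le_of_mul_le_mul_left hfin hr2

end DiscMean


/-! ### Convolution with rotation invariant kernels -/

section Mollifier

variable {n : ℕ}

/-- A smooth bump supported in the closed Euclidean ball of radius `ε`, invariant under rotations
`w ↦ e^{iθ} w`. -/
def rotBump (ε : ℝ) (w : Fin n → ℂ) : ℝ := expNegInvGlue (ε ^ 2 - ∑ j, ‖w j‖ ^ 2)

/-- The rotation invariant mollifier, of integral `1`. -/
def mollifier (ε : ℝ) (w : Fin n → ℂ) : ℝ := (∫ w' : Fin n → ℂ, rotBump ε w')⁻¹ * rotBump ε w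

/-- The convolution of `u` with the mollifier. -/
def mollify (ε : ℝ) (u : (Fin n → ℂ) → ℝ) : (Fin n → ℂ) → ℝ :=
  convolution u (mollifier ε) (ContinuousLinearMap.lsmul ℝ ℝ) volume

theorem contDiff_sum_norm_sq {m : WithTop ℕ∞} :
    ContDiff ℝ m fun w : Fin n → ℂ => ∑ j, ‖w j‖ ^ 2 :=
  ContDiff.sum fun j _ => (contDiff_apply ℝ ℂ j).norm_sq ℝ

theorem contDiff_rotBump (ε : ℝ) : ContDiff ℝ ∞ (rotBump ε : (Fin n → ℂ) → ℝ) :=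
  expNegInvGlue.contDiff.comp (contDiff_const.sub contDiff_sum_norm_sq)

theorem rotBump_nonneg (ε : ℝ) (w : Fin n → ℂ) : 0 ≤ rotBump ε w := expNegInvGlue.nonneg _

theorem rotBump_eq_zero {ε : ℝ} (hε : 0 < ε) {w : Fin n → ℂ} (hw : w ∉ closedBall 0 ε) :
    rotBump ε w = 0 := by
  apply expNegInvGlue.zero_of_nonpos
  rw [mem_closedBall_zero_iff, pi_norm_le_iff_of_nonneg hε.le] at hw
  push Not at hw
  obtain ⟨j, hj⟩ := hw
  have h1 : ‖w j‖ ^ 2 ≤ ∑ j, ‖w j‖ ^ 2 :=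
    Finset.single_le_sum (f := fun j => ‖w j‖ ^ 2) (fun i _ => by positivity) (Finset.mem_univ j)
  nlinarith

theorem hasCompactSupport_rotBump {ε : ℝ} (hε : 0 < ε) :
    HasCompactSupport (rotBump ε : (Fin n → ℂ) → ℝ) :=
  HasCompactSupport.intro (isCompact_closedBall 0 ε) fun _ hw => rotBump_eq_zero hε hw

theorem integrable_rotBump {ε : ℝ} (hε : 0 < ε) :
    Integrable (rotBump ε : (Fin n → ℂ) → ℝ) :=
  (contDiff_rotBump ε).continuous.integrable_of_hasCompactSupport (hasCompactSupport_rotBump hε)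

theorem integral_rotBump_pos {ε : ℝ} (hε : 0 < ε) :
    0 < ∫ w : Fin n → ℂ, rotBump ε w := by
  refine (contDiff_rotBump ε).continuous.integral_pos_of_hasCompactSupport_nonneg_nonzero
    (hasCompactSupport_rotBump hε) (rotBump_nonneg ε) (x := 0) ?_
  refine (expNegInvGlue.pos_of_pos ?_).ne'
  simp [hε]

theorem contDiff_mollifier (ε : ℝ) : ContDiff ℝ ∞ (mollifier ε : (Fin n → ℂ) → ℝ) :=
  contDiff_const.mul (contDiff_rotBump ε)

theorem mollifier_nonneg (ε : ℝ) (w : Fin n → ℂ) : 0 ≤ mollifier ε w :=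
  mul_nonneg (inv_nonneg.2 (integral_nonneg (rotBump_nonneg ε))) (rotBump_nonneg ε w)

theorem mollifier_eq_zero {ε : ℝ} (hε : 0 < ε) {w : Fin n → ℂ} (hw : w ∉ closedBall 0 ε) :
    mollifier ε w = 0 := by
  rw [mollifier, rotBump_eq_zero hε hw, mul_zero]

theorem hasCompactSupport_mollifier {ε : ℝ} (hε : 0 < ε) :
    HasCompactSupport (mollifier ε : (Fin n → ℂ) → ℝ) :=
  HasCompactSupport.intro (isCompact_closedBall 0 ε) fun _ hw => mollifier_eq_zero hε hw

theorem integrable_mollifier {ε : ℝ} (hε : 0 < ε) :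
    Integrable (mollifier ε : (Fin n → ℂ) → ℝ) :=
  (integrable_rotBump hε).const_mul _

theorem integral_mollifier {ε : ℝ} (hε : 0 < ε) : ∫ w : Fin n → ℂ, mollifier ε w = 1 := by
  simp only [mollifier, integral_const_mul]
  exact inv_mul_cancel₀ (integral_rotBump_pos hε).ne'

theorem mollifier_smul (ε : ℝ) {c : ℂ} (hc : ‖c‖ = 1) (w : Fin n → ℂ) :
    mollifier ε (c • w) = mollifier ε w := by
  simp [mollifier, rotBump, hc]

theorem mollifier_neg (ε : ℝ) (w : Fin n → ℂ) : mollifier ε (-w) = mollifier ε w := by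
  simp [mollifier, rotBump]

theorem measurePreserving_smul_of_norm_eq_one {c : ℂ} (hc : ‖c‖ = 1) :
    MeasurePreserving (fun w : Fin n → ℂ => c • w) := by
  have h1 : MeasurePreserving (fun z : ℂ => c * z) := by
    have := (rotation ⟨c, mem_sphere_zero_iff_norm.2 hc⟩).measurePreserving
    exact this
  exact volume_preserving_pi fun _ : Fin n => h1

section Bounded

variable {u : (Fin n → ℂ) → ℝ} {M ε : ℝ}

theorem locallyIntegrable_of_bounded (hu : Measurable u) (hM : ∀ z, |u z| ≤ M) :
    LocallyIntegrable u := by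
  have h1 : LocallyIntegrable (fun _ : Fin n → ℂ => M) := continuous_const.locallyIntegrable
  exact h1.mono hu.aestronglyMeasurable (Eventually.of_forall fun z =>
    (hM z).trans (le_abs_self M))

theorem mollify_eq (z : Fin n → ℂ) : mollify ε u z = ∫ t, u t * mollifier ε (z - t) := rfl

theorem mollify_eq_add (z : Fin n → ℂ) :
    mollify ε u z = ∫ w, u (z + w) * mollifier ε w := by
  rw [mollify_eq, ← integral_add_left_eq_self _ z]
  congr 1
  ext w
  rw [show z - (z + w) = -w by abel, mollifier_neg]

theorem contDiff_mollify (hu : Measurable u) (hM : ∀ z, |u z| ≤ M) (hε : 0 < ε) :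
    ContDiff ℝ ∞ (mollify ε u) :=
  (hasCompactSupport_mollifier hε).contDiff_convolution_right _
    (locallyIntegrable_of_bounded hu hM) (contDiff_mollifier ε)

theorem fderiv_convolution_apply {k : (Fin n → ℂ) → ℝ} (hu : LocallyIntegrable u)
    (hk : ContDiff ℝ 1 k) (hc : HasCompactSupport k) (v z : Fin n → ℂ) :
    fderiv ℝ (convolution u k (ContinuousLinearMap.lsmul ℝ ℝ) volume) z v =
      convolution u (fun t => fderiv ℝ k t v) (ContinuousLinearMap.lsmul ℝ ℝ) volume z := by
  rw [(hc.hasFDerivAt_convolution_right (ContinuousLinearMap.lsmul ℝ ℝ) hu hk z).fderiv]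
  exact convolution_precompR_apply _ hu (hc.fderiv ℝ) (hk.continuous_fderiv one_ne_zero) z v

/-- Both derivatives fall on the kernel, so `u` need only be locally integrable. -/
theorem fderiv_fderiv_convolution_apply {k : (Fin n → ℂ) → ℝ} (hu : LocallyIntegrable u)
    (hk : ContDiff ℝ ∞ k) (hc : HasCompactSupport k) (v z : Fin n → ℂ) :
    fderiv ℝ (fderiv ℝ (convolution u k (ContinuousLinearMap.lsmul ℝ ℝ) volume)) z v v =
      ∫ t, u t * fderiv ℝ (fderiv ℝ k) (z - t) v v := by
  have hs : ContDiff ℝ ∞ (convolution u k (ContinuousLinearMap.lsmul ℝ ℝ) volume) :=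
    hc.contDiff_convolution_right _ hu hk
  have hcomm (g : (Fin n → ℂ) → ℝ) (hg : ContDiff ℝ ∞ g) (w : Fin n → ℂ) :
      fderiv ℝ (fderiv ℝ g) w v v = fderiv ℝ (fun t => fderiv ℝ g t v) w v := by
    have hd : DifferentiableAt ℝ (fderiv ℝ g) w :=
      (hg.fderiv_right (m := 1) (by norm_cast)).differentiable one_ne_zero w
    rw [fderiv_clm_apply hd (differentiableAt_const v)]
    simp
  have hk' : ContDiff ℝ ∞ fun t => fderiv ℝ k t v :=
    (hk.fderiv_right (by norm_cast)).clm_apply contDiff_const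
  have hc' : HasCompactSupport fun t => fderiv ℝ k t v := hc.fderiv_apply ℝ v
  rw [hcomm _ hs]
  simp only [fderiv_convolution_apply hu (hk.of_le (by norm_cast)) hc]
  rw [fderiv_convolution_apply hu (hk'.of_le (by norm_cast)) hc']
  simp only [convolution, ContinuousLinearMap.lsmul_apply, smul_eq_mul]
  congr 1
  ext t
  rw [hcomm _ hk]

theorem leviForm_mollify (hu : Measurable u) (hM : ∀ z, |u z| ≤ M) (hε : 0 < ε)
    (z v : Fin n → ℂ) :
    leviForm (mollify ε u) z v = ∫ t, u t * leviForm (mollifier ε) (z - t) v := by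
  have hu' := locallyIntegrable_of_bounded hu hM
  have hk := contDiff_mollifier (n := n) ε
  have hc := hasCompactSupport_mollifier (n := n) hε
  have hkd : Continuous (fderiv ℝ (fderiv ℝ (mollifier (n := n) ε))) :=
    ((hk.fderiv_right (m := 1) (by norm_cast)).continuous_fderiv one_ne_zero)
  have hint (w : Fin n → ℂ) :
      Integrable fun t => u t * fderiv ℝ (fderiv ℝ (mollifier ε)) (z - t) w w := by
    refine integrable_bdd_mul hu hM (Continuous.integrable_of_hasCompactSupport (by fun_prop) ?_)
    have h1 : HasCompactSupport fun t => fderiv ℝ (fderiv ℝ (mollifier (n := n) ε)) t w w :=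
      ((hc.fderiv ℝ).fderiv_apply ℝ w).comp_left
        (g := fun L : (Fin n → ℂ) →L[ℝ] ℝ => L w) (by simp)
    exact h1.comp_homeomorph (Homeomorph.subLeft z)
  rw [leviForm_eq, mollify, fderiv_fderiv_convolution_apply hu' hk hc,
    fderiv_fderiv_convolution_apply hu' hk hc, ← integral_add (hint _) (hint _)]
  simp only [leviForm_eq, mul_add]

theorem fderiv_comp_const_sub {F : Type*} [NormedAddCommGroup F] [NormedSpace ℝ F]
    {k : (Fin n → ℂ) → F} (hk : Differentiable ℝ k) (z t : Fin n → ℂ) :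
    fderiv ℝ (fun t => k (z - t)) t = -fderiv ℝ k (z - t) := by
  have h1 : HasFDerivAt (fun t : Fin n → ℂ => z - t)
      (-ContinuousLinearMap.id ℝ (Fin n → ℂ)) t := (hasFDerivAt_id t).const_sub z
  have h2 : HasFDerivAt (fun t => k (z - t)) _ t := (hk (z - t)).hasFDerivAt.comp t h1
  rw [h2.fderiv]
  ext v
  simp

theorem leviForm_comp_const_sub {k : (Fin n → ℂ) → ℝ} (hk : ContDiff ℝ 2 k)
    (z t v : Fin n → ℂ) : leviForm (fun t => k (z - t)) t v = leviForm k (z - t) v := by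
  have h1 : fderiv ℝ (fun t => k (z - t)) = fun t => -fderiv ℝ k (z - t) := by
    ext1 t
    exact fderiv_comp_const_sub (hk.differentiable (by norm_num)) z t
  rw [leviForm_eq, leviForm_eq, h1, fderiv_fun_neg]
  rw [fderiv_comp_const_sub ((hk.fderiv_right (m := 1) (by norm_num)).differentiable
    one_ne_zero)]
  simp

theorem abs_mollify_le (hM : ∀ z, |u z| ≤ M) (hε : 0 < ε) (z : Fin n → ℂ) :
    |mollify ε u z| ≤ M := by
  rw [mollify_eq_add]
  have := norm_integral_le_of_norm_le (f := fun w => u (z + w) * mollifier ε w)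
    ((integrable_mollifier (n := n) hε).const_mul M) (Eventually.of_forall fun w => by
      rw [norm_mul, Real.norm_of_nonneg (mollifier_nonneg ε w)]
      exact mul_le_mul_of_nonneg_right (hM _) (mollifier_nonneg ε w))
  rwa [integral_const_mul, integral_mollifier hε, mul_one] at this

theorem integrable_prod_rot (hu : Measurable u) (hM : ∀ z, |u z| ≤ M) (hε : 0 < ε)
    (z : Fin n → ℂ) :
    Integrable (fun p : (Fin n → ℂ) × ℝ => u (z + circleMap 0 1 p.2 • p.1) * mollifier ε p.1)
      (volume.prod (volume.restrict (Ioc 0 (2 * Real.pi)))) := by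
  have h := (integrable_mollifier (n := n) hε).comp_fst
    (volume.restrict (Ioc (0 : ℝ) (2 * Real.pi)))
  refine h.bdd_mul (hu.comp (Continuous.measurable ?_)).aestronglyMeasurable
    (Eventually.of_forall fun p => hM _)
  unfold circleMap
  fun_prop

theorem integrable_discMean_mul_mollifier (hu : Measurable u) (hM : ∀ z, |u z| ≤ M) (hε : 0 < ε)
    (z : Fin n → ℂ) : Integrable fun w => discMean u z w * mollifier ε w := by
  have := (integrable_prod_rot hu hM hε z).integral_prod_left.const_mul (2 * Real.pi)⁻¹
  refine this.congr (Eventually.of_forall fun w => ?_)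
  simp only [discMean_eq, integral_mul_const,
    intervalIntegral.integral_of_le (by positivity : (0 : ℝ) ≤ 2 * Real.pi)]
  ring

/-- The substitution `w ↦ e^{iθ} w` preserves both Lebesgue measure and the kernel; averaging over
`θ` replaces the values of `u` by its circle means. -/
theorem mollify_eq_discMean (hu : Measurable u) (hM : ∀ z, |u z| ≤ M) (hε : 0 < ε)
    (z : Fin n → ℂ) : mollify ε u z = ∫ w, discMean u z w * mollifier ε w := by
  have h2π : (0 : ℝ) ≤ 2 * Real.pi := by positivity
  have hrot (θ : ℝ) : ∫ w, u (z + circleMap 0 1 θ • w) * mollifier ε w = mollify ε u z := by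
    have hc : ‖circleMap 0 1 θ‖ = 1 := by simp
    rw [mollify_eq_add]
    have hmp := measurePreserving_smul_of_norm_eq_one (n := n) hc
    have hme : MeasurableEmbedding fun w : Fin n → ℂ => circleMap 0 1 θ • w :=
      (Homeomorph.smulOfNeZero _ (norm_ne_zero_iff.1 (by rw [hc]; exact one_ne_zero))).measurableEmbedding
    rw [← hmp.integral_comp hme fun w => u (z + w) * mollifier ε w]
    simp only [mollifier_smul ε hc]
  calc mollify ε u z = (2 * Real.pi)⁻¹ * ∫ θ in Ioc 0 (2 * Real.pi), ∫ w,
          u (z + circleMap 0 1 θ • w) * mollifier ε w := by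
        simp only [hrot]
        rw [← intervalIntegral.integral_of_le h2π, intervalIntegral.integral_const, smul_eq_mul,
          sub_zero, ← mul_assoc, inv_mul_cancel₀ (by positivity), one_mul]
    _ = ∫ w, (2 * Real.pi)⁻¹ * ∫ θ in Ioc 0 (2 * Real.pi),
          u (z + circleMap 0 1 θ • w) * mollifier ε w := by
        rw [integral_const_mul]
        congr 1
        exact (integral_integral_swap (integrable_prod_rot hu hM hε z)).symm
    _ = ∫ w, discMean u z w * mollifier ε w := by
        congr 1
        ext w
        rw [discMean_eq, intervalIntegral.integral_of_le h2π, integral_mul_const]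
        ring

/-- Convergence holds at every such point, not just almost everywhere: semicontinuity bounds the
convolution from above, and the sub-mean property bounds it from below after it is written with
circle means. -/
theorem tendsto_mollify (hu : Measurable u) (hM : ∀ z, |u z| ≤ M) {z : Fin n → ℂ}
    (husc : ∀ δ > 0, ∀ᶠ w in 𝓝 z, u w ≤ u z + δ)
    (hsub : ∀ δ > 0, ∀ᶠ b in 𝓝 (0 : Fin n → ℂ), u z - δ ≤ discMean u z b) :
    Tendsto (fun ε => mollify ε u z) (𝓝[>] 0) (𝓝 (u z)) := by
  rw [Metric.tendsto_nhds]
  intro δ hδ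
  obtain ⟨η₁, hη₁, h1⟩ := Metric.eventually_nhds_iff.1 (husc (δ / 2) (by positivity))
  obtain ⟨η₂, hη₂, h2⟩ := Metric.eventually_nhds_iff.1 (hsub (δ / 2) (by positivity))
  filter_upwards [Ioo_mem_nhdsGT (lt_min hη₁ hη₂)] with ε hε
  have hε0 : 0 < ε := hε.1
  have hk := integrable_mollifier (n := n) hε0
  have hconst (c : ℝ) : ∫ w : Fin n → ℂ, c * mollifier ε w = c := by
    rw [integral_const_mul, integral_mollifier hε0, mul_one]
  have hup : mollify ε u z ≤ u z + δ / 2 := by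
    rw [mollify_eq_add, ← hconst (u z + δ / 2)]
    refine integral_mono (integrable_bdd_mul (hu.comp (measurable_const_add z))
      (fun w => hM _) hk) (hk.const_mul _) fun w => ?_
    by_cases hw : w ∈ closedBall (0 : Fin n → ℂ) ε
    · refine mul_le_mul_of_nonneg_right (h1 ?_) (mollifier_nonneg ε w)
      rw [dist_eq_norm, add_sub_cancel_left]
      exact (mem_closedBall_zero_iff.1 hw).trans_lt (hε.2.trans_le (min_le_left _ _))
    · simp [mollifier_eq_zero hε0 hw]
  have hlo : u z - δ / 2 ≤ mollify ε u z := by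
    rw [mollify_eq_discMean hu hM hε0, ← hconst (u z - δ / 2)]
    refine integral_mono (hk.const_mul _) (integrable_discMean_mul_mollifier hu hM hε0 z)
      fun w => ?_
    by_cases hw : w ∈ closedBall (0 : Fin n → ℂ) ε
    · refine mul_le_mul_of_nonneg_right (h2 ?_) (mollifier_nonneg ε w)
      rw [dist_zero_right]
      exact (mem_closedBall_zero_iff.1 hw).trans_lt (hε.2.trans_le (min_le_right _ _))
    · simp [mollifier_eq_zero hε0 hw]
  rw [Real.dist_eq, abs_lt]
  constructor <;> linarith

/-- The reflected translate `t ↦ mollifier ε (z - t)` is an admissible test function, and testing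
with it computes the Levi form of the convolution at `z`. -/
theorem neg_le_leviForm_mollify (hu : Measurable u) (hM : ∀ z, |u z| ≤ M) {Ω : Set (Fin n → ℂ)}
    {v : Fin n → ℂ} {m : ℝ}
    (H : ∀ χ : (Fin n → ℂ) → ℝ, ContDiff ℝ ∞ χ → HasCompactSupport χ → tsupport χ ⊆ Ω →
      (∀ z, 0 ≤ χ z) → 0 ≤ ∫ z, (χ z * m + u z * leviForm χ z v))
    (hε : 0 < ε) {z : Fin n → ℂ} (hz : closedBall z ε ⊆ Ω) :
    -m ≤ leviForm (mollify ε u) z v := by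
  have hs : ∀ t ∉ closedBall z ε, mollifier ε (z - t) = 0 := fun t ht => by
    refine mollifier_eq_zero hε fun h => ht ?_
    rwa [mem_closedBall_zero_iff, ← dist_eq_norm, dist_comm] at h
  have hcs : HasCompactSupport fun t => mollifier ε (z - t) :=
    HasCompactSupport.intro (isCompact_closedBall z ε) hs
  have hsm : ContDiff ℝ ∞ fun t => mollifier ε (z - t) :=
    (contDiff_mollifier ε).comp (contDiff_const.sub contDiff_id)
  have h := H (fun t => mollifier ε (z - t)) hsm hcs
    ((closure_minimal (fun t ht => by_contra fun h => (Function.mem_support.1 ht) (hs t h)) isClosed_closedBall).trans hz)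
    fun t => mollifier_nonneg ε _
  have hki : Integrable fun t => mollifier ε (z - t) :=
    (integrable_mollifier hε).comp_sub_left z
  have hLi : Integrable fun t => leviForm (fun t => mollifier ε (z - t)) t v :=
    (continuous_leviForm (hsm.of_le (by norm_cast)) v).integrable_of_hasCompactSupport
      (hasCompactSupport_leviForm hcs v)
  rw [integral_add (hki.mul_const m) (integrable_bdd_mul hu hM hLi), integral_mul_const,
    integral_sub_left_eq_self (mollifier ε), integral_mollifier hε] at h
  simp only [leviForm_comp_const_sub ((contDiff_mollifier (n := n) ε).of_le (by norm_cast))] at h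
  rw [← leviForm_mollify hu hM hε] at h
  linarith

end Bounded

end Mollifier


/-! ### Upper semicontinuous functions on open sets -/

section Semicontinuity

variable {Y : Type*} [TopologicalSpace Y]

theorem upperSemicontinuousOn_iff_of_isOpen {u : Y → ℝ} {Ω : Set Y} (hΩ : IsOpen Ω) :
    UpperSemicontinuousOn u Ω ↔ ∀ z ∈ Ω, ∀ δ > 0, ∀ᶠ w in 𝓝 z, u w < u z + δ := by
  rw [upperSemicontinuousOn_iff]
  refine forall₂_congr fun z hz => ?_
  rw [upperSemicontinuousWithinAt_iff, hΩ.nhdsWithin_eq hz]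
  constructor
  · exact fun h δ hδ => h _ (by linarith)
  · intro h y hy
    simpa using h (y - u z) (by linarith)

/-- Nothing is known about `u` off `Ω`, so measurability is stated for its extension by zero. -/
theorem measurable_indicator_of_upperSemicontinuousOn [MeasurableSpace Y] [BorelSpace Y]
    {u : Y → ℝ} {Ω : Set Y} (hΩ : IsOpen Ω) (hu : UpperSemicontinuousOn u Ω) :
    Measurable (Ω.indicator u) := by
  refine measurable_of_Iio fun c => ?_
  have h : Ω.indicator u ⁻¹' Iio c = (Ω ∩ u ⁻¹' Iio c) ∪ (Ωᶜ ∩ {_z | 0 < c}) := by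
    ext z
    by_cases hz : z ∈ Ω <;> simp [hz]
  rw [h]
  refine MeasurableSet.union (IsOpen.measurableSet ?_)
    (hΩ.measurableSet.compl.inter (MeasurableSet.const _))
  rw [isOpen_iff_mem_nhds]
  rintro z ⟨hz, hzc⟩
  have := (upperSemicontinuousOn_iff_of_isOpen hΩ).1 hu z hz (c - u z) (sub_pos.2 hzc)
  filter_upwards [this, hΩ.mem_nhds hz] with w hw hwΩ
  exact ⟨hwΩ, by simpa using hw⟩

end Semicontinuity

/-! ### Plurisubharmonic functions: operations and holomorphic invariance -/

section PSH

variable {n : ℕ}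

theorem leviForm_add {f g : (Fin n → ℂ) → ℝ} {z : Fin n → ℂ} (hf : ContDiffAt ℝ 2 f z)
    (hg : ContDiffAt ℝ 2 g z) (v : Fin n → ℂ) :
    leviForm (fun w => f w + g w) z v = leviForm f z v + leviForm g z v := by
  have h := iteratedFDeriv_add_apply (i := 2) hf hg
  have h' : iteratedFDeriv ℝ 2 (fun w => f w + g w) z =
      iteratedFDeriv ℝ 2 f z + iteratedFDeriv ℝ 2 g z := h
  simp only [leviForm, h', add_apply]
  ring

theorem leviForm_const_mul {f : (Fin n → ℂ) → ℝ} {z : Fin n → ℂ} (hf : ContDiffAt ℝ 2 f z)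
    (c : ℝ) (v : Fin n → ℂ) : leviForm (fun w => c * f w) z v = c * leviForm f z v := by
  have hf' : ContDiffAt ℝ ((2 : ℕ) : WithTop ℕ∞) f z := hf
  have h' : iteratedFDeriv ℝ 2 (fun w => c * f w) z = c • iteratedFDeriv ℝ 2 f z := by
    simpa only [smul_eq_mul] using iteratedFDeriv_const_smul_apply' (a := c) hf'
  simp only [leviForm, h', smul_apply, smul_eq_mul]
  ring

theorem circleIntegrable_comp {u : (Fin n → ℂ) → ℝ} {Ω : Set (Fin n → ℂ)} {M : ℝ}
    (hu : Measurable (Ω.indicator u)) (hM : ∀ z ∈ Ω, |u z| ≤ M) {γ : ℂ → Fin n → ℂ}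
    (hγ : ContinuousOn γ (sphere 0 1)) (hγΩ : MapsTo γ (sphere 0 1) Ω) :
    CircleIntegrable (fun ζ => u (γ ζ)) 0 1 := by
  have hmem (θ : ℝ) : circleMap 0 1 θ ∈ sphere (0 : ℂ) 1 := circleMap_mem_sphere 0 zero_le_one θ
  have hc : Continuous fun θ : ℝ => γ (circleMap 0 1 θ) :=
    hγ.comp_continuous (continuous_circleMap 0 1) hmem
  have hm : Measurable fun θ : ℝ => u (γ (circleMap 0 1 θ)) := by
    have h := hu.comp hc.measurable
    have he : Ω.indicator u ∘ (fun θ : ℝ => γ (circleMap 0 1 θ)) =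
        fun θ : ℝ => u (γ (circleMap 0 1 θ)) := by
      ext θ
      simp [hγΩ (hmem θ)]
    rwa [he] at h
  refine IntervalIntegrable.mono_fun' (g := fun _ => M) intervalIntegrable_const
    hm.aestronglyMeasurable (Eventually.of_forall fun θ => hM _ (hγΩ (hmem θ)))

theorem continuous_disc (a b : Fin n → ℂ) : Continuous fun ζ : ℂ => a + ζ • b := by fun_prop

theorem circleIntegrable_disc {u : (Fin n → ℂ) → ℝ} {Ω : Set (Fin n → ℂ)} {M : ℝ}
    (hu : Measurable (Ω.indicator u)) (hM : ∀ z ∈ Ω, |u z| ≤ M) {a b : Fin n → ℂ}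
    (h : ∀ ζ : ℂ, ‖ζ‖ ≤ 1 → a + ζ • b ∈ Ω) :
    CircleIntegrable (fun ζ : ℂ => u (a + ζ • b)) 0 1 :=
  circleIntegrable_comp hu hM (continuous_disc a b).continuousOn fun ζ hζ =>
    h ζ (by simpa using (mem_sphere_zero_iff_norm.1 hζ).le)

theorem eventually_disc_subset {Ω : Set (Fin n → ℂ)} (hΩ : IsOpen Ω) {z : Fin n → ℂ}
    (hz : z ∈ Ω) : ∀ᶠ b in 𝓝 (0 : Fin n → ℂ), ∀ ζ : ℂ, ‖ζ‖ ≤ 1 → z + ζ • b ∈ Ω := by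
  obtain ⟨r, hr, hb⟩ := Metric.isOpen_iff.1 hΩ z hz
  filter_upwards [ball_mem_nhds 0 hr] with b hbr ζ hζ
  apply hb
  rw [mem_ball, dist_eq_norm, add_sub_cancel_left, norm_smul]
  have := mem_ball_zero_iff.1 hbr
  nlinarith [norm_nonneg b, norm_nonneg ζ]

theorem sub_le_discMean_of_continuousAt {f : (Fin n → ℂ) → ℝ} {Ω : Set (Fin n → ℂ)}
    (hΩ : IsOpen Ω) (hf : ContinuousOn f Ω) {z : Fin n → ℂ} (hz : z ∈ Ω) {δ : ℝ} (hδ : 0 < δ) :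
    ∀ᶠ b in 𝓝 (0 : Fin n → ℂ), f z - δ ≤ discMean f z b := by
  have h1 : ∀ᶠ w in 𝓝 z, f z - δ < f w :=
    (hf.continuousAt (hΩ.mem_nhds hz)).eventually (lt_mem_nhds (by linarith))
  obtain ⟨s, hs, hso, hzs⟩ := _root_.eventually_nhds_iff.1 h1
  filter_upwards [eventually_disc_subset (hso.inter hΩ) ⟨hzs, hz⟩] with b hb
  have hconst : discMean (fun _ => f z - δ) z b = f z - δ := by
    rw [discMean_eq]
    simp only [intervalIntegral.integral_const, smul_eq_mul, sub_zero]
    rw [← mul_assoc, inv_mul_cancel₀ (by positivity), one_mul]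
  rw [← hconst]
  refine discMean_mono (circleIntegrable_const _ _ _) ?_ fun ζ hζ => (hs _ (hb ζ hζ.le).1).le
  refine ContinuousOn.circleIntegrable zero_le_one ?_
  exact hf.comp (continuous_disc z b).continuousOn fun ζ hζ =>
    (hb ζ (mem_sphere_zero_iff_norm.1 hζ).le).2

theorem discMean_add {u w : (Fin n → ℂ) → ℝ} {z b : Fin n → ℂ}
    (hu : CircleIntegrable (fun ζ : ℂ => u (z + ζ • b)) 0 1)
    (hw : CircleIntegrable (fun ζ : ℂ => w (z + ζ • b)) 0 1) :
    discMean (fun y => u y + w y) z b = discMean u z b + discMean w z b := by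
  rw [discMean_eq, discMean_eq, discMean_eq, ← mul_add]
  congr 1
  exact intervalIntegral.integral_add hu hw

theorem discMean_const_mul (c : ℝ) (u : (Fin n → ℂ) → ℝ) (z b : Fin n → ℂ) :
    discMean (fun y => c * u y) z b = c * discMean u z b := by
  rw [discMean_eq, discMean_eq, intervalIntegral.integral_const_mul]
  ring

/-- A function whose Levi form in the sense of distributions is at least `-m` is plurisubharmonic
along holomorphic discs after addition of a `C²` function with Levi form at least `m`, provided it
is determined at each point by its means. -/
theorem le_circleAverage_comp_of_distribution {u ρ : (Fin n → ℂ) → ℝ} (hu : Measurable u) {M : ℝ}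
    (hM : ∀ z, |u z| ≤ M) {Ω : Set (Fin n → ℂ)} (hΩ : IsOpen Ω)
    (husc : ∀ z ∈ Ω, ∀ δ > 0, ∀ᶠ w in 𝓝 z, u w ≤ u z + δ)
    (hsub : ∀ z ∈ Ω, ∀ δ > 0, ∀ᶠ b in 𝓝 (0 : Fin n → ℂ), u z - δ ≤ discMean u z b)
    {m : (Fin n → ℂ) → ℝ}
    (H : ∀ (v : Fin n → ℂ) (χ : (Fin n → ℂ) → ℝ), ContDiff ℝ ∞ χ → HasCompactSupport χ →
      tsupport χ ⊆ Ω → (∀ z, 0 ≤ χ z) → 0 ≤ ∫ z, (χ z * m v + u z * leviForm χ z v))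
    (hρ : ContDiffOn ℝ 2 ρ Ω) (hmρ : ∀ z ∈ Ω, ∀ v, m v ≤ leviForm ρ z v)
    {γ : ℂ → Fin n → ℂ} {U : Set ℂ} (hU : IsOpen U) (hU1 : closedBall 0 1 ⊆ U)
    (hγ : DifferentiableOn ℂ γ U) (hγΩ : MapsTo γ (closedBall 0 1) Ω) :
    u (γ 0) + ρ (γ 0) ≤ Real.circleAverage (fun ζ => u (γ ζ) + ρ (γ ζ)) 0 1 := by
  have hγc : ContinuousOn γ (closedBall 0 1) := hγ.continuousOn.mono hU1
  have hK : IsCompact (γ '' closedBall 0 1) := (isCompact_closedBall 0 1).image_of_continuousOn hγc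
  obtain ⟨ε₀, hε₀, hK'⟩ := hK.exists_cthickening_subset_open hΩ hγΩ.image_subset
  have hρc : ContinuousOn (fun ζ => ρ (γ ζ)) (closedBall 0 1) := hρ.continuousOn.comp hγc hγΩ
  obtain ⟨R, hR⟩ := (isCompact_closedBall (0 : ℂ) 1).exists_bound_of_continuousOn hρc
  have h0 : (0 : ℂ) ∈ closedBall (0 : ℂ) 1 := mem_closedBall_self zero_le_one
  have hmem (θ : ℝ) : circleMap 0 1 θ ∈ closedBall (0 : ℂ) 1 :=
    sphere_subset_closedBall (circleMap_mem_sphere 0 zero_le_one θ)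
  -- For `ε < ε₀` the `ε`-balls around the points of the disc stay in `Ω`. The convolution has Levi
  -- form at least `-m` there, so adding `ρ` makes it nonnegative along `γ`.
  have hle : ∀ᶠ ε in 𝓝[>] (0 : ℝ), mollify ε u (γ 0) + ρ (γ 0) ≤
      Real.circleAverage (fun ζ => mollify ε u (γ ζ) + ρ (γ ζ)) 0 1 := by
    filter_upwards [Ioo_mem_nhdsGT hε₀] with ε hε
    have hs : ContDiff ℝ 2 (mollify ε u) := (contDiff_mollify hu hM hε.1).of_le (by norm_cast)
    have := add_div_le_circleAverage_comp (f := fun z => mollify ε u z + ρ z) (m := 0) hΩ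
      (hs.contDiffOn.add hρ) hU hU1 hγ hγΩ fun ζ hζ => by
        have hz := hγΩ hζ
        rw [leviForm_add hs.contDiffAt (hρ.contDiffAt (hΩ.mem_nhds hz))]
        have h1 := neg_le_leviForm_mollify hu hM (H (deriv γ ζ)) hε.1 (z := γ ζ) (by
          refine (closedBall_subset_cthickening (mem_image_of_mem γ hζ) ε).trans ?_
          exact (cthickening_mono hε.2.le _).trans hK')
        have h2 := hmρ _ hz (deriv γ ζ)
        linarith
    simpa using this
  have hlim1 : Tendsto (fun ε => mollify ε u (γ 0) + ρ (γ 0)) (𝓝[>] 0) (𝓝 (u (γ 0) + ρ (γ 0))) :=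
    (tendsto_mollify hu hM (husc _ (hγΩ h0)) (hsub _ (hγΩ h0))).add_const _
  have hlim2 : Tendsto (fun ε => Real.circleAverage (fun ζ => mollify ε u (γ ζ) + ρ (γ ζ)) 0 1)
      (𝓝[>] 0) (𝓝 (Real.circleAverage (fun ζ => u (γ ζ) + ρ (γ ζ)) 0 1)) := by
    simp only [Real.circleAverage_def]
    refine Tendsto.const_smul ?_ _
    refine intervalIntegral.tendsto_integral_filter_of_dominated_convergence (fun _ => M + R)
      ?_ ?_ intervalIntegrable_const ?_
    · filter_upwards [self_mem_nhdsWithin] with ε hε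
      refine Continuous.aestronglyMeasurable ?_
      refine Continuous.add ?_ (hρc.comp_continuous (continuous_circleMap 0 1) hmem)
      exact (contDiff_mollify hu hM hε).continuous.comp
        (hγc.comp_continuous (continuous_circleMap 0 1) hmem)
    · filter_upwards [self_mem_nhdsWithin] with ε hε
      refine Eventually.of_forall fun θ _ => ?_
      exact (norm_add_le _ _).trans (add_le_add (abs_mollify_le hM hε _) (hR _ (hmem θ)))
    · exact Eventually.of_forall fun θ _ =>
        (tendsto_mollify hu hM (husc _ (hγΩ (hmem θ))) (hsub _ (hγΩ (hmem θ)))).add_const _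
  exact le_of_tendsto_of_tendsto hlim1 hlim2 hle

variable {u w : (Fin n → ℂ) → ℝ} {Ω Ω' : Set (Fin n → ℂ)} {M : ℝ}

theorem IsPSHOn.mono (hu : IsPSHOn u Ω) (h : Ω' ⊆ Ω) : IsPSHOn u Ω' :=
  ⟨hu.1.mono h, fun a b hab => hu.2 a b fun ζ hζ => h (hab ζ hζ)⟩

theorem IsPSHOn.le_discMean (hu : IsPSHOn u Ω) {a b : Fin n → ℂ}
    (h : ∀ ζ : ℂ, ‖ζ‖ ≤ 1 → a + ζ • b ∈ Ω) : u a ≤ discMean u a b := (hu.2 a b h).2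

theorem IsPSHOn.add (hΩ : IsOpen Ω) (hu : IsPSHOn u Ω) (hw : IsPSHOn w Ω) :
    IsPSHOn (fun z => u z + w z) Ω := by
  refine ⟨(upperSemicontinuousOn_iff_of_isOpen hΩ).2 fun z hz δ hδ => ?_, fun a b hab => ?_⟩
  · filter_upwards [(upperSemicontinuousOn_iff_of_isOpen hΩ).1 hu.1 z hz (δ / 2) (by linarith),
      (upperSemicontinuousOn_iff_of_isOpen hΩ).1 hw.1 z hz (δ / 2) (by linarith)] with y h1 h2
    linarith
  · refine ⟨(hu.2 a b hab).1.add (hw.2 a b hab).1, ?_⟩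
    have := discMean_add (hu.2 a b hab).1 (hw.2 a b hab).1
    rw [discMean] at this
    rw [this]
    exact add_le_add (hu.2 a b hab).2 (hw.2 a b hab).2

theorem IsPSHOn.const_mul (hΩ : IsOpen Ω) (hu : IsPSHOn u Ω) {c : ℝ} (hc : 0 < c) :
    IsPSHOn (fun z => c * u z) Ω := by
  refine ⟨(upperSemicontinuousOn_iff_of_isOpen hΩ).2 fun z hz δ hδ => ?_, fun a b hab => ?_⟩
  · filter_upwards [(upperSemicontinuousOn_iff_of_isOpen hΩ).1 hu.1 z hz (δ / c)
      (by positivity)] with y h1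
    have := mul_lt_mul_of_pos_left h1 hc
    rwa [mul_add, mul_div_cancel₀ _ hc.ne'] at this
  · refine ⟨(hu.2 a b hab).1.const_smul (a := c), ?_⟩
    have := discMean_const_mul c u a b
    rw [discMean] at this
    rw [this]
    exact mul_le_mul_of_nonneg_left (hu.2 a b hab).2 hc.le

theorem IsPSHOn.sup (hΩ : IsOpen Ω) (hu : IsPSHOn u Ω) (hw : IsPSHOn w Ω) :
    IsPSHOn (fun z => max (u z) (w z)) Ω := by
  refine ⟨(upperSemicontinuousOn_iff_of_isOpen hΩ).2 fun z hz δ hδ => ?_, fun a b hab => ?_⟩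
  · filter_upwards [(upperSemicontinuousOn_iff_of_isOpen hΩ).1 hu.1 z hz δ hδ,
      (upperSemicontinuousOn_iff_of_isOpen hΩ).1 hw.1 z hz δ hδ] with y h1 h2
    rw [← max_add_add_right]
    exact max_lt_max h1 h2
  · have hi : CircleIntegrable (fun ζ : ℂ => max (u (a + ζ • b)) (w (a + ζ • b))) 0 1 := by
      have h1 := (hu.2 a b hab).1
      have h2 := (hw.2 a b hab).1
      unfold CircleIntegrable at h1 h2 ⊢
      rw [intervalIntegrable_iff] at h1 h2 ⊢
      exact h1.sup h2
    exact ⟨hi, max_le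
      ((hu.2 a b hab).2.trans (discMean_mono (w := fun z => max (u z) (w z))
        (hu.2 a b hab).1 hi fun ζ _ => le_max_left _ _))
      ((hw.2 a b hab).2.trans (discMean_mono (w := fun z => max (u z) (w z))
        (hw.2 a b hab).1 hi fun ζ _ => le_max_right _ _))⟩

theorem isPSHOn_of_leviForm_nonneg (hΩ : IsOpen Ω) (hu : ContDiffOn ℝ 2 u Ω)
    (h : ∀ z ∈ Ω, ∀ v, 0 ≤ leviForm u z v) : IsPSHOn u Ω := by
  refine ⟨hu.continuousOn.upperSemicontinuousOn, fun a b hab => ⟨?_, ?_⟩⟩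
  · refine ContinuousOn.circleIntegrable zero_le_one ?_
    exact hu.continuousOn.comp (continuous_disc a b).continuousOn fun ζ hζ =>
      hab ζ (mem_sphere_zero_iff_norm.1 hζ).le
  · simpa [discMean] using add_div_le_discMean (m := 0) hΩ hu hab fun ζ hζ => h _ (hab ζ hζ) _

theorem isPSHOn_const (hΩ : IsOpen Ω) (c : ℝ) : IsPSHOn (fun _ => c) Ω :=
  isPSHOn_of_leviForm_nonneg hΩ contDiffOn_const fun z _ v => by simp [leviForm_eq]

theorem eventually_indicator_le (hΩ : IsOpen Ω) (hu : UpperSemicontinuousOn u Ω) {z : Fin n → ℂ}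
    (hz : z ∈ Ω) {δ : ℝ} (hδ : 0 < δ) :
    ∀ᶠ y in 𝓝 z, Ω.indicator u y ≤ Ω.indicator u z + δ := by
  filter_upwards [(upperSemicontinuousOn_iff_of_isOpen hΩ).1 hu z hz δ hδ, hΩ.mem_nhds hz]
    with y hy hyΩ
  rw [indicator_of_mem hz, indicator_of_mem hyΩ]
  exact hy.le

theorem discMean_indicator {a b : Fin n → ℂ} (h : ∀ ζ : ℂ, ‖ζ‖ ≤ 1 → a + ζ • b ∈ Ω) :
    discMean (Ω.indicator u) a b = discMean u a b :=
  discMean_congr fun ζ hζ => indicator_of_mem (h ζ hζ.le) _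

theorem abs_indicator_le (hM : ∀ z ∈ Ω, |u z| ≤ M) (hM0 : 0 ≤ M) (z : Fin n → ℂ) :
    |Ω.indicator u z| ≤ M := by
  by_cases hz : z ∈ Ω
  · rw [indicator_of_mem hz]; exact hM z hz
  · rw [indicator_of_notMem hz, abs_zero]; exact hM0

/-- The case `h = 0` of `integral_add_mul_leviForm_nonneg`, for radii so small that the discs
centred on the support of `χ` stay in `Ω`. -/
theorem IsPSHOn.integral_mul_leviForm_nonneg (hΩ : IsOpen Ω) (hu : IsPSHOn u Ω)
    (hM : ∀ z ∈ Ω, |u z| ≤ M) (v : Fin n → ℂ) {χ : (Fin n → ℂ) → ℝ} (hχ : ContDiff ℝ 2 χ)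
    (hc : HasCompactSupport χ) (hs : tsupport χ ⊆ Ω) (hχ0 : ∀ z, 0 ≤ χ z) :
    0 ≤ ∫ z, Ω.indicator u z * leviForm χ z v := by
  have hm := measurable_indicator_of_upperSemicontinuousOn hΩ hu.1
  have h := integral_add_mul_leviForm_nonneg (h := fun _ => 0) hm
    (abs_indicator_le (M := max M 0) (fun z hz => (hM z hz).trans (le_max_left _ _))
    (le_max_right _ _)) hχ hc hχ0 (by simp) v ?_
  · simpa using h
  · intro δ hδ
    obtain ⟨r₀, hr₀, hK⟩ := IsCompact.exists_cthickening_subset_open hc hΩ hs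
    refine ⟨r₀ / (‖v‖ + 1), by positivity, fun r hr hr' z hz => ?_⟩
    have hdisc : ∀ ζ : ℂ, ‖ζ‖ ≤ 1 → z + ζ • r • v ∈ Ω := fun ζ hζ => by
      apply hK
      refine mem_cthickening_of_dist_le _ z _ _ hz ?_
      rw [dist_eq_norm, add_sub_cancel_left, norm_smul, norm_smul, Real.norm_of_nonneg hr.le]
      rw [lt_div_iff₀ (by positivity)] at hr'
      have h0 : 0 ≤ r * ‖v‖ := by positivity
      nlinarith
    rw [discMean_indicator hdisc, indicator_of_mem (hs hz)]
    have := hu.le_discMean hdisc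
    have : 0 ≤ r ^ 2 / 4 * (0 + δ) := by positivity
    linarith

/-- `T` carries affine discs to holomorphic discs that need not be affine. The distributional
inequality for `u` yields the sub-mean property along these as well. -/
theorem IsPSHOn.comp_holomorphic (hΩ : IsOpen Ω) (hu : IsPSHOn u Ω) (hM : ∀ z ∈ Ω, |u z| ≤ M)
    (hΩ' : IsOpen Ω') {T : (Fin n → ℂ) → (Fin n → ℂ)} (hT : DifferentiableOn ℂ T Ω')
    (hTΩ : MapsTo T Ω' Ω) : IsPSHOn (fun z => u (T z)) Ω' := by
  have hm := measurable_indicator_of_upperSemicontinuousOn hΩ hu.1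
  have hM' := abs_indicator_le (u := u) (Ω := Ω) (M := max M 0)
    (fun z hz => (hM z hz).trans (le_max_left _ _)) (le_max_right _ _)
  refine ⟨(upperSemicontinuousOn_iff_of_isOpen hΩ').2 fun z hz δ hδ => ?_, fun a b hab => ⟨?_, ?_⟩⟩
  · have h1 := (upperSemicontinuousOn_iff_of_isOpen hΩ).1 hu.1 (T z) (hTΩ hz) δ hδ
    exact (hT.continuousOn.continuousAt (hΩ'.mem_nhds hz)).eventually h1
  · refine circleIntegrable_comp (γ := fun ζ : ℂ => T (a + ζ • b)) hm hM ?_ ?_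
    · exact hT.continuousOn.comp (continuous_disc a b).continuousOn fun ζ hζ =>
        hab ζ (mem_sphere_zero_iff_norm.1 hζ).le
    · exact fun ζ hζ => hTΩ (hab ζ (mem_sphere_zero_iff_norm.1 hζ).le)
  · have hU : IsOpen ((fun ζ : ℂ => a + ζ • b) ⁻¹' Ω') := hΩ'.preimage (continuous_disc a b)
    have hin : ∀ ζ ∈ closedBall (0 : ℂ) 1, a + ζ • b ∈ Ω' := fun ζ hζ =>
      hab ζ (mem_closedBall_zero_iff.1 hζ)
    have := le_circleAverage_comp_of_distribution (ρ := fun _ => 0) (m := fun _ => 0)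
      (γ := fun ζ : ℂ => T (a + ζ • b)) hm hM' hΩ
      (fun z hz δ hδ => eventually_indicator_le hΩ hu.1 hz hδ) (fun z hz δ hδ => by
        filter_upwards [eventually_disc_subset hΩ hz] with b hb
        rw [discMean_indicator hb, indicator_of_mem hz]
        have := hu.le_discMean hb
        linarith)
      (fun v χ h1 h2 h3 h4 => by
        simpa using hu.integral_mul_leviForm_nonneg hΩ hM v (h1.of_le (by norm_cast)) h2 h3 h4)
      contDiffOn_const (fun z hz v => by simp [leviForm_eq]) hU hin
      (hT.comp (fun ζ _ => by fun_prop) (mapsTo_preimage _ _)) (fun ζ hζ => hTΩ (hin ζ hζ))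
    simp only [add_zero] at this
    rw [indicator_of_mem (hTΩ (hin 0 (by simp)))] at this
    rw [zero_smul, add_zero] at this
    refine this.trans_eq ?_
    rw [Real.circleAverage_def, Real.circleAverage_def]
    congr 2
    ext θ
    rw [indicator_of_mem]
    exact hTΩ (hab _ (by simp))

end PSH


/-! ### Measurability in charts -/

section PartialHomeomorph

variable {n : ℕ} {X : Type*} [TopologicalSpace X]

theorem isOpen_target_inter_preimage (e' : OpenPartialHomeomorph X (Fin n → ℂ)) {s : Set X}
    (hs : IsOpen s) : IsOpen (e'.target ∩ e'.symm ⁻¹' s) :=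
  e'.symm.isOpen_inter_preimage hs

variable [MeasurableSpace X] [BorelSpace X]

theorem aemeasurable_symm (e : OpenPartialHomeomorph X (Fin n → ℂ)) :
    AEMeasurable e.symm (volume.restrict e.target) :=
  e.continuousOn_symm.aemeasurable e.open_target.measurableSet

theorem measurableSet_target_inter_preimage (e : OpenPartialHomeomorph X (Fin n → ℂ))
    {A : Set X} (hA : MeasurableSet A) : MeasurableSet (e.target ∩ e.symm ⁻¹' A) := by
  have h1 : Measurable (e.target.domRestrict e.symm) :=
    (continuousOn_iff_continuous_domRestrict.1 e.continuousOn_symm).measurable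
  have h2 := MeasurableSet.subtype_image e.open_target.measurableSet (h1 hA)
  rwa [show e.target.domRestrict e.symm ⁻¹' A = Subtype.val ⁻¹' (e.symm ⁻¹' A) from rfl,
    Subtype.image_preimage_coe] at h2

theorem measurableSet_source_inter_preimage (e : OpenPartialHomeomorph X (Fin n → ℂ))
    {A : Set (Fin n → ℂ)} (hA : MeasurableSet A) : MeasurableSet (e.source ∩ e ⁻¹' A) := by
  have h1 : Measurable (e.source.domRestrict e) :=
    (continuousOn_iff_continuous_domRestrict.1 e.continuousOn).measurable
  have h2 := MeasurableSet.subtype_image e.open_source.measurableSet (h1 hA)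
  rwa [show e.source.domRestrict e ⁻¹' A = Subtype.val ⁻¹' (e ⁻¹' A) from rfl,
    Subtype.image_preimage_coe] at h2

end PartialHomeomorph

/-! ### Chart changes, the metric in charts, and the volume measure -/

section Manifold

variable {n : ℕ} {X : Type*} [TopologicalSpace X] [ChartedSpace (Fin n → ℂ) X]

section Transition

variable {e e' : OpenPartialHomeomorph X (Fin n → ℂ)}

theorem contDiffOn_transition (he : e ∈ IsManifold.maximalAtlas 𝓘(ℂ, Fin n → ℂ) ω X)
    (he' : e' ∈ IsManifold.maximalAtlas 𝓘(ℂ, Fin n → ℂ) ω X) :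
    ContDiffOn ℂ ω (fun z => e (e'.symm z)) (e'.target ∩ e'.symm ⁻¹' e.source) := by
  rw [← contMDiffOn_iff_contDiffOn]
  exact (contMDiffOn_of_mem_maximalAtlas he).comp
    ((contMDiffOn_symm_of_mem_maximalAtlas he').mono inter_subset_left) fun z hz => hz.2

theorem differentiableOn_transition (he : e ∈ IsManifold.maximalAtlas 𝓘(ℂ, Fin n → ℂ) ω X)
    (he' : e' ∈ IsManifold.maximalAtlas 𝓘(ℂ, Fin n → ℂ) ω X) :
    DifferentiableOn ℂ (fun z => e (e'.symm z)) (e'.target ∩ e'.symm ⁻¹' e.source) :=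
  (contDiffOn_transition he he').differentiableOn (by simp)

theorem mDifferentiable_of_mem_maximalAtlas
    (he : e ∈ IsManifold.maximalAtlas 𝓘(ℂ, Fin n → ℂ) ω X) :
    e.MDifferentiable 𝓘(ℂ, Fin n → ℂ) 𝓘(ℂ, Fin n → ℂ) :=
  ⟨(contMDiffOn_of_mem_maximalAtlas he).mdifferentiableOn (by simp),
    (contMDiffOn_symm_of_mem_maximalAtlas he).mdifferentiableOn (by simp)⟩

theorem mfderiv_symm_eq_comp (he : e ∈ IsManifold.maximalAtlas 𝓘(ℂ, Fin n → ℂ) ω X)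
    (he' : e' ∈ IsManifold.maximalAtlas 𝓘(ℂ, Fin n → ℂ) ω X) {z : Fin n → ℂ}
    (hz : z ∈ e'.target) (hz' : e'.symm z ∈ e.source) (v : Fin n → ℂ) :
    (mfderiv 𝓘(ℂ, Fin n → ℂ) 𝓘(ℂ, Fin n → ℂ) e'.symm z v : Fin n → ℂ) =
      (mfderiv 𝓘(ℂ, Fin n → ℂ) 𝓘(ℂ, Fin n → ℂ) e.symm (e (e'.symm z))
        (fderiv ℂ (fun y => e (e'.symm y)) z v) : Fin n → ℂ) := by
  have hD : e'.target ∩ e'.symm ⁻¹' e.source ∈ 𝓝 z :=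
    (isOpen_target_inter_preimage e' e.open_source).mem_nhds ⟨hz, hz'⟩
  have h1 : e'.symm =ᶠ[𝓝 z] e.symm ∘ fun y => e (e'.symm y) := by
    filter_upwards [hD] with y hy
    exact (e.left_inv hy.2).symm
  have hT : DifferentiableAt ℂ (fun y => e (e'.symm y)) z :=
    (differentiableOn_transition he he').differentiableAt hD
  have hs : MDifferentiableAt 𝓘(ℂ, Fin n → ℂ) 𝓘(ℂ, Fin n → ℂ) e.symm (e (e'.symm z)) :=
    (mDifferentiable_of_mem_maximalAtlas he).mdifferentiableAt_symm (e.map_source hz')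
  have h2 := h1.mfderiv_eq (I := 𝓘(ℂ, Fin n → ℂ)) (I' := 𝓘(ℂ, Fin n → ℂ))
  have h3 := mfderiv_comp z hs hT.mdifferentiableAt
  rw [mfderiv_eq_fderiv] at h3
  have h4 := h2.trans h3
  exact congrArg (fun L : (Fin n → ℂ) →L[ℂ] (Fin n → ℂ) => L v) h4

end Transition

section Form

variable (h : ∀ x : X, TangentSpace 𝓘(ℂ, Fin n → ℂ) x →ₗ⋆[ℂ]
  TangentSpace 𝓘(ℂ, Fin n → ℂ) x →ₗ[ℂ] ℂ)

theorem form_congr {x y : X} (hxy : x = y) (v w : Fin n → ℂ) :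
    h x (v : TangentSpace 𝓘(ℂ, Fin n → ℂ) x) (w : TangentSpace 𝓘(ℂ, Fin n → ℂ) x) =
      h y (v : TangentSpace 𝓘(ℂ, Fin n → ℂ) y) (w : TangentSpace 𝓘(ℂ, Fin n → ℂ) y) := by
  subst hxy
  rfl

theorem formInChart_eq {e e' : OpenPartialHomeomorph X (Fin n → ℂ)}
    (he : e ∈ IsManifold.maximalAtlas 𝓘(ℂ, Fin n → ℂ) ω X)
    (he' : e' ∈ IsManifold.maximalAtlas 𝓘(ℂ, Fin n → ℂ) ω X) {z : Fin n → ℂ}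
    (hz : z ∈ e'.target) (hz' : e'.symm z ∈ e.source) (v w : Fin n → ℂ) :
    formInChart h e' z v w = formInChart h e (e (e'.symm z))
      (fderiv ℂ (fun y => e (e'.symm y)) z v) (fderiv ℂ (fun y => e (e'.symm y)) z w) := by
  unfold formInChart
  have h1 := form_congr h (e.left_inv hz') (mfderiv 𝓘(ℂ, Fin n → ℂ) 𝓘(ℂ, Fin n → ℂ) e'.symm z v)
    (mfderiv 𝓘(ℂ, Fin n → ℂ) 𝓘(ℂ, Fin n → ℂ) e'.symm z w)
  refine h1.symm.trans ?_
  rw [mfderiv_symm_eq_comp he he' hz hz' v, mfderiv_symm_eq_comp he he' hz hz' w]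

theorem formInChart_expand (e : OpenPartialHomeomorph X (Fin n → ℂ)) (z v w : Fin n → ℂ) :
    formInChart h e z v w = ∑ j, ∑ k, conj (v j) * w k *
      formInChart h e z (Pi.single j 1) (Pi.single k 1) := by
  have hv (v : Fin n → ℂ) : v = ∑ j, v j • (Pi.single j 1 : Fin n → ℂ) := by
    ext i
    simp [Finset.sum_apply, Pi.single_apply]
  -- Every tangent space is `ℂⁿ` by definition, so the expansion may be carried out for an arbitrary
  -- sesquilinear form and linear map.
  have key (B : (Fin n → ℂ) →ₗ⋆[ℂ] (Fin n → ℂ) →ₗ[ℂ] ℂ) (D : (Fin n → ℂ) →L[ℂ] (Fin n → ℂ)) :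
      B (D v) (D w) = ∑ j, ∑ k, conj (v j) * w k * B (D (Pi.single j 1)) (D (Pi.single k 1)) := by
    conv_lhs => rw [hv v, hv w]
    simp only [map_sum, map_smul, map_smulₛₗ, LinearMap.sum_apply, LinearMap.smul_apply,
      smul_eq_mul, Finset.mul_sum, mul_assoc]
    rw [Finset.sum_comm]
    refine Finset.sum_congr rfl fun j _ => Finset.sum_congr rfl fun k _ => ?_
    ring
  exact key (h (e.symm z)) (mfderiv 𝓘(ℂ, Fin n → ℂ) 𝓘(ℂ, Fin n → ℂ) e.symm z)

theorem formInChart_zero (e : OpenPartialHomeomorph X (Fin n → ℂ)) (z : Fin n → ℂ) :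
    formInChart h e z 0 0 = 0 := by
  rw [formInChart_expand]
  simp

theorem formInChart_smul_smul (e : OpenPartialHomeomorph X (Fin n → ℂ)) (z v : Fin n → ℂ)
    (c : ℂ) : formInChart h e z (c • v) (c • v) = ((‖c‖ ^ 2 : ℝ) : ℂ) * formInChart h e z v v := by
  rw [formInChart_expand h e z (c • v), formInChart_expand h e z v, Finset.mul_sum]
  refine Finset.sum_congr rfl fun j _ => ?_
  rw [Finset.mul_sum]
  refine Finset.sum_congr rfl fun k _ => ?_
  have : ((‖c‖ ^ 2 : ℝ) : ℂ) = conj c * c := by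
    rw [mul_comm, Complex.mul_conj, Complex.normSq_eq_norm_sq]
  rw [this]
  simp only [Pi.smul_apply, smul_eq_mul, map_mul]
  ring

end Form

variable (g : HermitianMetric n X) {e e' : OpenPartialHomeomorph X (Fin n → ℂ)}

theorem HermitianMetric.continuousOn_formInChart
    (he : e ∈ IsManifold.maximalAtlas 𝓘(ℂ, Fin n → ℂ) ω X) :
    ContinuousOn (fun p : (Fin n → ℂ) × (Fin n → ℂ) => (formInChart g.form e p.1 p.2 p.2).re)
      (e.target ×ˢ univ) := by
  simp only [fun p : (Fin n → ℂ) × (Fin n → ℂ) => formInChart_expand g.form e p.1 p.2 p.2]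
  refine Complex.continuous_re.comp_continuousOn ?_
  refine continuousOn_finsetSum _ fun j _ => continuousOn_finsetSum _ fun k _ => ?_
  refine ContinuousOn.mul (by fun_prop) ?_
  exact (g.smooth e he _ _).continuousOn.comp continuousOn_fst fun p hp => hp.1

theorem HermitianMetric.formInChart_re_pos
    (he : e ∈ IsManifold.maximalAtlas 𝓘(ℂ, Fin n → ℂ) ω X) {z v : Fin n → ℂ} (hz : z ∈ e.target)
    (hv : v ≠ 0) : 0 < (formInChart g.form e z v v).re := by
  refine g.pos _ _ fun h0 => hv ?_
  have h1 := (mDifferentiable_of_mem_maximalAtlas he).comp_symm_deriv hz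
  have h2 := congrArg (fun L : (Fin n → ℂ) →L[ℂ] (Fin n → ℂ) => L v) h1
  refine h2.symm.trans ?_
  refine (congrArg (mfderiv 𝓘(ℂ, Fin n → ℂ) 𝓘(ℂ, Fin n → ℂ) e (e.symm z)) h0).trans ?_
  exact map_zero _

theorem formInChart_re_eq_norm_sq_mul
    (h : ∀ x : X, TangentSpace 𝓘(ℂ, Fin n → ℂ) x →ₗ⋆[ℂ] TangentSpace 𝓘(ℂ, Fin n → ℂ) x →ₗ[ℂ] ℂ)
    (z : Fin n → ℂ) {v : Fin n → ℂ} (hv : v ≠ 0) :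
    (formInChart h e z v v).re = ‖v‖ ^ 2 *
      (formInChart h e z ((‖v‖ : ℂ)⁻¹ • v) ((‖v‖ : ℂ)⁻¹ • v)).re := by
  have hv' : ‖v‖ ≠ 0 := norm_ne_zero_iff.2 hv
  rw [formInChart_smul_smul, Complex.re_ofReal_mul]
  simp only [norm_inv, Complex.norm_real, norm_norm]
  field_simp

theorem norm_inv_norm_smul {v : Fin n → ℂ} (hv : v ≠ 0) : ‖(‖v‖ : ℂ)⁻¹ • v‖ = 1 := by
  rw [norm_smul, norm_inv, Complex.norm_real, norm_norm,
    inv_mul_cancel₀ (norm_ne_zero_iff.2 hv)]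

theorem HermitianMetric.exists_formInChart_le
    (he : e ∈ IsManifold.maximalAtlas 𝓘(ℂ, Fin n → ℂ) ω X) {K : Set (Fin n → ℂ)}
    (hK : IsCompact K) (hKe : K ⊆ e.target) :
    ∃ C > 0, ∀ z ∈ K, ∀ v, (formInChart g.form e z v v).re ≤ C * ‖v‖ ^ 2 := by
  obtain ⟨C, hC⟩ := (hK.prod (isCompact_sphere (0 : Fin n → ℂ) 1)).exists_bound_of_continuousOn
    ((g.continuousOn_formInChart he).mono (prod_mono hKe (subset_univ _)))
  refine ⟨max C 1, by positivity, fun z hz v => ?_⟩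
  rcases eq_or_ne v 0 with rfl | hv
  · simp [formInChart_zero]
  · rw [formInChart_re_eq_norm_sq_mul _ _ hv, mul_comm]
    refine mul_le_mul_of_nonneg_right ?_ (by positivity)
    refine (le_abs_self _).trans ((hC (z, (‖v‖ : ℂ)⁻¹ • v) ⟨hz, ?_⟩).trans (le_max_left _ _))
    exact mem_sphere_zero_iff_norm.2 (norm_inv_norm_smul hv)

/-- By homogeneity it suffices to take `v` on the unit sphere, where the form is positive and
continuous on the compact set `K × sphere`. -/
theorem HermitianMetric.exists_le_formInChart
    (he : e ∈ IsManifold.maximalAtlas 𝓘(ℂ, Fin n → ℂ) ω X) {K : Set (Fin n → ℂ)}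
    (hK : IsCompact K) (hKe : K ⊆ e.target) :
    ∃ c > 0, ∀ z ∈ K, ∀ v, c * ‖v‖ ^ 2 ≤ (formInChart g.form e z v v).re := by
  obtain ⟨c, hc, hcb⟩ := (hK.prod (isCompact_sphere (0 : Fin n → ℂ) 1)).exists_forall_le'
    ((g.continuousOn_formInChart he).mono (prod_mono hKe (subset_univ _))) (a := 0)
    (fun p hp => g.formInChart_re_pos he (hKe hp.1) (by
      have := mem_sphere_zero_iff_norm.1 hp.2
      intro h0
      simp [h0] at this))
  refine ⟨c, hc, fun z hz v => ?_⟩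
  rcases eq_or_ne v 0 with rfl | hv
  · simp [formInChart_zero]
  · rw [formInChart_re_eq_norm_sq_mul _ _ hv, mul_comm]
    refine mul_le_mul_of_nonneg_left ?_ (by positivity)
    exact hcb (z, (‖v‖ : ℂ)⁻¹ • v) ⟨hz, mem_sphere_zero_iff_norm.2 (norm_inv_norm_smul hv)⟩

/-- The matrix of the metric in a chart. -/
def HermitianMetric.matrix (e : OpenPartialHomeomorph X (Fin n → ℂ)) (z : Fin n → ℂ) :
    Matrix (Fin n) (Fin n) ℂ :=
  Matrix.of fun j k => formInChart g.form e z (Pi.single j 1) (Pi.single k 1)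

/-- The density of the volume measure in a chart. -/
def HermitianMetric.density (e : OpenPartialHomeomorph X (Fin n → ℂ)) (z : Fin n → ℂ) : ℝ :=
  n.factorial * (g.matrix e z).det.re

theorem HermitianMetric.density_pos
    (he : e ∈ IsManifold.maximalAtlas 𝓘(ℂ, Fin n → ℂ) ω X) {z : Fin n → ℂ} (hz : z ∈ e.target) :
    0 < g.density e z := by
  open scoped ComplexOrder in
  have hpd : (g.matrix e z).PosDef := by
    refine Matrix.PosDef.of_dotProduct_mulVec_pos ?_ fun v hv => ?_
    · ext j k
      exact g.conj_symm _ _ _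
    · have h1 : star v ⬝ᵥ (g.matrix e z).mulVec v = formInChart g.form e z v v := by
        rw [formInChart_expand]
        simp only [dotProduct, Matrix.mulVec, HermitianMetric.matrix, Matrix.of_apply,
          Finset.mul_sum, Pi.star_apply]
        refine Finset.sum_congr rfl fun j _ => Finset.sum_congr rfl fun k _ => ?_
        rw [RCLike.star_def]
        ring
      rw [h1, Complex.lt_def]
      refine ⟨g.formInChart_re_pos he hz hv, ?_⟩
      have h2 : conj (formInChart g.form e z v v) = formInChart g.form e z v v :=
        g.conj_symm _ _ _
      exact (Complex.conj_eq_iff_im.1 h2).symm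
  have hdet := hpd.det_pos
  exact mul_pos (by positivity) (Complex.lt_def.1 hdet).1

theorem HermitianMetric.continuousOn_density
    (he : e ∈ IsManifold.maximalAtlas 𝓘(ℂ, Fin n → ℂ) ω X) :
    ContinuousOn (g.density e) e.target := by
  have h1 : ContinuousOn (g.matrix e) e.target := by
    refine continuousOn_pi.2 fun j => continuousOn_pi.2 fun k => ?_
    exact (g.smooth e he _ _).continuousOn
  have h2 : ContinuousOn (fun z => (g.matrix e z).det) e.target :=
    Continuous.comp_continuousOn (g := fun A : Matrix (Fin n) (Fin n) ℂ => A.det)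
      (Continuous.matrix_det continuous_id) h1
  exact continuousOn_const.mul (Complex.continuous_re.comp_continuousOn h2)

/-- The matrix of the metric changes by `H ↦ J* H J`, so its determinant is multiplied by `|det
J|²`, which is the real Jacobian determinant of the holomorphic chart change. -/
theorem HermitianMetric.density_eq
    (he : e ∈ IsManifold.maximalAtlas 𝓘(ℂ, Fin n → ℂ) ω X)
    (he' : e' ∈ IsManifold.maximalAtlas 𝓘(ℂ, Fin n → ℂ) ω X) {z : Fin n → ℂ}
    (hz : z ∈ e'.target) (hz' : e'.symm z ∈ e.source) :
    g.density e' z = |((fderiv ℂ (fun y => e (e'.symm y)) z).restrictScalars ℝ).det| *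
      g.density e (e (e'.symm z)) := by
  set L := fderiv ℂ (fun y => e (e'.symm y)) z
  set J : Matrix (Fin n) (Fin n) ℂ := LinearMap.toMatrix' (L : (Fin n → ℂ) →ₗ[ℂ] (Fin n → ℂ))
  have hJ (a j : Fin n) : L (Pi.single j 1) a = J a j := by
    exact (LinearMap.toMatrix'_apply (L : (Fin n → ℂ) →ₗ[ℂ] (Fin n → ℂ)) a j).symm
  have hm : g.matrix e' z = J.conjTranspose * g.matrix e (e (e'.symm z)) * J := by
    ext j k
    rw [HermitianMetric.matrix, Matrix.of_apply, formInChart_eq g.form he he' hz hz',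
      formInChart_expand]
    simp only [Matrix.mul_apply, Matrix.conjTranspose_apply, Finset.sum_mul,
      HermitianMetric.matrix, Matrix.of_apply]
    rw [Finset.sum_comm]
    refine Finset.sum_congr rfl fun a _ => Finset.sum_congr rfl fun b _ => ?_
    rw [← hJ, ← hJ, RCLike.star_def]
    ring
  have hdet : (L.restrictScalars ℝ).det = ‖J.det‖ ^ 2 := by
    have h1 : (L.restrictScalars ℝ).det =
        LinearMap.det ((L : (Fin n → ℂ) →ₗ[ℂ] (Fin n → ℂ)).restrictScalars ℝ) := rfl
    rw [h1, LinearMap.det_restrictScalars, Algebra.norm_complex_apply, Complex.normSq_eq_norm_sq,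
      LinearMap.det_toMatrix']
  rw [hdet, abs_of_nonneg (by positivity), HermitianMetric.density, HermitianMetric.density, hm,
    Matrix.det_mul, Matrix.det_mul, Matrix.det_conjTranspose]
  have h2 : star J.det * (g.matrix e (e (e'.symm z))).det * J.det =
      ((‖J.det‖ ^ 2 : ℝ) : ℂ) * (g.matrix e (e (e'.symm z))).det := by
    rw [← Complex.normSq_eq_norm_sq, ← Complex.mul_conj, RCLike.star_def]
    ring
  rw [h2, Complex.re_ofReal_mul]
  ring

variable [MeasurableSpace X]

theorem HermitianMetric.chartVolume_eq (e : OpenPartialHomeomorph X (Fin n → ℂ)) :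
    g.chartVolume e = ((MeasureSpace.volume.restrict e.target).withDensity fun z =>
      ENNReal.ofReal (g.density e z)).map e.symm := rfl

theorem HermitianMetric.chartVolume_le_volume
    (he : e ∈ IsManifold.maximalAtlas 𝓘(ℂ, Fin n → ℂ) ω X) : g.chartVolume e ≤ g.volume :=
  le_iSup₂_of_le (f := fun e (_ : e ∈ IsManifold.maximalAtlas 𝓘(ℂ, Fin n → ℂ) ω X) =>
    g.chartVolume e) e he le_rfl

variable [BorelSpace X]

theorem HermitianMetric.chartVolume_apply (e : OpenPartialHomeomorph X (Fin n → ℂ)) {A : Set X}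
    (hA : MeasurableSet A) :
    g.chartVolume e A = ∫⁻ z in e.target ∩ e.symm ⁻¹' A, ENNReal.ofReal (g.density e z) := by
  rw [chartVolume_eq, Measure.map_apply_of_aemeasurable
    ((aemeasurable_symm e).mono_ac (withDensity_absolutelyContinuous _ _)) hA, withDensity_apply',
    Measure.restrict_restrict' e.open_target.measurableSet, inter_comm]

/-- Change of variables along the transition map, which is injective and whose Jacobian is accounted
for by `density_eq`. -/
theorem HermitianMetric.chartVolume_le_of_subset
    (he : e ∈ IsManifold.maximalAtlas 𝓘(ℂ, Fin n → ℂ) ω X)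
    (he' : e' ∈ IsManifold.maximalAtlas 𝓘(ℂ, Fin n → ℂ) ω X) {A : Set X}
    (hA : MeasurableSet A) (hAe : A ⊆ e.source) : g.chartVolume e' A ≤ g.chartVolume e A := by
  rw [g.chartVolume_apply e' hA, g.chartVolume_apply e hA]
  set S := e'.target ∩ e'.symm ⁻¹' A
  have hS : MeasurableSet S := measurableSet_target_inter_preimage e' hA
  have hSD : S ⊆ e'.target ∩ e'.symm ⁻¹' e.source := fun z hz => ⟨hz.1, hAe hz.2⟩
  have hder : ∀ z ∈ S, HasFDerivWithinAt (fun y => e (e'.symm y))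
      ((fderiv ℂ (fun y => e (e'.symm y)) z).restrictScalars ℝ) S z := fun z hz =>
    ((((differentiableOn_transition he he').differentiableAt
      ((isOpen_target_inter_preimage e' e.open_source).mem_nhds
        (hSD hz))).hasFDerivAt).restrictScalars ℝ).hasFDerivWithinAt
  have hinj : InjOn (fun y => e (e'.symm y)) S := fun y hy z hz hyz =>
    e'.symm.injOn hy.1 hz.1 (e.injOn (hSD hy).2 (hSD hz).2 hyz)
  have himg : (fun y => e (e'.symm y)) '' S ⊆ e.target ∩ e.symm ⁻¹' A := by
    rintro _ ⟨z, hz, rfl⟩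
    refine ⟨e.map_source (hSD hz).2, ?_⟩
    rw [mem_preimage, e.left_inv (hSD hz).2]
    exact hz.2
  refine le_trans (le_of_eq ?_) (lintegral_mono_set himg)
  rw [lintegral_image_eq_lintegral_abs_det_fderiv_mul MeasureSpace.volume hS hder hinj]
  refine setLIntegral_congr_fun hS fun z hz => ?_
  rw [← ENNReal.ofReal_mul (abs_nonneg _), ← g.density_eq he he' (hSD hz).1 (hSD hz).2]

theorem HermitianMetric.volume_le_chartVolume
    (he : e ∈ IsManifold.maximalAtlas 𝓘(ℂ, Fin n → ℂ) ω X) {A : Set X}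
    (hA : MeasurableSet A) (hAe : A ⊆ e.source) : g.volume A ≤ g.chartVolume e A := by
  -- The volume is a least upper bound. The measure on the right bounds every chart volume, being
  -- infinite on nonempty sets off the domain of `e`, and it agrees with the volume of `e` on that
  -- domain.
  have hle : g.volume ≤ g.chartVolume e + (⊤ : Measure X).restrict e.sourceᶜ := by
    refine iSup₂_le fun e' he' => Measure.le_iff.2 fun B hB => ?_
    have hso := e.open_source.measurableSet
    rw [← measure_inter_add_sdiff B hso, Measure.add_apply]
    refine add_le_add ?_ ?_
    · exact (g.chartVolume_le_of_subset he he' (hB.inter hso) inter_subset_right).trans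
        (measure_mono inter_subset_left)
    · rw [Measure.restrict_apply hB, ← sdiff_eq]
      exact Measure.le_iff'.1 (le_top : g.chartVolume e' ≤ ⊤) _
  refine (Measure.le_iff'.1 hle A).trans ?_
  rw [Measure.add_apply, Measure.restrict_apply hA,
    (disjoint_compl_right_iff_subset.2 hAe).inter_eq, measure_empty, add_zero]

end Manifold


/-! ### The squared Euclidean norm and bounds for Levi forms -/

section NormSq

variable {n : ℕ}

theorem fderiv_sum_norm_sub_sq (a t w : Fin n → ℂ) :
    fderiv ℝ (fun w : Fin n → ℂ => ∑ j, ‖w j - a j‖ ^ 2) t w =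
      ∑ j, 2 * inner ℝ (t j - a j) (w j) := by
  have hj (j : Fin n) : HasFDerivAt (fun w : Fin n → ℂ => ‖w j - a j‖ ^ 2)
      (2 • (innerSL ℝ (t j - a j)).comp (ContinuousLinearMap.proj (R := ℝ) j)) t :=
    HasFDerivAt.norm_sq (((ContinuousLinearMap.proj (R := ℝ) (φ := fun _ : Fin n => ℂ)
      j).hasFDerivAt).sub_const (a j))
  have hs : HasFDerivAt (fun w : Fin n → ℂ => ∑ j, ‖w j - a j‖ ^ 2)
      (∑ j, 2 • (innerSL ℝ (t j - a j)).comp (ContinuousLinearMap.proj (R := ℝ) j)) t :=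
    HasFDerivAt.fun_sum fun j _ => hj j
  rw [hs.fderiv]
  simp
  exact Finset.sum_congr rfl fun j _ => by ring

theorem contDiff_sum_norm_sub_sq {m : WithTop ℕ∞} (a : Fin n → ℂ) :
    ContDiff ℝ m fun w : Fin n → ℂ => ∑ j, ‖w j - a j‖ ^ 2 :=
  ContDiff.sum fun j _ => ((contDiff_apply ℝ ℂ j).sub contDiff_const).norm_sq ℝ

theorem leviForm_sum_norm_sub_sq (a z v : Fin n → ℂ) :
    leviForm (fun w => ∑ j, ‖w j - a j‖ ^ 2) z v = 4 * ∑ j, ‖v j‖ ^ 2 := by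
  have hs : ContDiff ℝ 2 fun w : Fin n → ℂ => ∑ j, ‖w j - a j‖ ^ 2 := contDiff_sum_norm_sub_sq a
  have h2 (w : Fin n → ℂ) :
      fderiv ℝ (fderiv ℝ (fun w : Fin n → ℂ => ∑ j, ‖w j - a j‖ ^ 2)) z w w =
        2 * ∑ j, ‖w j‖ ^ 2 := by
    have hd : DifferentiableAt ℝ (fderiv ℝ (fun w : Fin n → ℂ => ∑ j, ‖w j - a j‖ ^ 2)) z :=
      (hs.fderiv_right (m := 1) (by norm_num)).differentiable one_ne_zero z
    have h3 : fderiv ℝ (fun t => fderiv ℝ (fun w : Fin n → ℂ => ∑ j, ‖w j - a j‖ ^ 2) t w) z w =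
        fderiv ℝ (fderiv ℝ (fun w : Fin n → ℂ => ∑ j, ‖w j - a j‖ ^ 2)) z w w := by
      rw [fderiv_clm_apply hd (differentiableAt_const w)]
      simp
    rw [← h3]
    simp only [fderiv_sum_norm_sub_sq]
    have hj (j : Fin n) : HasFDerivAt (fun t : Fin n → ℂ => 2 * inner ℝ (t j - a j) (w j))
        ((2 : ℝ) • (innerSL ℝ (w j)).comp (ContinuousLinearMap.proj (R := ℝ) j)) z := by
      have h4 : HasFDerivAt (fun t : Fin n → ℂ => inner ℝ (w j) (t j - a j))
          ((innerSL ℝ (w j)).comp (ContinuousLinearMap.proj (R := ℝ) j)) z :=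
        (innerSL ℝ (w j)).hasFDerivAt.comp z ((ContinuousLinearMap.proj (R := ℝ)
          (φ := fun _ : Fin n => ℂ) j).hasFDerivAt.sub_const (a j))
      have h5 := h4.const_mul 2
      simp only [real_inner_comm] at h5 ⊢
      exact h5
    have hsum : HasFDerivAt (fun t : Fin n → ℂ => ∑ j, 2 * inner ℝ (t j - a j) (w j))
        (∑ j, (2 : ℝ) • (innerSL ℝ (w j)).comp (ContinuousLinearMap.proj (R := ℝ) j)) z :=
      HasFDerivAt.fun_sum fun j _ => hj j
    rw [hsum.fderiv]
    simp [Finset.mul_sum]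
  rw [leviForm_eq, h2, h2]
  simp
  ring

theorem norm_sq_le_sum (v : Fin n → ℂ) : ‖v‖ ^ 2 ≤ ∑ j, ‖v j‖ ^ 2 := by
  have h0 : 0 ≤ ∑ j, ‖v j‖ ^ 2 := Finset.sum_nonneg fun j _ => by positivity
  rw [← Real.le_sqrt (norm_nonneg v) h0, pi_norm_le_iff_of_nonneg (Real.sqrt_nonneg _)]
  intro j
  rw [Real.le_sqrt (norm_nonneg _) h0]
  exact Finset.single_le_sum (f := fun j => ‖v j‖ ^ 2) (fun i _ => by positivity)
    (Finset.mem_univ j)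

theorem exists_abs_leviForm_le {f : (Fin n → ℂ) → ℝ} {W K : Set (Fin n → ℂ)} (hW : IsOpen W)
    (hf : ContDiffOn ℝ 2 f W) (hK : IsCompact K) (hKW : K ⊆ W) :
    ∃ C > 0, ∀ z ∈ K, ∀ v, |leviForm f z v| ≤ C * ‖v‖ ^ 2 := by
  obtain ⟨C, hC⟩ := (hK.prod (isCompact_sphere (0 : Fin n → ℂ) 1)).exists_bound_of_continuousOn
    ((continuousOn_leviForm hW hf).mono (prod_mono hKW (subset_univ _)))
  refine ⟨max C 1, by positivity, fun z hz v => ?_⟩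
  rcases eq_or_ne v 0 with rfl | hv
  · simp [leviForm_eq]
  · have h1 : leviForm f z v = ‖v‖ ^ 2 * leviForm f z ((‖v‖ : ℂ)⁻¹ • v) := by
      have hv' : ‖v‖ ≠ 0 := norm_ne_zero_iff.2 hv
      rw [leviForm_smul, norm_inv, Complex.norm_real, norm_norm]
      field_simp
    rw [h1, abs_mul, abs_of_nonneg (by positivity), mul_comm]
    refine mul_le_mul_of_nonneg_right ?_ (by positivity)
    exact (hC (z, (‖v‖ : ℂ)⁻¹ • v)
      ⟨hz, mem_sphere_zero_iff_norm.2 (norm_inv_norm_smul hv)⟩).trans (le_max_left _ _)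

end NormSq

/-! ### Comparison of `ω^n` with Lebesgue measure on compact sets -/

section Volume

variable {n : ℕ} {X : Type*} [TopologicalSpace X] [ChartedSpace (Fin n → ℂ) X]
  (g : HermitianMetric n X) {e : OpenPartialHomeomorph X (Fin n → ℂ)} [MeasurableSpace X]
  [BorelSpace X]

theorem exists_volume_restrict_le (he : e ∈ IsManifold.maximalAtlas 𝓘(ℂ, Fin n → ℂ) ω X)
    {K : Set (Fin n → ℂ)} (hK : IsCompact K) (hKe : K ⊆ e.target) :
    ∃ C > 0, g.volume.restrict (e.source ∩ e ⁻¹' K) ≤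
      ENNReal.ofReal C • (volume.restrict K).map e.symm := by
  obtain ⟨C, hC⟩ := hK.exists_bound_of_continuousOn ((g.continuousOn_density he).mono hKe)
  have hS := measurableSet_source_inter_preimage e hK.measurableSet
  refine ⟨max C 1, by positivity, Measure.le_iff.2 fun A hA => ?_⟩
  rw [Measure.restrict_apply hA, Measure.smul_apply, smul_eq_mul]
  refine (g.volume_le_chartVolume he (hA.inter hS) fun x hx => hx.2.1).trans ?_
  rw [g.chartVolume_apply e (hA.inter hS), Measure.map_apply_of_aemeasurable
    ((aemeasurable_symm e).mono_measure (Measure.restrict_mono_set _ hKe)) hA,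
    Measure.restrict_apply' hK.measurableSet]
  have hsub : e.target ∩ e.symm ⁻¹' (A ∩ (e.source ∩ e ⁻¹' K)) ⊆ e.symm ⁻¹' A ∩ K := by
    rintro z ⟨hz, hzA, -, hzK⟩
    refine ⟨hzA, ?_⟩
    rwa [mem_preimage, e.right_inv hz] at hzK
  calc ∫⁻ z in e.target ∩ e.symm ⁻¹' (A ∩ (e.source ∩ e ⁻¹' K)), ENNReal.ofReal (g.density e z)
      ≤ ∫⁻ z in e.target ∩ e.symm ⁻¹' (A ∩ (e.source ∩ e ⁻¹' K)), ENNReal.ofReal (max C 1) := by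
        refine setLIntegral_mono' (measurableSet_target_inter_preimage e (hA.inter hS))
          fun z hz => ENNReal.ofReal_le_ofReal ?_
        exact (le_abs_self _).trans ((hC z (hsub hz).2).trans (le_max_left _ _))
    _ ≤ _ := by
        rw [setLIntegral_const]
        gcongr

/-- The density is continuous and positive, hence bounded below by a positive constant on `K`. -/
theorem exists_map_symm_le (he : e ∈ IsManifold.maximalAtlas 𝓘(ℂ, Fin n → ℂ) ω X)
    {K : Set (Fin n → ℂ)} (hK : IsCompact K) (hKe : K ⊆ e.target) :
    ∃ C > 0, (volume.restrict K).map e.symm ≤ ENNReal.ofReal C • g.volume := by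
  obtain ⟨c, hc, hcb⟩ := hK.exists_forall_le' ((g.continuousOn_density he).mono hKe) (a := 0)
    fun z hz => g.density_pos he (hKe hz)
  refine ⟨c⁻¹, by positivity, Measure.le_iff.2 fun A hA => ?_⟩
  rw [Measure.smul_apply, smul_eq_mul]
  refine le_trans ?_ (mul_le_mul_right (Measure.le_iff'.1 (g.chartVolume_le_volume he) A) _)
  rw [g.chartVolume_apply e hA, Measure.map_apply_of_aemeasurable
    ((aemeasurable_symm e).mono_measure (Measure.restrict_mono_set _ hKe)) hA,
    Measure.restrict_apply' hK.measurableSet]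
  have hsub : e.symm ⁻¹' A ∩ K ⊆ e.target ∩ e.symm ⁻¹' A := fun z hz => ⟨hKe hz.2, hz.1⟩
  have hm : MeasurableSet (e.symm ⁻¹' A ∩ K) := by
    have := (measurableSet_target_inter_preimage e hA).inter hK.measurableSet
    rwa [inter_right_comm, inter_eq_self_of_subset_right hKe, inter_comm] at this
  have h1 : ENNReal.ofReal c * volume (e.symm ⁻¹' A ∩ K) ≤
      ∫⁻ z in e.target ∩ e.symm ⁻¹' A, ENNReal.ofReal (g.density e z) := by
    refine le_trans ?_ (lintegral_mono_set hsub)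
    rw [← setLIntegral_const]
    exact setLIntegral_mono' hm fun z hz => ENNReal.ofReal_le_ofReal (hcb z hz.2)
  calc volume (e.symm ⁻¹' A ∩ K)
      = ENNReal.ofReal c⁻¹ * (ENNReal.ofReal c * volume (e.symm ⁻¹' A ∩ K)) := by
        rw [← mul_assoc, ← ENNReal.ofReal_mul (by positivity), inv_mul_cancel₀ hc.ne',
          ENNReal.ofReal_one, one_mul]
    _ ≤ _ := mul_le_mul_right h1 _

theorem isFiniteMeasure_volume [CompactSpace X] [IsManifold 𝓘(ℂ, Fin n → ℂ) ω X] :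
    IsFiniteMeasure g.volume := by
  have : IsLocallyFiniteMeasure g.volume := ⟨fun x => by
    set e := chartAt (Fin n → ℂ) x
    have hx : x ∈ e.source := mem_chart_source _ x
    have he : e ∈ IsManifold.maximalAtlas 𝓘(ℂ, Fin n → ℂ) ω X :=
      IsManifold.chart_mem_maximalAtlas x
    obtain ⟨r, hr, hrb⟩ := nhds_basis_closedBall.mem_iff.1
      (e.open_target.mem_nhds (e.map_source hx))
    obtain ⟨C, -, hC⟩ := exists_volume_restrict_le g he (isCompact_closedBall (e x) r) hrb
    refine ⟨e.source ∩ e ⁻¹' closedBall (e x) r, ?_, ?_⟩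
    · exact inter_mem (e.open_source.mem_nhds hx)
        (e.continuousAt hx (closedBall_mem_nhds _ hr))
    · rw [← Measure.restrict_apply_univ]
      refine (Measure.le_iff'.1 hC _).trans_lt ?_
      rw [Measure.smul_apply, smul_eq_mul, Measure.map_apply_of_aemeasurable
        ((aemeasurable_symm e).mono_measure (Measure.restrict_mono_set _ hrb)) MeasurableSet.univ,
        preimage_univ, Measure.restrict_apply_univ]
      exact ENNReal.mul_lt_top ENNReal.ofReal_lt_top measure_closedBall_lt_top⟩
  exact CompactSpace.isFiniteMeasure

end Volume

/-! ### Semicontinuity of quasi-plurisubharmonic functions -/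

section Semicontinuity

variable {n : ℕ} {X : Type*} [TopologicalSpace X] [ChartedSpace (Fin n → ℂ) X]
  {u : X → ℝ} {e : OpenPartialHomeomorph X (Fin n → ℂ)}

theorem IsQuasiPSH.upperSemicontinuousOn (hu : IsQuasiPSH n u)
    (he : e ∈ IsManifold.maximalAtlas 𝓘(ℂ, Fin n → ℂ) ω X) :
    UpperSemicontinuousOn (fun z => u (e.symm z)) e.target := by
  refine (upperSemicontinuousOn_iff_of_isOpen e.open_target).2 fun z hz δ hδ => ?_
  obtain ⟨V, p, f, hV, hzV, -, hp, hf, h⟩ := hu e he z hz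
  have hfc : ∀ᶠ w in 𝓝 z, f w < f z + δ / 2 :=
    (hf.continuousOn.continuousAt (hV.mem_nhds hzV)).eventually (gt_mem_nhds (by linarith))
  filter_upwards [(upperSemicontinuousOn_iff_of_isOpen hV).1 hp.1 z hzV (δ / 2) (by linarith), hfc,
    hV.mem_nhds hzV] with w h1 h2 h3
  rw [h w h3, h z hzV]
  linarith

theorem IsQuasiPSH.measurable [IsManifold 𝓘(ℂ, Fin n → ℂ) ω X] [MeasurableSpace X]
    [BorelSpace X] (hu : IsQuasiPSH n u) : Measurable u := by
  have h : UpperSemicontinuousOn u univ := by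
    refine (upperSemicontinuousOn_iff_of_isOpen isOpen_univ).2 fun x _ δ hδ => ?_
    set e := chartAt (Fin n → ℂ) x
    have hx : x ∈ e.source := mem_chart_source _ x
    have h1 := (upperSemicontinuousOn_iff_of_isOpen e.open_target).1
      (hu.upperSemicontinuousOn (IsManifold.chart_mem_maximalAtlas x)) (e x) (e.map_source hx) δ hδ
    filter_upwards [(e.continuousAt hx).eventually h1, e.open_source.mem_nhds hx] with y hy hys
    rwa [e.left_inv hys, e.left_inv hx] at hy
  simpa using measurable_indicator_of_upperSemicontinuousOn isOpen_univ h

end Semicontinuity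


/-! ### Extension of local plurisubharmonic functions to members of `S` -/

section Glue

variable {n : ℕ} {X : Type*} [TopologicalSpace X]

open scoped Classical in
/-- The extension to `X` of the function `ε (φ - 1)` from the region of `B` where the cutoff `q` is
`1`, by gluing it with `-3 ε q`. -/
def glue (e : OpenPartialHomeomorph X (Fin n → ℂ)) (B : Set (Fin n → ℂ)) (q : (Fin n → ℂ) → ℝ)
    (ε : ℝ) (φ : (Fin n → ℂ) → ℝ) (x : X) : ℝ :=
  if x ∈ e.source ∧ e x ∈ B then max (ε * (φ (e x) - 1)) (-(3 * ε) * q (e x)) else 0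

theorem glue_of_mem {e : OpenPartialHomeomorph X (Fin n → ℂ)} {B : Set (Fin n → ℂ)}
    {q φ : (Fin n → ℂ) → ℝ} {ε : ℝ} {x : X} (hx : x ∈ e.source) (hxB : e x ∈ B) :
    glue e B q ε φ x = max (ε * (φ (e x) - 1)) (-(3 * ε) * q (e x)) := if_pos ⟨hx, hxB⟩

variable [ChartedSpace (Fin n → ℂ) X]

/-- The conditions on a cutoff function in a chart under which gluing yields `ω`-plurisubharmonic
functions. -/
structure IsCutoff (g : HermitianMetric n X) (e : OpenPartialHomeomorph X (Fin n → ℂ))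
    (B : Set (Fin n → ℂ)) (q : (Fin n → ℂ) → ℝ) (ε : ℝ) : Prop where
  mem : e ∈ IsManifold.maximalAtlas 𝓘(ℂ, Fin n → ℂ) ω X
  isOpen : IsOpen B
  subset : B ⊆ e.target
  smooth : ContDiff ℝ ∞ q
  compact : HasCompactSupport q
  tsupport_subset : tsupport q ⊆ B
  nonneg : ∀ z, 0 ≤ q z
  le_one : ∀ z, q z ≤ 1
  pos : 0 < ε
  le_third : 3 * ε ≤ 1
  levi_le : ∀ z ∈ B, ∀ v, 3 * ε * leviForm q z v ≤ (formInChart g.form e z v v).re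

variable {g : HermitianMetric n X} {e e' : OpenPartialHomeomorph X (Fin n → ℂ)}
  {B : Set (Fin n → ℂ)} {q : (Fin n → ℂ) → ℝ} {ε : ℝ} {φ ψ : (Fin n → ℂ) → ℝ}

theorem HermitianMetric.integrable_mul_formInChart (g : HermitianMetric n X)
    (he : e ∈ IsManifold.maximalAtlas 𝓘(ℂ, Fin n → ℂ) ω X) {χ : (Fin n → ℂ) → ℝ}
    (hχ : Continuous χ) (hc : HasCompactSupport χ) (hs : tsupport χ ⊆ e.target)
    (v : Fin n → ℂ) : Integrable fun z => χ z * (formInChart g.form e z v v).re := by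
  have hc' : ContinuousOn (fun z => (formInChart g.form e z v v).re) e.target :=
    (g.continuousOn_formInChart he).comp (f := fun z : Fin n → ℂ => (z, v)) (by fun_prop)
      fun z hz => ⟨hz, mem_univ _⟩
  have h1 : IntegrableOn (fun z => χ z * (formInChart g.form e z v v).re) (tsupport χ) :=
    (hχ.continuousOn.mul (hc'.mono hs)).integrableOn_compact hc
  refine (integrableOn_iff_integrable_of_support_subset fun z hz => ?_).1 h1
  by_contra h
  exact hz (by simp [image_eq_zero_of_notMem_tsupport h])

namespace IsCutoff

/-- Where `q` vanishes, the branch `-3 ε q = 0` exceeds `ε (φ - 1) ≤ -ε`, so the maximum joins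
smoothly with the value zero outside the ball. -/
theorem glue_eq_zero (hq : IsCutoff g e B q ε) (hφ : φ ∈ classS₀ e.target) {x : X}
    (hx : x ∉ e.source ∩ e ⁻¹' tsupport q) : glue e B q ε φ x = 0 := by
  by_cases h : x ∈ e.source ∧ e x ∈ B
  · rw [glue_of_mem h.1 h.2, image_eq_zero_of_notMem_tsupport fun hs => hx ⟨h.1, hs⟩, mul_zero]
    refine max_eq_right ?_
    have := (hφ.2 _ (hq.subset h.2)).2
    nlinarith [hq.pos]
  · exact if_neg h

theorem glue_bounds (hq : IsCutoff g e B q ε) (hφ : φ ∈ classS₀ e.target) (x : X) :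
    -1 ≤ glue e B q ε φ x ∧ glue e B q ε φ x ≤ 0 := by
  by_cases h : x ∈ e.source ∧ e x ∈ B
  · rw [glue_of_mem h.1 h.2]
    have h1 := hφ.2 _ (hq.subset h.2)
    have h2 := hq.nonneg (e x)
    have h3 := hq.le_one (e x)
    have h4 := hq.pos
    have h5 := hq.le_third
    refine ⟨le_max_of_le_right ?_, max_le ?_ ?_⟩ <;> nlinarith
  · rw [glue, if_neg h]
    norm_num

theorem abs_glue_le (hq : IsCutoff g e B q ε) (hφ : φ ∈ classS₀ e.target) (x : X) :
    |glue e B q ε φ x| ≤ 1 :=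
  abs_le.2 ⟨(hq.glue_bounds hφ x).1, (hq.glue_bounds hφ x).2.trans zero_le_one⟩

theorem isClosed_support [T2Space X] (hq : IsCutoff g e B q ε) :
    IsClosed (e.source ∩ e ⁻¹' tsupport q) := by
  have h1 : e.source ∩ e ⁻¹' tsupport q = e.symm '' tsupport q :=
    (e.symm_image_eq_source_inter_preimage (hq.tsupport_subset.trans hq.subset)).symm
  rw [h1]
  exact (hq.compact.isCompact.image_of_continuousOn
    (e.continuousOn_symm.mono (hq.tsupport_subset.trans hq.subset))).isClosed

/-- The part of the chart `e'` where `e` takes values in `B`. -/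
def overlap (_hq : IsCutoff g e B q ε) (e' : OpenPartialHomeomorph X (Fin n → ℂ)) :
    Set (Fin n → ℂ) := e'.target ∩ e'.symm ⁻¹' (e.source ∩ e ⁻¹' B)

theorem isOpen_overlap (hq : IsCutoff g e B q ε) : IsOpen (hq.overlap e') :=
  isOpen_target_inter_preimage e' (e.isOpen_inter_preimage hq.isOpen)

theorem overlap_subset (hq : IsCutoff g e B q ε) :
    hq.overlap e' ⊆ e'.target ∩ e'.symm ⁻¹' e.source := fun _ hz => ⟨hz.1, hz.2.1⟩

theorem differentiableOn_overlap (hq : IsCutoff g e B q ε)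
    (he' : e' ∈ IsManifold.maximalAtlas 𝓘(ℂ, Fin n → ℂ) ω X) :
    DifferentiableOn ℂ (fun z => e (e'.symm z)) (hq.overlap e') :=
  (differentiableOn_transition hq.mem he').mono hq.overlap_subset

theorem contDiffOn_cutoff_comp (hq : IsCutoff g e B q ε)
    (he' : e' ∈ IsManifold.maximalAtlas 𝓘(ℂ, Fin n → ℂ) ω X) :
    ContDiffOn ℝ 2 (fun z => -(3 * ε) * q (e (e'.symm z))) (hq.overlap e') := by
  have h1 : ContDiffOn ℝ 2 (fun z => e (e'.symm z)) (hq.overlap e') :=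
    (((contDiffOn_transition hq.mem he').mono hq.overlap_subset).restrict_scalars ℝ).of_le
      (by simp)
  exact contDiffOn_const.mul ((hq.smooth.of_le (by norm_cast)).comp_contDiffOn h1)

theorem isPSHOn_comp (hq : IsCutoff g e B q ε) (hφ : φ ∈ classS₀ e.target)
    (he' : e' ∈ IsManifold.maximalAtlas 𝓘(ℂ, Fin n → ℂ) ω X) :
    IsPSHOn (fun z => φ (e (e'.symm z))) (hq.overlap e') :=
  hφ.1.comp_holomorphic e.open_target (M := 1) (fun z hz => abs_le.2
    ⟨(hφ.2 z hz).1, (hφ.2 z hz).2.trans zero_le_one⟩) hq.isOpen_overlap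
    (hq.differentiableOn_overlap he') fun _ hz => hq.subset hz.2.2

theorem glue_comp_of_mem_overlap (hq : IsCutoff g e B q ε) {z : Fin n → ℂ}
    (hz : z ∈ hq.overlap e') : glue e B q ε φ (e'.symm z) =
      max (ε * (φ (e (e'.symm z)) - 1)) (-(3 * ε) * q (e (e'.symm z))) :=
  glue_of_mem hz.2.1 hz.2.2

/-- Near the support of `q`, adding a large multiple of `|w - z|²` makes both branches psh, hence
also their maximum. Off that support, which is closed in `X`, the function is zero. -/
theorem isQuasiPSH_glue [T2Space X] (hq : IsCutoff g e B q ε) (hφ : φ ∈ classS₀ e.target) :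
    IsQuasiPSH n (glue e B q ε φ) := by
  intro e' he' z hz
  by_cases hzs : e'.symm z ∈ e.source ∩ e ⁻¹' tsupport q
  · have hzW : z ∈ hq.overlap e' := ⟨hz, hzs.1, hq.tsupport_subset hzs.2⟩
    obtain ⟨r, hr, hrW⟩ := nhds_basis_closedBall.mem_iff.1 (hq.isOpen_overlap.mem_nhds hzW)
    have hVW : ball z r ⊆ hq.overlap e' := ball_subset_closedBall.trans hrW
    obtain ⟨C, hC, hCb⟩ := exists_abs_leviForm_le hq.isOpen_overlap
      (hq.contDiffOn_cutoff_comp he') (isCompact_closedBall z r) hrW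
    let ρ : (Fin n → ℂ) → ℝ := fun w => C * ∑ j, ‖w j - z j‖ ^ 2
    have hρ (m : WithTop ℕ∞) : ContDiff ℝ m ρ := contDiff_const.mul (contDiff_sum_norm_sub_sq z)
    have hρL (w v : Fin n → ℂ) : C * ‖v‖ ^ 2 ≤ leviForm ρ w v := by
      have h1 : leviForm ρ w v = C * (4 * ∑ j, ‖v j‖ ^ 2) := by
        rw [leviForm_const_mul (contDiff_sum_norm_sub_sq z).contDiffAt,
          leviForm_sum_norm_sub_sq]
      rw [h1]
      refine mul_le_mul_of_nonneg_left ?_ hC.le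
      have := norm_sq_le_sum v
      nlinarith [sq_nonneg ‖v‖]
    have h1 : IsPSHOn (fun w => ε * φ (e (e'.symm w)) + (ρ w + -ε)) (ball z r) := by
      refine (((hq.isPSHOn_comp hφ he').mono hVW).const_mul isOpen_ball hq.pos).add isOpen_ball ?_
      refine isPSHOn_of_leviForm_nonneg isOpen_ball ((hρ 2).add contDiff_const).contDiffOn
        fun w _ v => ?_
      rw [leviForm_add (hρ 2).contDiffAt contDiffAt_const]
      have h2 : leviForm (fun _ : Fin n → ℂ => -ε) w v = 0 := by simp [leviForm_eq]
      rw [h2, add_zero]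
      exact le_trans (by positivity) (hρL w v)
    have h2 : IsPSHOn (fun w => -(3 * ε) * q (e (e'.symm w)) + ρ w) (ball z r) := by
      have hc := (hq.contDiffOn_cutoff_comp he').mono hVW
      refine isPSHOn_of_leviForm_nonneg isOpen_ball (hc.add (hρ 2).contDiffOn) fun w hw v => ?_
      rw [leviForm_add (hc.contDiffAt (isOpen_ball.mem_nhds hw)) (hρ 2).contDiffAt]
      have h3 := (abs_le.1 (hCb w (ball_subset_closedBall hw) v)).1
      have h4 := hρL w v
      linarith
    refine ⟨ball z r, fun w => max (ε * φ (e (e'.symm w)) + (ρ w + -ε))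
      (-(3 * ε) * q (e (e'.symm w)) + ρ w), fun w => -ρ w, isOpen_ball, mem_ball_self hr,
      hVW.trans fun w hw => hw.1, h1.sup isOpen_ball h2, (hρ ∞).neg.contDiffOn, fun w hw => ?_⟩
    rw [hq.glue_comp_of_mem_overlap (hVW hw), ← sub_eq_add_neg, ← max_sub_sub_right]
    congr 1 <;> ring
  · have hopen : IsOpen (e'.target ∩ e'.symm ⁻¹' (e.source ∩ e ⁻¹' tsupport q)ᶜ) :=
      isOpen_target_inter_preimage e' hq.isClosed_support.isOpen_compl
    exact ⟨_, fun _ => 0, fun _ => 0, hopen, ⟨hz, hzs⟩, inter_subset_left,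
      isPSHOn_const hopen 0, contDiffOn_const, fun w hw => by
        rw [hq.glue_eq_zero hφ hw.2, add_zero]⟩

/-- `levi_le` is given in the chart `e`. An affine disc of `e'` is a holomorphic disc in `e`, and
the metric transforms by the derivative of the chart change, so the Levi form of `-3 ε q` along that
disc is at least `-r² m`. -/
theorem le_discMean_cutoff_comp (hq : IsCutoff g e B q ε)
    (he' : e' ∈ IsManifold.maximalAtlas 𝓘(ℂ, Fin n → ℂ) ω X) {z v : Fin n → ℂ} {r m : ℝ}
    (hdisc : ∀ ζ : ℂ, ‖ζ‖ ≤ 1 → z + ζ • r • v ∈ hq.overlap e')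
    (hm : ∀ ζ : ℂ, ‖ζ‖ ≤ 1 → (formInChart g.form e' (z + ζ • r • v) v v).re ≤ m) :
    -(3 * ε) * q (e (e'.symm z)) - r ^ 2 / 4 * m ≤
      discMean (fun w => -(3 * ε) * q (e (e'.symm w))) z (r • v) := by
  have hU : IsOpen ((fun ζ : ℂ => z + ζ • r • v) ⁻¹' hq.overlap e') :=
    hq.isOpen_overlap.preimage (continuous_disc z (r • v))
  have hd (ζ : ℂ) : HasDerivAt (fun ζ : ℂ => z + ζ • r • v) (r • v) ζ := by
    simpa using ((hasDerivAt_id ζ).smul_const (r • v)).const_add z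
  have hq2 : ContDiff ℝ 2 q := hq.smooth.of_le (by norm_cast)
  have key := add_div_le_circleAverage_comp (f := fun w => -(3 * ε) * q w)
    (γ := fun ζ : ℂ => e (e'.symm (z + ζ • r • v))) (m := -(r ^ 2 * m)) isOpen_univ
    (contDiff_const.mul hq2).contDiffOn hU (fun ζ hζ => hdisc ζ (mem_closedBall_zero_iff.1 hζ))
    ((hq.differentiableOn_overlap he').comp (fun ζ _ => by fun_prop) (mapsTo_preimage _ _))
    (fun _ _ => mem_univ _) fun ζ hζ => by
      have hζ' := mem_closedBall_zero_iff.1 hζ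
      have hw := hdisc ζ hζ'
      have hT : HasFDerivAt (fun w => e (e'.symm w))
          (fderiv ℂ (fun w => e (e'.symm w)) (z + ζ • r • v)) (z + ζ • r • v) :=
        ((hq.differentiableOn_overlap he').differentiableAt
          (hq.isOpen_overlap.mem_nhds hw)).hasFDerivAt
      have hder : deriv (fun ζ : ℂ => e (e'.symm (z + ζ • r • v))) ζ =
          fderiv ℂ (fun w => e (e'.symm w)) (z + ζ • r • v) (r • v) := by
        exact (HasFDerivAt.comp_hasDerivAt (f := fun ζ : ℂ => z + ζ • r • v) ζ hT (hd ζ)).deriv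
      rw [leviForm_const_mul hq2.contDiffAt, hder]
      have h1 := hq.levi_le _ hw.2.2 (fderiv ℂ (fun w => e (e'.symm w)) (z + ζ • r • v) (r • v))
      rw [← formInChart_eq g.form hq.mem he' hw.1 hw.2.1] at h1
      have h2 := formInChart_smul_smul g.form e' (z + ζ • r • v) v (r : ℂ)
      rw [show (r : ℂ) • v = r • v from rfl, Complex.norm_real, Real.norm_eq_abs, sq_abs] at h2
      rw [h2, Complex.re_ofReal_mul] at h1
      have h3 := mul_le_mul_of_nonneg_left (hm ζ hζ') (sq_nonneg r)
      linarith
  simp only [zero_smul, add_zero] at key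
  rw [discMean]
  linarith

theorem circleIntegrable_glue [T2Space X] (hq : IsCutoff g e B q ε) (hφ : φ ∈ classS₀ e.target)
    (he' : e' ∈ IsManifold.maximalAtlas 𝓘(ℂ, Fin n → ℂ) ω X) {z b : Fin n → ℂ}
    (hdisc : ∀ ζ : ℂ, ‖ζ‖ ≤ 1 → z + ζ • b ∈ e'.target) :
    CircleIntegrable (fun ζ : ℂ => glue e B q ε φ (e'.symm (z + ζ • b))) 0 1 :=
  circleIntegrable_disc (u := fun w => glue e B q ε φ (e'.symm w))
    (measurable_indicator_of_upperSemicontinuousOn e'.open_target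
      ((hq.isQuasiPSH_glue hφ).upperSemicontinuousOn he')) (fun _ _ => hq.abs_glue_le hφ _) hdisc

/-- Each branch is bounded by its own mean up to `r² m / 4`, and its mean is at most that of the
maximum. -/
theorem glue_le_discMean_of_overlap [T2Space X] (hq : IsCutoff g e B q ε)
    (hφ : φ ∈ classS₀ e.target) (he' : e' ∈ IsManifold.maximalAtlas 𝓘(ℂ, Fin n → ℂ) ω X)
    {z v : Fin n → ℂ} {r m : ℝ} (hm0 : 0 ≤ m)
    (hdisc : ∀ ζ : ℂ, ‖ζ‖ ≤ 1 → z + ζ • r • v ∈ hq.overlap e')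
    (hm : ∀ ζ : ℂ, ‖ζ‖ ≤ 1 → (formInChart g.form e' (z + ζ • r • v) v v).re ≤ m) :
    glue e B q ε φ (e'.symm z) - r ^ 2 / 4 * m ≤
      discMean (fun w => glue e B q ε φ (e'.symm w)) z (r • v) := by
  have hz : z ∈ hq.overlap e' := by simpa using hdisc 0 (by simp)
  have hi := hq.circleIntegrable_glue hφ he' fun ζ hζ => (hdisc ζ hζ).1
  have hle (ζ : ℂ) (hζ : ‖ζ‖ = 1) := hq.glue_comp_of_mem_overlap (φ := φ) (hdisc ζ hζ.le)
  rw [hq.glue_comp_of_mem_overlap hz, sub_le_iff_le_add]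
  refine max_le ?_ ?_
  · have hpsh : IsPSHOn (fun w => ε * φ (e (e'.symm w)) + -ε) (hq.overlap e') :=
      ((hq.isPSHOn_comp hφ he').const_mul hq.isOpen_overlap hq.pos).add hq.isOpen_overlap
        (isPSHOn_const hq.isOpen_overlap _)
    have h1 := hpsh.le_discMean hdisc
    have h2 := discMean_mono (u := fun w => ε * φ (e (e'.symm w)) + -ε)
      (w := fun w => glue e B q ε φ (e'.symm w)) (hpsh.2 _ _ hdisc).1 hi fun ζ hζ => by
      rw [hle ζ hζ]
      exact le_max_of_le_left (by linarith)
    have h3 : 0 ≤ r ^ 2 / 4 * m := by positivity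
    linarith
  · have h1 := hq.le_discMean_cutoff_comp he' hdisc hm
    have h2 := discMean_mono (u := fun w => -(3 * ε) * q (e (e'.symm w)))
      (w := fun w => glue e B q ε φ (e'.symm w))
      (ContinuousOn.circleIntegrable zero_le_one
        ((hq.contDiffOn_cutoff_comp he').continuousOn.comp (continuous_disc z (r • v)).continuousOn
          fun ζ hζ => hdisc ζ (mem_sphere_zero_iff_norm.1 hζ).le)) hi fun ζ hζ => by
      rw [hle ζ hζ]
      exact le_max_right _ _
    linarith

theorem exists_glue_le_discMean [T2Space X] (hq : IsCutoff g e B q ε)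
    (hφ : φ ∈ classS₀ e.target) (he' : e' ∈ IsManifold.maximalAtlas 𝓘(ℂ, Fin n → ℂ) ω X)
    {K : Set (Fin n → ℂ)} (hK : IsCompact K) (hKe : K ⊆ e'.target) (v : Fin n → ℂ) {δ : ℝ}
    (hδ : 0 < δ) : ∃ r₀ > 0, ∀ r : ℝ, 0 < r → r < r₀ → ∀ z ∈ K,
      (∀ ζ : ℂ, ‖ζ‖ ≤ 1 → z + ζ • r • v ∈ e'.target) ∧
      glue e B q ε φ (e'.symm z) - r ^ 2 / 4 * ((formInChart g.form e' z v v).re + δ) ≤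
        discMean (fun w => glue e B q ε φ (e'.symm w)) z (r • v) := by
  set h : (Fin n → ℂ) → ℝ := fun z => (formInChart g.form e' z v v).re with hh
  have hc : ContinuousOn h e'.target :=
    (g.continuousOn_formInChart he').comp (f := fun z : Fin n → ℂ => (z, v)) (by fun_prop)
      fun z hz => ⟨hz, mem_univ _⟩
  have hpos : ∀ z ∈ e'.target, 0 ≤ h z := fun z hz => by
    rcases eq_or_ne v 0 with rfl | hv
    · simp [hh, formInChart_zero]
    · exact (g.formInChart_re_pos he' hz hv).le
  set W₂ : Set (Fin n → ℂ) := e'.target ∩ e'.symm ⁻¹' (e.source ∩ e ⁻¹' tsupport q)ᶜ with hW₂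
  have hopen : IsOpen W₂ := isOpen_target_inter_preimage e' hq.isClosed_support.isOpen_compl
  obtain ⟨r₁, hr₁, hK₁⟩ := hK.exists_cthickening_subset_open e'.open_target hKe
  have huc := (IsCompact.cthickening hK (r := r₁)).uniformContinuousOn_of_continuous (hc.mono hK₁)
  obtain ⟨r₂, hr₂, hh₂⟩ := Metric.uniformContinuousOn_iff.1 huc δ hδ
  -- Below a Lebesgue number, each disc lies entirely in the overlap or entirely off the support of
  -- the cutoff.
  obtain ⟨r₃, hr₃, hleb⟩ := lebesgue_number_lemma_of_metric (s := K)
    (c := fun i : Bool => if i then hq.overlap e' else W₂) hK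
    (fun i => by cases i <;> simp [hq.isOpen_overlap, hopen]) fun z hz => by
      rw [mem_iUnion]
      by_cases hzs : e'.symm z ∈ e.source ∩ e ⁻¹' tsupport q
      · exact ⟨true, (⟨hKe hz, hzs.1, hq.tsupport_subset hzs.2⟩ : z ∈ hq.overlap e')⟩
      · exact ⟨false, (⟨hKe hz, hzs⟩ : z ∈ W₂)⟩
  refine ⟨min r₁ (min r₂ r₃) / (‖v‖ + 1), by positivity, fun r hr hr' z hz => ?_⟩
  have hnear (ζ : ℂ) (hζ : ‖ζ‖ ≤ 1) : dist (z + ζ • r • v) z < min r₁ (min r₂ r₃) := by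
    rw [dist_eq_norm, add_sub_cancel_left, norm_smul, norm_smul, Real.norm_of_nonneg hr.le]
    rw [lt_div_iff₀ (by positivity)] at hr'
    have h0 : 0 ≤ r * ‖v‖ := by positivity
    nlinarith
  have hin (ζ : ℂ) (hζ : ‖ζ‖ ≤ 1) : z + ζ • r • v ∈ cthickening r₁ K :=
    mem_cthickening_of_dist_le _ z _ _ hz ((hnear ζ hζ).le.trans (min_le_left _ _))
  refine ⟨fun ζ hζ => hK₁ (hin ζ hζ), ?_⟩
  have hm (ζ : ℂ) (hζ : ‖ζ‖ ≤ 1) : h (z + ζ • r • v) ≤ h z + δ := by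
    have := hh₂ _ (hin ζ hζ) z (self_subset_cthickening _ hz)
      ((hnear ζ hζ).trans_le ((min_le_right _ _).trans (min_le_left _ _)))
    rw [Real.dist_eq] at this
    linarith [(abs_lt.1 this).2]
  have hm0 : 0 ≤ h z + δ := by linarith [hpos z (hKe hz)]
  obtain ⟨i, hi⟩ := hleb z hz
  have hball (ζ : ℂ) (hζ : ‖ζ‖ ≤ 1) : z + ζ • r • v ∈ ball z r₃ :=
    (hnear ζ hζ).trans_le ((min_le_right _ _).trans (min_le_right _ _))
  cases i
  · have hsub : ∀ ζ : ℂ, ‖ζ‖ ≤ 1 → z + ζ • r • v ∈ W₂ := fun ζ hζ => by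
      simpa using hi (hball ζ hζ)
    have hz₂ : z ∈ W₂ := by simpa using hsub 0 (by simp)
    have h1 : discMean (fun w => glue e B q ε φ (e'.symm w)) z (r • v) = 0 := by
      rw [discMean_congr (w := fun _ => 0) fun ζ hζ => hq.glue_eq_zero hφ (hsub ζ hζ.le).2]
      simp [discMean_eq]
    rw [h1, hq.glue_eq_zero hφ hz₂.2]
    have : 0 ≤ r ^ 2 / 4 * (h z + δ) := by positivity
    linarith
  · exact hq.glue_le_discMean_of_overlap hφ he' hm0 (fun ζ hζ => by
      simpa using hi (hball ζ hζ)) hm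

theorem isOmegaPSH_glue [T2Space X] (hq : IsCutoff g e B q ε) (hφ : φ ∈ classS₀ e.target) :
    IsOmegaPSH g (glue e B q ε φ) := by
  refine ⟨hq.isQuasiPSH_glue hφ, fun e' he' v χ hχ hc hs hχ0 => ?_⟩
  have hint := g.integrable_mul_formInChart he' hχ.continuous hc hs v
  have key := integral_add_mul_leviForm_nonneg
    (u := e'.target.indicator fun z => glue e B q ε φ (e'.symm z))
    (h := fun z => (formInChart g.form e' z v v).re)
    (measurable_indicator_of_upperSemicontinuousOn e'.open_target
      ((hq.isQuasiPSH_glue hφ).upperSemicontinuousOn he'))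
    (abs_indicator_le (fun _ _ => hq.abs_glue_le hφ _) zero_le_one)
    (hχ.of_le (by norm_cast)) hc hχ0 hint v fun δ hδ => by
      obtain ⟨r₀, hr₀, H⟩ := hq.exists_glue_le_discMean hφ he' hc hs v hδ
      refine ⟨r₀, hr₀, fun r hr hr' z hz => ?_⟩
      obtain ⟨hdisc, hle⟩ := H r hr hr' z hz
      rw [discMean_indicator hdisc, indicator_of_mem (hs hz)]
      exact hle
  rw [← setIntegral_eq_integral_of_forall_compl_eq_zero (s := e'.target)] at key
  · refine key.trans_eq (setIntegral_congr_fun e'.open_target.measurableSet fun z hz => ?_)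
    simp only [indicator_of_mem hz]
  · intro z hz
    have hz' : z ∉ tsupport χ := fun h => hz (hs h)
    simp [image_eq_zero_of_notMem_tsupport hz', leviForm_eq_zero_of_notMem_tsupport hz']

theorem glue_mem_classS [T2Space X] (hq : IsCutoff g e B q ε) (hφ : φ ∈ classS₀ e.target)
    (hne : ∃ z ∈ e.target, z ∉ tsupport q) : glue e B q ε φ ∈ classS g := by
  refine ⟨hq.isOmegaPSH_glue hφ, hq.glue_bounds hφ, ?_, ?_⟩
  · rintro _ ⟨x, rfl⟩
    exact (hq.glue_bounds hφ x).2
  · intro b hb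
    obtain ⟨z, hz, hzq⟩ := hne
    have h0 : glue e B q ε φ (e.symm z) = 0 := hq.glue_eq_zero hφ fun h => hzq (by
      have := h.2
      rwa [mem_preimage, e.right_inv hz] at this)
    exact h0 ▸ hb (mem_range_self (e.symm z))

theorem glue_mono (hq : IsCutoff g e B q ε) (h : ∀ z ∈ e.target, φ z ≤ ψ z) (x : X) :
    glue e B q ε φ x ≤ glue e B q ε ψ x := by
  by_cases hx : x ∈ e.source ∧ e x ∈ B
  · rw [glue_of_mem hx.1 hx.2, glue_of_mem hx.1 hx.2]
    refine max_le_max ?_ le_rfl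
    have := h _ (hq.subset hx.2)
    nlinarith [hq.pos]
  · rw [glue, glue, if_neg hx, if_neg hx]

/-- Since `φ ≥ -1`, the first branch is at least `-2ε`, above the second branch `-3ε`. This is where
the factor `3` is used. -/
theorem glue_of_cutoff_eq_one (hq : IsCutoff g e B q ε) (hφ : φ ∈ classS₀ e.target) {x : X}
    (hx : x ∈ e.source) (hxB : e x ∈ B) (h1 : q (e x) = 1) :
    glue e B q ε φ x = ε * (φ (e x) - 1) := by
  rw [glue_of_mem hx hxB, h1]
  refine max_eq_left ?_
  have := (hφ.2 _ (hq.subset hxB)).1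
  nlinarith [hq.pos]

theorem abs_glue_sub_le (hq : IsCutoff g e B q ε) {x : X} (hx : x ∈ e.source) (hxB : e x ∈ B) :
    |glue e B q ε φ x - glue e B q ε ψ x| ≤ ε * |φ (e x) - ψ (e x)| := by
  rw [glue_of_mem hx hxB, glue_of_mem hx hxB]
  refine (abs_max_sub_max_le_abs _ _ _).trans_eq ?_
  rw [← mul_sub, abs_mul, abs_of_pos hq.pos]
  congr 2
  ring

end IsCutoff

end Glue


/-! ### From the global to the local estimate -/

section GlobalToLocal

variable {n : ℕ} {X : Type*} [TopologicalSpace X] [ChartedSpace (Fin n → ℂ) X]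
  {g : HermitianMetric n X} {e : OpenPartialHomeomorph X (Fin n → ℂ)}
  {B : Set (Fin n → ℂ)} {q : (Fin n → ℂ) → ℝ} {ε : ℝ} {φ ψ : (Fin n → ℂ) → ℝ}

theorem classS₀.sup {Ω : Set (Fin n → ℂ)} (hΩ : IsOpen Ω) (hφ : φ ∈ classS₀ Ω)
    (hψ : ψ ∈ classS₀ Ω) : (fun z => max (φ z) (ψ z)) ∈ classS₀ Ω :=
  ⟨hφ.1.sup hΩ hψ.1, fun z hz => ⟨le_max_of_le_left (hφ.2 z hz).1,
    max_le (hφ.2 z hz).2 (hψ.2 z hz).2⟩⟩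

theorem exists_isCutoff (he : e ∈ IsManifold.maximalAtlas 𝓘(ℂ, Fin n → ℂ) ω X)
    (z₀ : Fin n → ℂ) {R : ℝ} (hR : 0 < R) (hRe : closedBall z₀ R ⊆ e.target) :
    ∃ (q : (Fin n → ℂ) → ℝ) (ε : ℝ), IsCutoff g e (ball z₀ R) q ε ∧
      (∀ z ∈ ball z₀ (R / 3), q z = 1) ∧ tsupport q = closedBall z₀ (R / 2) := by
  let q : ContDiffBump z₀ := ⟨R / 3, R / 2, by positivity, by linarith⟩
  have hsupp : tsupport q = closedBall z₀ (R / 2) := q.tsupport_eq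
  have hsub : closedBall z₀ (R / 2) ⊆ ball z₀ R := closedBall_subset_ball (by linarith)
  have hsub' : closedBall z₀ (R / 2) ⊆ e.target := hsub.trans (ball_subset_closedBall.trans hRe)
  obtain ⟨M, hM, hMb⟩ := exists_abs_leviForm_le isOpen_univ
    (q.contDiff (n := 2)).contDiffOn (isCompact_closedBall z₀ (R / 2)) (subset_univ _)
  obtain ⟨c, hc, hcb⟩ := g.exists_le_formInChart he (isCompact_closedBall z₀ (R / 2)) hsub'
  -- The value `1 / 3` keeps `-3 ε q ≥ -1`; `c / (3 M)` keeps `3 ε` times the Levi form of `q`, of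
  -- size at most `M ‖v‖²`, below the metric, of size at least `c ‖v‖²`.
  have hε : 0 < min (1 / 3) (c / (3 * M)) := by positivity
  refine ⟨q, min (1 / 3) (c / (3 * M)), ⟨he, isOpen_ball, ball_subset_closedBall.trans hRe,
    q.contDiff, q.hasCompactSupport, hsupp.trans_subset hsub, fun _ => q.nonneg,
    fun _ => q.le_one, hε, ?_, fun z hz v => ?_⟩,
    fun z hz => q.one_of_mem_closedBall (ball_subset_closedBall hz), hsupp⟩
  · linarith [min_le_left (1 / 3) (c / (3 * M))]
  · by_cases hzq : z ∈ tsupport q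
    · rw [hsupp] at hzq
      refine le_trans ?_ (hcb z hzq v)
      have h1 : 3 * min (1 / 3) (c / (3 * M)) * M ≤ c := by
        have := min_le_right (1 / 3) (c / (3 * M))
        rw [le_div_iff₀ (by positivity)] at this
        linarith
      have h2 := (le_abs_self _).trans (hMb z hzq v)
      calc _ ≤ 3 * min (1 / 3) (c / (3 * M)) * (M * ‖v‖ ^ 2) :=
            mul_le_mul_of_nonneg_left h2 (by positivity)
        _ = 3 * min (1 / 3) (c / (3 * M)) * M * ‖v‖ ^ 2 := by ring
        _ ≤ _ := mul_le_mul_of_nonneg_right h1 (by positivity)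
    · rw [leviForm_eq_zero_of_notMem_tsupport hzq, mul_zero]
      rcases eq_or_ne v 0 with rfl | hv
      · simp [formInChart_zero]
      · exact (g.formInChart_re_pos he (hRe (ball_subset_closedBall hz)) hv).le

variable [MeasurableSpace X] [BorelSpace X]

namespace IsCutoff

theorem setLIntegral_map_le (hq : IsCutoff g e B q ε) (μ : Measure X) (hφ : φ ∈ classS₀ e.target)
    (hψ : ψ ∈ classS₀ e.target) {N : Set (Fin n → ℂ)} (hN : MeasurableSet N) (hNB : N ⊆ B)
    (h1 : ∀ z ∈ N, q z = 1) :
    ∫⁻ z in N, ENNReal.ofReal (ψ z - φ z) ∂((μ.restrict e.source).map e) ≤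
      ENNReal.ofReal ε⁻¹ *
        ∫⁻ x, ENNReal.ofReal (glue e B q ε ψ x - glue e B q ε φ x) ∂μ := by
  have hNe : N ⊆ e.target := hNB.trans hq.subset
  set F : (Fin n → ℂ) → ENNReal := N.indicator fun z =>
    ENNReal.ofReal (e.target.indicator ψ z - e.target.indicator φ z)
  have hF : Measurable F := (ENNReal.measurable_ofReal.comp
    ((measurable_indicator_of_upperSemicontinuousOn e.open_target hψ.1.1).sub
      (measurable_indicator_of_upperSemicontinuousOn e.open_target hφ.1.1))).indicator hN
  calc ∫⁻ z in N, ENNReal.ofReal (ψ z - φ z) ∂((μ.restrict e.source).map e)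
      = ∫⁻ z, F z ∂((μ.restrict e.source).map e) := by
        rw [← lintegral_indicator hN]
        congr 1
        ext z
        by_cases hz : z ∈ N
        · simp [F, hz, hNe hz]
        · simp [F, hz]
    _ = ∫⁻ x in e.source, F (e x) ∂μ := lintegral_map' hF.aemeasurable
        (e.continuousOn.aemeasurable e.open_source.measurableSet)
    _ ≤ ∫⁻ x in e.source, ENNReal.ofReal ε⁻¹ *
          ENNReal.ofReal (glue e B q ε ψ x - glue e B q ε φ x) ∂μ := by
        refine setLIntegral_mono' e.open_source.measurableSet fun x hx => ?_
        by_cases hz : e x ∈ N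
        · rw [hq.glue_of_cutoff_eq_one hφ hx (hNB hz) (h1 _ hz),
            hq.glue_of_cutoff_eq_one hψ hx (hNB hz) (h1 _ hz),
            ← ENNReal.ofReal_mul (inv_nonneg.2 hq.pos.le), ← mul_sub,
            inv_mul_cancel_left₀ hq.pos.ne']
          simp [F, hz, hNe hz]
        · simp [F, hz]
    _ ≤ ∫⁻ x, ENNReal.ofReal ε⁻¹ *
          ENNReal.ofReal (glue e B q ε ψ x - glue e B q ε φ x) ∂μ := setLIntegral_le_lintegral _ _
    _ = _ := lintegral_const_mul' _ _ ENNReal.ofReal_ne_top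

variable [T2Space X]

/-- The difference is supported in the compact support of `q`, where `ω^n` is comparable to Lebesgue
measure, and is at most `ε |φ - ψ|` with `ε ≤ 1`. -/
theorem exists_lintegral_glue_sub_le [IsManifold 𝓘(ℂ, Fin n → ℂ) ω X] (hq : IsCutoff g e B q ε) :
    ∃ C > 0, ∀ φ ∈ classS₀ e.target, ∀ ψ ∈ classS₀ e.target,
      ∫⁻ x, ENNReal.ofReal |glue e B q ε φ x - glue e B q ε ψ x| ∂g.volume ≤
        ENNReal.ofReal C * ∫⁻ z in e.target, ENNReal.ofReal |φ z - ψ z| := by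
  have hKe : tsupport q ⊆ e.target := hq.tsupport_subset.trans hq.subset
  obtain ⟨C, hC, hCb⟩ := exists_volume_restrict_le g hq.mem hq.compact hKe
  refine ⟨C, hC, fun φ hφ ψ hψ => ?_⟩
  set F : X → ENNReal := fun x => ENNReal.ofReal |glue e B q ε φ x - glue e B q ε ψ x|
  have hF : Measurable F := ENNReal.measurable_ofReal.comp
    (((hq.isQuasiPSH_glue hφ).measurable.sub (hq.isQuasiPSH_glue hψ).measurable).abs)
  have hS := measurableSet_source_inter_preimage e hq.compact.measurableSet
  calc ∫⁻ x, F x ∂g.volume = ∫⁻ x in e.source ∩ e ⁻¹' tsupport q, F x ∂g.volume := by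
        rw [setLIntegral_eq_of_support_subset]
        intro x hx
        by_contra h
        exact hx (by simp [F, hq.glue_eq_zero hφ h, hq.glue_eq_zero hψ h])
    _ ≤ ∫⁻ x, F x ∂(ENNReal.ofReal C • (volume.restrict (tsupport q)).map e.symm) :=
        lintegral_mono' hCb le_rfl
    _ = ENNReal.ofReal C * ∫⁻ z in tsupport q, F (e.symm z) := by
        rw [lintegral_smul_measure, smul_eq_mul, lintegral_map' hF.aemeasurable
          ((aemeasurable_symm e).mono_measure (Measure.restrict_mono_set _ hKe))]
    _ ≤ ENNReal.ofReal C * ∫⁻ z in tsupport q, ENNReal.ofReal |φ z - ψ z| := by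
        refine mul_le_mul_right ?_ _
        refine setLIntegral_mono' hq.compact.measurableSet fun z hz => ENNReal.ofReal_le_ofReal ?_
        have hz' := hKe hz
        have h1 := hq.abs_glue_sub_le (φ := φ) (ψ := ψ) (e.map_target hz')
          (by rw [e.right_inv hz']; exact hq.tsupport_subset hz)
        rw [e.right_inv hz'] at h1
        have h2 := hq.le_third
        nlinarith [abs_nonneg (φ z - ψ z)]
    _ ≤ _ := by
        gcongr

end IsCutoff

variable [CompactSpace X] [IsManifold 𝓘(ℂ, Fin n → ℂ) ω X] {μ : Measure X} {C α : ℝ}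

/-- For an ordered pair the difference of the integrals is the integral of the absolute difference,
so the hypothesis on the functional becomes an `L¹(μ)` bound. -/
theorem ofReal_abs_integral_le (hμ : ∀ v ∈ classS g, Integrable v μ) (hC : 0 < C) (hα : 0 < α)
    (H : ∀ u ∈ classS g, ∀ v ∈ classS g,
      |∫ x, u x ∂μ - ∫ x, v x ∂μ| ≤ C * (∫ x, |u x - v x| ∂g.volume) ^ α)
    {u v : X → ℝ} (hu : u ∈ classS g) (hv : v ∈ classS g) (huv : ∀ x, v x ≤ u x) :
    ∫⁻ x, ENNReal.ofReal (u x - v x) ∂μ ≤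
      ENNReal.ofReal C * (∫⁻ x, ENNReal.ofReal |u x - v x| ∂g.volume) ^ α := by
  have := isFiniteMeasure_volume g
  have hb {w : X → ℝ} (hw : w ∈ classS g) : Integrable w g.volume :=
    Integrable.of_bound hw.1.1.measurable.aestronglyMeasurable 1 (Eventually.of_forall fun x =>
      abs_le.2 ⟨(hw.2.1 x).1, (hw.2.1 x).2.trans zero_le_one⟩)
  rw [← ofReal_integral_eq_lintegral_ofReal (f := fun x => u x - v x) ((hμ u hu).sub (hμ v hv))
    (Eventually.of_forall fun x => sub_nonneg.2 (huv x)),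
    ← ofReal_integral_eq_lintegral_ofReal (f := fun x => |u x - v x|) ((hb hu).sub (hb hv)).abs
      (Eventually.of_forall fun x => abs_nonneg _),
    ENNReal.ofReal_rpow_of_nonneg (integral_nonneg fun _ => abs_nonneg _) hα.le,
    ← ENNReal.ofReal_mul hC.le]
  refine ENNReal.ofReal_le_ofReal ?_
  rw [integral_sub (hμ u hu) (hμ v hv)]
  exact (le_abs_self _).trans (H u hu v hv)

variable [T2Space X]

theorem IsCutoff.exists_setLIntegral_abs_sub_le (hq : IsCutoff g e B q ε)
    (hne : ∃ z ∈ e.target, z ∉ tsupport q)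
    (hμ : ∀ v ∈ classS g, Integrable v μ) (hC : 0 < C) (hα : 0 < α)
    (H : ∀ u ∈ classS g, ∀ v ∈ classS g,
      |∫ x, u x ∂μ - ∫ x, v x ∂μ| ≤ C * (∫ x, |u x - v x| ∂g.volume) ^ α)
    {N : Set (Fin n → ℂ)} (hN : MeasurableSet N) (hNB : N ⊆ B) (h1 : ∀ z ∈ N, q z = 1) :
    ∃ C' > 0, ∀ φ ∈ classS₀ e.target, ∀ ψ ∈ classS₀ e.target,
      ∫⁻ z in N, ENNReal.ofReal |φ z - ψ z| ∂((μ.restrict e.source).map e) ≤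
        ENNReal.ofReal C' * (∫⁻ z in e.target, ENNReal.ofReal |φ z - ψ z|) ^ α := by
  obtain ⟨D, hD, hDb⟩ := hq.exists_lintegral_glue_sub_le
  have hε := hq.pos
  have step : ∀ φ ∈ classS₀ e.target, ∀ ψ ∈ classS₀ e.target, (∀ z ∈ e.target, φ z ≤ ψ z) →
      ∫⁻ z in N, ENNReal.ofReal (ψ z - φ z) ∂((μ.restrict e.source).map e) ≤
        ENNReal.ofReal (ε⁻¹ * (C * D ^ α)) *
          (∫⁻ z in e.target, ENNReal.ofReal |ψ z - φ z|) ^ α := by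
    intro φ hφ ψ hψ h
    refine (hq.setLIntegral_map_le μ hφ hψ hN hNB h1).trans ?_
    rw [ENNReal.ofReal_mul (by positivity), ENNReal.ofReal_mul hC.le,
      ← ENNReal.ofReal_rpow_of_nonneg hD.le hα.le, mul_assoc, mul_assoc,
      ← ENNReal.mul_rpow_of_nonneg _ _ hα.le]
    gcongr
    refine (ofReal_abs_integral_le hμ hC hα H (hq.glue_mem_classS hψ hne)
      (hq.glue_mem_classS hφ hne) (hq.glue_mono h)).trans ?_
    gcongr
    exact hDb ψ hψ φ hφ
  refine ⟨2 * (ε⁻¹ * (C * D ^ α)), by positivity, fun φ hφ ψ hψ => ?_⟩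
  -- The maximum reduces to ordered pairs: `|φ - ψ| = (χ - φ) + (χ - ψ)`, and each summand is at
  -- most `|φ - ψ|`. The two summands account for the factor `2`.
  set χ : (Fin n → ℂ) → ℝ := fun z => max (φ z) (ψ z) with hχ
  have hχS : χ ∈ classS₀ e.target := classS₀.sup e.open_target hφ hψ
  have hmeas : AEMeasurable (fun z => ENNReal.ofReal (χ z - φ z))
      (((μ.restrict e.source).map e).restrict N) := by
    refine (ENNReal.measurable_ofReal.comp
      ((measurable_indicator_of_upperSemicontinuousOn e.open_target hχS.1.1).sub
      (measurable_indicator_of_upperSemicontinuousOn e.open_target hφ.1.1))).aemeasurable.congr ?_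
    refine ae_restrict_of_forall_mem hN fun z hz => ?_
    simp [hq.subset (hNB hz)]
  have hle {θ : (Fin n → ℂ) → ℝ} (hθ : ∀ z, |χ z - θ z| ≤ |φ z - ψ z|) :
      (∫⁻ z in e.target, ENNReal.ofReal |χ z - θ z|) ^ α ≤
        (∫⁻ z in e.target, ENNReal.ofReal |φ z - ψ z|) ^ α := by
    exact ENNReal.rpow_le_rpow
      (lintegral_mono fun z => ENNReal.ofReal_le_ofReal (hθ z)) hα.le
  have h2 := (step φ hφ χ hχS fun z _ => le_max_left _ _).trans (mul_le_mul_right (hle fun z => by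
    rw [hχ, abs_of_nonneg (sub_nonneg.2 (le_max_left _ _)), sub_le_iff_le_add]
    exact max_le (by linarith [abs_nonneg (φ z - ψ z)])
      (by linarith [neg_abs_le (φ z - ψ z)])) _)
  have h3 := (step ψ hψ χ hχS fun z _ => le_max_right _ _).trans (mul_le_mul_right (hle fun z => by
    rw [hχ, abs_of_nonneg (sub_nonneg.2 (le_max_right _ _)), sub_le_iff_le_add]
    exact max_le (by linarith [le_abs_self (φ z - ψ z)])
      (by linarith [abs_nonneg (φ z - ψ z)])) _)
  calc ∫⁻ z in N, ENNReal.ofReal |φ z - ψ z| ∂((μ.restrict e.source).map e)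
      = ∫⁻ z in N, (ENNReal.ofReal (χ z - φ z) + ENNReal.ofReal (χ z - ψ z))
          ∂((μ.restrict e.source).map e) := by
        congr 1
        ext z
        rw [← ENNReal.ofReal_add (sub_nonneg.2 (le_max_left _ _))
          (sub_nonneg.2 (le_max_right _ _))]
        congr 1
        rcases le_total (φ z) (ψ z) with h | h
        · simp only [max_eq_right h]; rw [abs_of_nonpos (by linarith)]; ring
        · simp only [max_eq_left h]; rw [abs_of_nonneg (by linarith)]; ring
    _ = _ := lintegral_add_left' hmeas _
    _ ≤ _ := add_le_add h2 h3
    _ = _ := by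
        rw [← two_mul, ENNReal.ofReal_mul zero_le_two, ENNReal.ofReal_ofNat, mul_assoc]

theorem IsHolderOnS.isLocallyHolderInChart (hn : 1 ≤ n) (h : IsHolderOnS g μ)
    (he : e ∈ IsManifold.maximalAtlas 𝓘(ℂ, Fin n → ℂ) ω X) : IsLocallyHolderInChart μ e := by
  obtain ⟨hμ, C, α, hC, hα, H⟩ := h
  intro Ω' hΩ' hK hKe
  have key : ∃ C' > 0, ∀ φ ∈ classS₀ e.target, ∀ ψ ∈ classS₀ e.target,
      ∫⁻ z in closure Ω', ENNReal.ofReal |φ z - ψ z| ∂((μ.restrict e.source).map e) ≤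
        ENNReal.ofReal C' * (∫⁻ z in e.target, ENNReal.ofReal |φ z - ψ z|) ^ α := by
    refine hK.induction_on (p := fun s => ∃ C' > 0, ∀ φ ∈ classS₀ e.target,
      ∀ ψ ∈ classS₀ e.target,
      ∫⁻ z in s, ENNReal.ofReal |φ z - ψ z| ∂((μ.restrict e.source).map e) ≤
        ENNReal.ofReal C' * (∫⁻ z in e.target, ENNReal.ofReal |φ z - ψ z|) ^ α) ?_ ?_ ?_ ?_
    · exact ⟨1, one_pos, fun φ _ ψ _ => by simp⟩
    · rintro s t hst ⟨C', hC', h'⟩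
      exact ⟨C', hC', fun φ hφ ψ hψ => (lintegral_mono_set hst).trans (h' φ hφ ψ hψ)⟩
    · rintro s t ⟨C₁, hC₁, h₁⟩ ⟨C₂, hC₂, h₂⟩
      refine ⟨C₁ + C₂, by positivity, fun φ hφ ψ hψ => (lintegral_union_le _ _ _).trans ?_⟩
      rw [ENNReal.ofReal_add hC₁.le hC₂.le, add_mul]
      exact add_le_add (h₁ φ hφ ψ hψ) (h₂ φ hφ ψ hψ)
    · intro z₀ hz₀
      obtain ⟨R, hR, hRe⟩ := nhds_basis_closedBall.mem_iff.1 (e.open_target.mem_nhds (hKe hz₀))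
      obtain ⟨q, ε, hq, hq1, hqs⟩ := exists_isCutoff (g := g) he z₀ hR hRe
      -- A point at distance `3 R / 4` lies in the chart but off the support, of radius `R / 2`, so
      -- the glued functions attain the supremum `0`. Such a point exists because `n ≥ 1`.
      have hne : ∃ z ∈ e.target, z ∉ tsupport q := by
        have hd : dist (z₀ + Pi.single (⟨0, hn⟩ : Fin n) ((3 * R / 4 : ℝ) : ℂ)) z₀ = 3 * R / 4 := by
          rw [dist_eq_norm, add_sub_cancel_left, Pi.norm_single, Complex.norm_real,
            Real.norm_of_nonneg (by positivity)]
        refine ⟨_, hRe (mem_closedBall.2 (hd.le.trans (by linarith))), ?_⟩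
        rw [hqs, mem_closedBall, hd]
        linarith
      exact ⟨ball z₀ (R / 3), mem_nhdsWithin_of_mem_nhds (ball_mem_nhds _ (by positivity)),
        hq.exists_setLIntegral_abs_sub_le hne hμ hC hα H measurableSet_ball
          (ball_subset_ball (by linarith)) hq1⟩
  obtain ⟨C', hC', h'⟩ := key
  exact ⟨C', α, hC', hα, fun φ hφ ψ hψ =>
    (lintegral_mono_set subset_closure).trans (h' φ hφ ψ hψ)⟩

end GlobalToLocal


/-! ### Euclidean balls are strictly pseudoconvex -/

section EuclideanBall

variable {n : ℕ}

/-- The open ball of `ℂⁿ` for the Euclidean norm. -/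
def euclideanBall (a : Fin n → ℂ) (r : ℝ) : Set (Fin n → ℂ) := {z | ∑ j, ‖z j - a j‖ ^ 2 < r ^ 2}

variable {a : Fin n → ℂ} {r : ℝ}

theorem isOpen_euclideanBall : IsOpen (euclideanBall a r) :=
  isOpen_lt (contDiff_sum_norm_sub_sq (m := 0) a).continuous continuous_const

theorem mem_euclideanBall_self (hr : 0 < r) : a ∈ euclideanBall a r := by
  simp [euclideanBall, pow_pos hr]

theorem euclideanBall_subset_ball (hr : 0 < r) : euclideanBall a r ⊆ ball a r := fun z hz => by
  rw [mem_ball, dist_eq_norm]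
  exact lt_of_pow_lt_pow_left₀ 2 hr.le ((norm_sq_le_sum (z - a)).trans_lt hz)

theorem closure_euclideanBall_subset {s : ℝ} (hs : 0 ≤ s) (hsr : s < r) :
    closure (euclideanBall a s) ⊆ euclideanBall a r := by
  refine (closure_lt_subset_le (contDiff_sum_norm_sub_sq (m := 0) a).continuous
    continuous_const).trans fun z hz => ?_
  exact lt_of_le_of_lt (show _ ≤ s ^ 2 from hz) (pow_lt_pow_left₀ hsr hs two_ne_zero)

theorem isConnected_euclideanBall (hr : 0 < r) : IsConnected (euclideanBall a r) := by
  refine ⟨⟨a, mem_euclideanBall_self hr⟩, Convex.isPreconnected ?_⟩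
  -- The norm on `Fin n → ℂ` is the supremum norm; convexity is pulled back from a ball of
  -- `EuclideanSpace`.
  have h : euclideanBall a r =
      (WithLp.linearEquiv 2 ℝ (Fin n → ℂ)).symm ⁻¹' ball (WithLp.toLp 2 a) r := by
    ext z
    rw [mem_preimage, mem_ball, EuclideanSpace.dist_eq, Real.sqrt_lt' hr]
    simp [euclideanBall, dist_eq_norm]
  rw [h]
  exact (convex_ball _ _).linear_preimage
    (WithLp.linearEquiv 2 ℝ (Fin n → ℂ)).symm.toLinearMap

theorem isStrictlyPseudoconvexDomain_euclideanBall (hr : 0 < r) :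
    IsStrictlyPseudoconvexDomain (euclideanBall a r) := by
  have hc : ContDiff ℝ 2 fun z : Fin n → ℂ => ∑ j, ‖z j - a j‖ ^ 2 := contDiff_sum_norm_sub_sq a
  refine ⟨isOpen_euclideanBall, isConnected_euclideanBall hr,
    isBounded_ball.subset (euclideanBall_subset_ball hr), univ,
    fun z => ∑ j, ‖z j - a j‖ ^ 2 + -r ^ 2, isOpen_univ, subset_univ _,
    (hc.add contDiff_const).contDiffOn, ?_, fun z hz h0 => ?_, fun z _ v hv => ?_⟩
  · ext z
    simp [euclideanBall]
  · have hz' : ∑ j, ‖z j - a j‖ ^ 2 = r ^ 2 :=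
      frontier_lt_subset_eq hc.continuous continuous_const hz
    rw [fderiv_add_const] at h0
    -- The radial derivative at a boundary point is `2 r²`, so the differential does not vanish
    -- there.
    have h1 := fderiv_sum_norm_sub_sq a z (z - a)
    rw [h0] at h1
    simp only [Pi.sub_apply, real_inner_self_eq_norm_sq, ← Finset.mul_sum, hz'] at h1
    have : (0 : ℝ) = 2 * r ^ 2 := by simpa using h1
    nlinarith
  · have h2 : leviForm (fun _ : Fin n → ℂ => -r ^ 2) z v = 0 := by simp [leviForm_eq]
    rw [leviForm_add hc.contDiffAt contDiffAt_const, h2, leviForm_sum_norm_sub_sq, add_zero]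
    have := norm_sq_le_sum v
    have : 0 < ‖v‖ := norm_pos_iff.2 hv
    nlinarith

end EuclideanBall

/-! ### Integrals transported by a chart -/

section MapChart

variable {n : ℕ} {X : Type*} [TopologicalSpace X] [MeasurableSpace X] [BorelSpace X]

theorem setLIntegral_source_inter_preimage (e : OpenPartialHomeomorph X (Fin n → ℂ))
    (μ : Measure X) {F : X → ENNReal} (hF : Measurable F) {N : Set (Fin n → ℂ)}
    (hN : MeasurableSet N) (hNe : N ⊆ e.target) :
    ∫⁻ x in e.source ∩ e ⁻¹' N, F x ∂μ =
      ∫⁻ z in N, F (e.symm z) ∂((μ.restrict e.source).map e) := by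
  have hem : AEMeasurable e (μ.restrict e.source) :=
    e.continuousOn.aemeasurable e.open_source.measurableSet
  have h1 : AEMeasurable (fun z => F (e.symm z)) (((μ.restrict e.source).map e).restrict N) :=
    hF.comp_aemeasurable ((e.continuousOn_symm.mono hNe).aemeasurable hN)
  have hres : (μ.restrict e.source).restrict (e ⁻¹' N) = μ.restrict (e.source ∩ e ⁻¹' N) := by
    rw [Measure.restrict_restrict' e.open_source.measurableSet, inter_comm]
  rw [Measure.restrict_map_of_aemeasurable hem hN, hres] at h1 ⊢
  rw [lintegral_map' h1 (hem.mono_measure (Measure.restrict_mono_set _ inter_subset_left))]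
  refine setLIntegral_congr_fun (measurableSet_source_inter_preimage e hN) fun x hx => ?_
  simp only [e.left_inv hx.1]

end MapChart

/-! ### From local estimates to the global one -/

section LocalToGlobal

variable {n : ℕ} {X : Type*} [TopologicalSpace X] [ChartedSpace (Fin n → ℂ) X]
  {g : HermitianMetric n X} {e : OpenPartialHomeomorph X (Fin n → ℂ)} {u : X → ℝ}

/-- The psh part satisfies the sub-mean inequality exactly and the smooth part up to `δ` by
continuity. This asymptotic form is all that `tendsto_mollify` requires. -/
theorem IsQuasiPSH.eventually_sub_le_discMean (hu : IsQuasiPSH n u)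
    (he : e ∈ IsManifold.maximalAtlas 𝓘(ℂ, Fin n → ℂ) ω X) {z : Fin n → ℂ} (hz : z ∈ e.target)
    {δ : ℝ} (hδ : 0 < δ) :
    ∀ᶠ b in 𝓝 (0 : Fin n → ℂ), u (e.symm z) - δ ≤ discMean (fun w => u (e.symm w)) z b := by
  obtain ⟨V, p, f, hV, hzV, -, hp, hf, h⟩ := hu e he z hz
  filter_upwards [eventually_disc_subset hV hzV,
    sub_le_discMean_of_continuousAt hV hf.continuousOn hzV hδ] with b hb hfb
  have hfi : CircleIntegrable (fun ζ : ℂ => f (z + ζ • b)) 0 1 :=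
    ContinuousOn.circleIntegrable zero_le_one (hf.continuousOn.comp
      (continuous_disc z b).continuousOn fun ζ hζ => hb ζ (mem_sphere_zero_iff_norm.1 hζ).le)
  rw [discMean_congr (w := fun w => p w + f w) fun ζ hζ => h _ (hb ζ hζ.le),
    discMean_add (hp.2 z b hb).1 hfi, h z hzV]
  have := hp.le_discMean hb
  linarith

/-- On `Ω` the metric is at most `C ‖v‖²`, so positivity of `ω + dd^c u` gives `u` the
distributional lower bound `-C ‖v‖²`, which the Levi form of `ρ` compensates. -/
theorem IsOmegaPSH.isPSHOn_add (hu : IsOmegaPSH g u) (hub : ∀ x, |u x| ≤ 1)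
    (he : e ∈ IsManifold.maximalAtlas 𝓘(ℂ, Fin n → ℂ) ω X) {Ω : Set (Fin n → ℂ)}
    (hΩ : IsOpen Ω) (hΩe : Ω ⊆ e.target) {C : ℝ}
    (hC : ∀ z ∈ Ω, ∀ v, (formInChart g.form e z v v).re ≤ C * ‖v‖ ^ 2)
    {ρ : (Fin n → ℂ) → ℝ} (hρ : ContDiffOn ℝ 2 ρ Ω)
    (hρC : ∀ z ∈ Ω, ∀ v, C * ‖v‖ ^ 2 ≤ leviForm ρ z v) :
    IsPSHOn (fun z => u (e.symm z) + ρ z) Ω := by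
  have husc := hu.1.upperSemicontinuousOn he
  have hm := measurable_indicator_of_upperSemicontinuousOn e.open_target husc
  have hM : ∀ z, |e.target.indicator (fun z => u (e.symm z)) z| ≤ 1 :=
    abs_indicator_le (fun z _ => hub _) zero_le_one
  refine ⟨(husc.mono hΩe).add hρ.continuousOn.upperSemicontinuousOn, fun a b hab => ⟨?_, ?_⟩⟩
  · refine CircleIntegrable.add (f := fun ζ : ℂ => u (e.symm (a + ζ • b)))
      (g := fun ζ : ℂ => ρ (a + ζ • b)) ?_ ?_
    · exact circleIntegrable_disc (u := fun w => u (e.symm w)) hm (fun z _ => hub _)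
        fun ζ hζ => hΩe (hab ζ hζ)
    · exact ContinuousOn.circleIntegrable zero_le_one (hρ.continuousOn.comp
        (continuous_disc a b).continuousOn fun ζ hζ => hab ζ (mem_sphere_zero_iff_norm.1 hζ).le)
  · have key := le_circleAverage_comp_of_distribution (m := fun v => C * ‖v‖ ^ 2)
      (γ := fun ζ : ℂ => a + ζ • b) (U := univ) hm hM hΩ
      (fun z hz δ hδ => eventually_indicator_le e.open_target husc (hΩe hz) hδ)
      (fun z hz δ hδ => by
        filter_upwards [hu.1.eventually_sub_le_discMean he (hΩe hz) hδ,
          eventually_disc_subset e.open_target (hΩe hz)] with b h1 h2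
        rwa [indicator_of_mem (hΩe hz), discMean_indicator h2])
      (fun v χ hχ hc hs hχ0 => by
        have hχ2 : ContDiff ℝ 2 χ := hχ.of_le (by norm_cast)
        have h1 := hu.2 e he v χ hχ hc (hs.trans hΩe) hχ0
        have h2 : Integrable fun z =>
            e.target.indicator (fun z => u (e.symm z)) z * leviForm χ z v :=
          integrable_bdd_mul hm hM ((continuous_leviForm hχ2 v).integrable_of_hasCompactSupport
            (hasCompactSupport_leviForm hc v))
        have h3 := g.integrable_mul_formInChart he hχ.continuous hc (hs.trans hΩe) v
        have h4 : Integrable fun z => χ z * (C * ‖v‖ ^ 2) :=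
          (hχ.continuous.integrable_of_hasCompactSupport hc).mul_const _
        have h5 : ∫ z in e.target, (χ z * (formInChart g.form e z v v).re +
            u (e.symm z) * leviForm χ z v) = ∫ z, (χ z * (formInChart g.form e z v v).re +
            e.target.indicator (fun z => u (e.symm z)) z * leviForm χ z v) := by
          refine Eq.trans ?_ (setIntegral_eq_integral_of_forall_compl_eq_zero (s := e.target) ?_)
          · refine setIntegral_congr_fun e.open_target.measurableSet fun z hz => ?_
            simp only [indicator_of_mem hz]
          · intro z hz
            have hz' : z ∉ tsupport χ := fun h => hz (hΩe (hs h))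
            simp [image_eq_zero_of_notMem_tsupport hz', leviForm_eq_zero_of_notMem_tsupport hz']
        rw [h5] at h1
        refine h1.trans (integral_mono (h3.add h2) (h4.add h2) fun z => ?_)
        simp only [add_le_add_iff_right]
        by_cases hz : z ∈ tsupport χ
        · exact mul_le_mul_of_nonneg_left (hC z (hs hz) v) (hχ0 z)
        · simp [image_eq_zero_of_notMem_tsupport hz])
      hρ hρC isOpen_univ (subset_univ _) (by fun_prop)
      fun ζ hζ => hab ζ (mem_closedBall_zero_iff.1 hζ)
    simp only [zero_smul, add_zero] at key
    have ha : a ∈ Ω := by simpa using hab 0 (by simp)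
    rw [indicator_of_mem (hΩe ha)] at key
    refine key.trans_eq (discMean_congr (u := fun w =>
      e.target.indicator (fun z => u (e.symm z)) w + ρ w) (w := fun w => u (e.symm w) + ρ w)
      fun ζ hζ => ?_)
    simp only [indicator_of_mem (hΩe (hab ζ hζ.le))]

theorem exists_comp_symm_add_mem_classS₀
    (he : e ∈ IsManifold.maximalAtlas 𝓘(ℂ, Fin n → ℂ) ω X) {a : Fin n → ℂ} {r : ℝ} (hr : 0 < r)
    (hre : closedBall a r ⊆ e.target) :
    ∃ (T : ℝ) (ρ : (Fin n → ℂ) → ℝ), 1 ≤ T ∧ ∀ u ∈ classS g,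
      (fun z => T⁻¹ * (u (e.symm z) + ρ z)) ∈ classS₀ (euclideanBall a r) := by
  obtain ⟨C, hC, hCb⟩ := g.exists_formInChart_le he (isCompact_closedBall a r) hre
  have hsub : euclideanBall a r ⊆ closedBall a r :=
    (euclideanBall_subset_ball hr).trans ball_subset_closedBall
  have hs : ContDiff ℝ 2 fun z : Fin n → ℂ => ∑ j, ‖z j - a j‖ ^ 2 := contDiff_sum_norm_sub_sq a
  have hCr : 0 < C * r ^ 2 := by positivity
  -- On the ball `-C r² ≤ ρ ≤ 0`, so `u + ρ` takes values in `[-T, 0]` with `T = 1 + C r²`.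
  refine ⟨1 + C * r ^ 2, fun z => C * ∑ j, ‖z j - a j‖ ^ 2 + -(C * r ^ 2), by linarith,
    fun u hu => ⟨?_, fun z hz => ?_⟩⟩
  · refine IsPSHOn.const_mul isOpen_euclideanBall ?_ (by positivity)
    refine hu.1.isPSHOn_add (fun x => abs_le.2 ⟨(hu.2.1 x).1, (hu.2.1 x).2.trans zero_le_one⟩) he
      isOpen_euclideanBall (hsub.trans hre) (fun z hz v => hCb z (hsub hz) v)
      ((contDiff_const.mul hs).add contDiff_const).contDiffOn fun z _ v => ?_
    have h2 : leviForm (fun _ : Fin n → ℂ => -(C * r ^ 2)) z v = 0 := by simp [leviForm_eq]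
    rw [leviForm_add (contDiff_const.mul hs).contDiffAt contDiffAt_const, h2, add_zero,
      leviForm_const_mul hs.contDiffAt, leviForm_sum_norm_sub_sq]
    refine mul_le_mul_of_nonneg_left ?_ hC.le
    have := norm_sq_le_sum v
    nlinarith [sq_nonneg ‖v‖]
  · have h1 := hu.2.1 (e.symm z)
    have h2 : 0 ≤ C * ∑ j, ‖z j - a j‖ ^ 2 :=
      mul_nonneg hC.le (Finset.sum_nonneg fun j _ => by positivity)
    have h3 : C * ∑ j, ‖z j - a j‖ ^ 2 ≤ C * r ^ 2 :=
      mul_le_mul_of_nonneg_left (show _ < r ^ 2 from hz).le hC.le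
    constructor
    · rw [le_inv_mul_iff₀ (by positivity)]
      linarith
    · exact mul_nonpos_of_nonneg_of_nonpos (by positivity) (by linarith)

theorem exists_restr_target_eq (he : e ∈ IsManifold.maximalAtlas 𝓘(ℂ, Fin n → ℂ) ω X)
    {Ω : Set (Fin n → ℂ)} (hΩ : IsOpen Ω) (hΩe : Ω ⊆ e.target) :
    ∃ e' ∈ IsManifold.maximalAtlas 𝓘(ℂ, Fin n → ℂ) ω X, e'.target = Ω ∧
      e'.source = e.source ∩ e ⁻¹' Ω ∧ (∀ x, e' x = e x) ∧ ∀ z, e'.symm z = e.symm z := by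
  have hs : IsOpen (e.source ∩ e ⁻¹' Ω) := e.isOpen_inter_preimage hΩ
  refine ⟨e.restr (e.source ∩ e ⁻¹' Ω), restr_mem_maximalAtlas _ he hs, ?_, ?_, fun _ => rfl,
    fun _ => rfl⟩
  · rw [OpenPartialHomeomorph.restr_toPartialEquiv, hs.interior_eq]
    ext z
    simp only [PartialEquiv.restr_target, mem_inter_iff, mem_preimage]
    constructor
    · rintro ⟨h1, -, h2⟩
      exact (congrArg (· ∈ Ω) (e.right_inv h1)).mp h2
    · exact fun h => ⟨hΩe h, e.map_target (hΩe h),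
      (congrArg (· ∈ Ω) (e.right_inv (hΩe h))).mpr h⟩
  · rw [e.restr_source' _ hs, ← inter_assoc, inter_self]

variable [MeasurableSpace X] [BorelSpace X]

theorem classS.measurable [IsManifold 𝓘(ℂ, Fin n → ℂ) ω X] {u v : X → ℝ} (hu : u ∈ classS g)
    (hv : v ∈ classS g) : Measurable fun x => ENNReal.ofReal |u x - v x| :=
  ENNReal.measurable_ofReal.comp ((hu.1.1.measurable.sub hv.1.1.measurable).abs)

theorem exists_nhds_lintegral_abs_sub_le [IsManifold 𝓘(ℂ, Fin n → ℂ) ω X] {μ : Measure X}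
    (h : ∀ e ∈ IsManifold.maximalAtlas 𝓘(ℂ, Fin n → ℂ) ω X,
      IsStrictlyPseudoconvexDomain e.target → IsLocallyHolderInChart μ e) (x : X) :
    ∃ S ∈ 𝓝 x, μ S < ⊤ ∧ ∃ C α : ℝ, 0 < C ∧ 0 < α ∧ ∀ u ∈ classS g, ∀ v ∈ classS g,
      ∫⁻ x in S, ENNReal.ofReal |u x - v x| ∂μ ≤
        ENNReal.ofReal C * (∫⁻ x, ENNReal.ofReal |u x - v x| ∂g.volume) ^ α := by
  set e := chartAt (Fin n → ℂ) x
  have hx : x ∈ e.source := mem_chart_source _ x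
  have he : e ∈ IsManifold.maximalAtlas 𝓘(ℂ, Fin n → ℂ) ω X := IsManifold.chart_mem_maximalAtlas x
  obtain ⟨r, hr, hre⟩ := nhds_basis_closedBall.mem_iff.1 (e.open_target.mem_nhds (e.map_source hx))
  set a := e x
  have hsub : euclideanBall a r ⊆ closedBall a r :=
    (euclideanBall_subset_ball hr).trans ball_subset_closedBall
  obtain ⟨e', he', het, hes, hee, hees⟩ :=
    exists_restr_target_eq he isOpen_euclideanBall (hsub.trans hre)
  have hloc := h e' he' (het ▸ isStrictlyPseudoconvexDomain_euclideanBall hr)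
  have hcl : closure (euclideanBall a (r / 2)) ⊆ euclideanBall a r :=
    closure_euclideanBall_subset (by positivity) (by linarith)
  have hcl' : closure (euclideanBall a (r / 2)) ⊆ e'.target := het ▸ hcl
  obtain ⟨C, α, hC, hα, H⟩ := hloc (euclideanBall a (r / 2)) isOpen_euclideanBall
    (isCompact_closedBall a r |>.of_isClosed_subset isClosed_closure (hcl.trans hsub)) hcl'
  rw [het] at H
  obtain ⟨T, ρ, hT, hTS⟩ := exists_comp_symm_add_mem_classS₀ (g := g) he hr hre
  obtain ⟨D, hD, hDb⟩ := exists_map_symm_le g he (isCompact_closedBall a r) hre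
  have hTpos : 0 < T := by linarith
  refine ⟨e'.source ∩ e' ⁻¹' euclideanBall a (r / 2), ?_, ?_, T * (C * D ^ α), α, by positivity,
    hα, fun u hu v hv => ?_⟩
  · have hx' : x ∈ e'.source := by
      rw [hes]
      exact ⟨hx, mem_euclideanBall_self hr⟩
    refine (e'.isOpen_inter_preimage isOpen_euclideanBall).mem_nhds ⟨hx', ?_⟩
    rw [mem_preimage, hee]
    exact mem_euclideanBall_self (by positivity)
  -- For the constants `-1` and `0` the left side is the mass of the half ball, and the right side
  -- is finite.
  · have h1 := H (fun _ => -1) ⟨isPSHOn_const isOpen_euclideanBall _, fun _ _ => by norm_num⟩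
      (fun _ => 0) ⟨isPSHOn_const isOpen_euclideanBall _, fun _ _ => by norm_num⟩
    rw [← setLIntegral_source_inter_preimage e' μ measurable_const
      isOpen_euclideanBall.measurableSet (subset_closure.trans hcl')] at h1
    simp only [sub_zero, abs_neg, abs_one, ENNReal.ofReal_one, setLIntegral_one] at h1
    refine h1.trans_lt (ENNReal.mul_lt_top ENNReal.ofReal_lt_top
      (ENNReal.rpow_lt_top_of_nonneg hα.le ?_))
    exact ((measure_mono hsub).trans_lt measure_closedBall_lt_top).ne
  · have hm := classS.measurable hu hv
    have h1 (z : Fin n → ℂ) : ENNReal.ofReal |u (e.symm z) - v (e.symm z)| = ENNReal.ofReal T *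
        ENNReal.ofReal |T⁻¹ * (u (e.symm z) + ρ z) - T⁻¹ * (v (e.symm z) + ρ z)| := by
      rw [← ENNReal.ofReal_mul hTpos.le, ← mul_sub, abs_mul, abs_of_pos (inv_pos.2 hTpos),
        mul_inv_cancel_left₀ hTpos.ne', add_sub_add_right_eq_sub]
    have h2 : ∫⁻ z in euclideanBall a r, ENNReal.ofReal
        |T⁻¹ * (u (e.symm z) + ρ z) - T⁻¹ * (v (e.symm z) + ρ z)| ≤
        ENNReal.ofReal D * ∫⁻ x, ENNReal.ofReal |u x - v x| ∂g.volume := by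
      calc _ ≤ ∫⁻ z in closedBall a r, ENNReal.ofReal |u (e.symm z) - v (e.symm z)| := by
            refine (lintegral_mono_set hsub).trans (lintegral_mono fun z => ?_)
            simp only [h1]
            exact le_mul_of_one_le_left' (ENNReal.one_le_ofReal.2 hT)
        _ = ∫⁻ x, ENNReal.ofReal |u x - v x| ∂((volume.restrict (closedBall a r)).map e.symm) :=
            (lintegral_map' hm.aemeasurable ((aemeasurable_symm e).mono_measure
              (Measure.restrict_mono_set _ hre))).symm
        _ ≤ _ := by
            refine (lintegral_mono' hDb le_rfl).trans_eq ?_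
            rw [lintegral_smul_measure, smul_eq_mul]
    rw [setLIntegral_source_inter_preimage e' μ hm isOpen_euclideanBall.measurableSet
      (subset_closure.trans hcl')]
    simp only [hees, h1]
    rw [lintegral_const_mul' _ _ ENNReal.ofReal_ne_top, ENNReal.ofReal_mul hTpos.le,
      ENNReal.ofReal_mul hC.le, ← ENNReal.ofReal_rpow_of_nonneg hD.le hα.le, mul_assoc, mul_assoc,
      ← ENNReal.mul_rpow_of_nonneg _ _ hα.le]
    refine mul_le_mul_right ((H _ (hTS u hu) _ (hTS v hv)).trans ?_) _
    gcongr

/-- Lowers a Hölder exponent at the cost of a constant, with `W` the total volume. -/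
theorem rpow_le_mul_rpow {D W : ENNReal} (hDW : D ≤ W) {α β : ℝ} (hα : 0 ≤ α) (hαβ : α ≤ β) :
    D ^ β ≤ W ^ (β - α) * D ^ α := by
  calc D ^ β = D ^ (β - α) * D ^ α := by
        rw [← ENNReal.rpow_add_of_nonneg _ _ (sub_nonneg.2 hαβ) hα, sub_add_cancel]
    _ ≤ _ := by gcongr

theorem isHolderOnS_of_charts [CompactSpace X] [IsManifold 𝓘(ℂ, Fin n → ℂ) ω X] {μ : Measure X}
    (h : ∀ e ∈ IsManifold.maximalAtlas 𝓘(ℂ, Fin n → ℂ) ω X,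
      IsStrictlyPseudoconvexDomain e.target → IsLocallyHolderInChart μ e) :
    IsHolderOnS g μ := by
  have hfin := isFiniteMeasure_volume g
  have hle {u v : X → ℝ} (hu : u ∈ classS g) (hv : v ∈ classS g) :
      ∫⁻ x, ENNReal.ofReal |u x - v x| ∂g.volume ≤ g.volume univ := by
    rw [← lintegral_one]
    refine lintegral_mono fun x => ENNReal.ofReal_le_one.2 (abs_le.2 ?_)
    have h1 := hu.2.1 x
    have h2 := hv.2.1 x
    constructor <;> linarith
  -- Asking for the estimate at every exponent up to `β` makes the property stable under unions,
  -- with the smaller of the two bounds. Finiteness of `μ` is carried along for integrability.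
  have key : μ univ < ⊤ ∧ ∃ β > 0, ∀ α : ℝ, 0 < α → α ≤ β → ∃ C > 0, ∀ u ∈ classS g,
      ∀ v ∈ classS g, ∫⁻ x in univ, ENNReal.ofReal |u x - v x| ∂μ ≤
        ENNReal.ofReal C * (∫⁻ x, ENNReal.ofReal |u x - v x| ∂g.volume) ^ α := by
    refine isCompact_univ.induction_on (p := fun S => μ S < ⊤ ∧ ∃ β > 0, ∀ α : ℝ, 0 < α → α ≤ β →
      ∃ C > 0, ∀ u ∈ classS g, ∀ v ∈ classS g, ∫⁻ x in S, ENNReal.ofReal |u x - v x| ∂μ ≤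
        ENNReal.ofReal C * (∫⁻ x, ENNReal.ofReal |u x - v x| ∂g.volume) ^ α) ?_ ?_ ?_ ?_
    · exact ⟨by simp, 1, one_pos, fun _ _ _ => ⟨1, one_pos, fun u _ v _ => by simp⟩⟩
    · rintro s t hst ⟨h1, β, hβ, h2⟩
      refine ⟨(measure_mono hst).trans_lt h1, β, hβ, fun α hα hαβ => ?_⟩
      obtain ⟨C, hC, h3⟩ := h2 α hα hαβ
      exact ⟨C, hC, fun u hu v hv => (lintegral_mono_set hst).trans (h3 u hu v hv)⟩
    · rintro s t ⟨h1, β₁, hβ₁, hs⟩ ⟨h2, β₂, hβ₂, ht⟩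
      refine ⟨measure_union_lt_top h1 h2, min β₁ β₂, lt_min hβ₁ hβ₂, fun α hα hαβ => ?_⟩
      obtain ⟨C₁, hC₁, h₁⟩ := hs α hα (hαβ.trans (min_le_left _ _))
      obtain ⟨C₂, hC₂, h₂⟩ := ht α hα (hαβ.trans (min_le_right _ _))
      refine ⟨C₁ + C₂, by positivity, fun u hu v hv => (lintegral_union_le _ _ _).trans ?_⟩
      rw [ENNReal.ofReal_add hC₁.le hC₂.le, add_mul]
      exact add_le_add (h₁ u hu v hv) (h₂ u hu v hv)
    · intro x _
      obtain ⟨S, hS, hμS, C, β, hC, hβ, H⟩ := exists_nhds_lintegral_abs_sub_le (g := g) h x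
      refine ⟨S, mem_nhdsWithin_of_mem_nhds hS, hμS, β, hβ, fun α hα hαβ =>
        ⟨C * ((g.volume univ ^ (β - α)).toReal + 1), by positivity, fun u hu v hv => ?_⟩⟩
      refine (H u hu v hv).trans ?_
      rw [ENNReal.ofReal_mul hC.le, mul_assoc]
      refine mul_le_mul_right ((rpow_le_mul_rpow (hle hu hv) hα.le hαβ).trans
        (mul_le_mul_left ?_ _)) _
      refine (ENNReal.le_ofReal_iff_toReal_le ?_ (by positivity)).2 (by linarith)
      exact ENNReal.rpow_ne_top_of_nonneg (sub_nonneg.2 hαβ) (measure_ne_top _ _)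
  obtain ⟨hμ, β, hβ, hβC⟩ := key
  obtain ⟨C, hC, H⟩ := hβC β hβ le_rfl
  have hμ' : IsFiniteMeasure μ := ⟨hμ⟩
  have hint (m : Measure X) [IsFiniteMeasure m] {w : X → ℝ} (hw : w ∈ classS g) :
      Integrable w m :=
    Integrable.of_bound hw.1.1.measurable.aestronglyMeasurable 1 (Eventually.of_forall fun x =>
      abs_le.2 ⟨(hw.2.1 x).1, (hw.2.1 x).2.trans zero_le_one⟩)
  refine ⟨fun v hv => hint μ hv, C, β, hC, hβ, fun u hu v hv => ?_⟩
  have h1 := H u hu v hv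
  rw [Measure.restrict_univ, ← ofReal_integral_eq_lintegral_ofReal (f := fun x => |u x - v x|)
    ((hint μ hu).sub (hint μ hv)).abs (Eventually.of_forall fun x => abs_nonneg _),
    ← ofReal_integral_eq_lintegral_ofReal (f := fun x => |u x - v x|)
    ((hint g.volume hu).sub (hint g.volume hv)).abs (Eventually.of_forall fun x => abs_nonneg _),
    ENNReal.ofReal_rpow_of_nonneg (integral_nonneg fun _ => abs_nonneg _) hβ.le,
    ← ENNReal.ofReal_mul hC.le, ENNReal.ofReal_le_ofReal_iff (by positivity)] at h1
  rw [← integral_sub (hint μ hu) (hint μ hv)]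
  exact (abs_integral_le_integral_abs).trans h1

end LocalToGlobal

end

theorem mainTheorem9 {n : ℕ} (hn : 1 ≤ n) {X : Type*} [TopologicalSpace X] [T2Space X]
    [CompactSpace X] [ChartedSpace (Fin n → ℂ) X] [IsManifold 𝓘(ℂ, Fin n → ℂ) ω X]
    [MeasurableSpace X] [BorelSpace X] (g : HermitianMetric n X) (μ : Measure X) :
    (IsHolderOnS g μ ↔
      ∀ e ∈ IsManifold.maximalAtlas 𝓘(ℂ, Fin n → ℂ) ω X,
        IsStrictlyPseudoconvexDomain e.target → IsLocallyHolderInChart μ e) ∧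
    (IsHolderOnS g μ ↔
      ∀ e ∈ IsManifold.maximalAtlas 𝓘(ℂ, Fin n → ℂ) ω X, IsLocallyHolderInChart μ e) := by
  have hglobal : IsHolderOnS g μ → ∀ e ∈ IsManifold.maximalAtlas 𝓘(ℂ, Fin n → ℂ) ω X,
      IsLocallyHolderInChart μ e := fun h e he => h.isLocallyHolderInChart hn he
  exact ⟨⟨fun h e he _ => hglobal h e he, isHolderOnS_of_charts⟩,
    ⟨hglobal, fun h => isHolderOnS_of_charts fun e he _ => h e he⟩⟩
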